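/- **Model.** On a probability space let $0=\tau_0<\tau_1<\tau_2<\cdots$ be trading dates, $S>0$ a stock price with $S_0$ known, $Z_k=(S_{\tau_k}-S_{\tau_{k-1}})/S_{\tau_{k-1}}$ for $k\ge1$, and $Z_0$ a constant. Put $\mathcal G_t=\sigma\{(\tau_k,Z_k):\tau_k\le t\}$ and $\mathcal G_{\tau_k}=\sigma\{(\tau_i,Z_i):i\le k\}$. Fix $\lambda,\rho>0$, $\underline z\in(0,1]$, $\bar z\in(0,+\infty]$, constants $k,b\ge0$, and a probability kernel $p(t,dz)$, and assume: (H) The $\tau_k$, $k\ge1$, are the jumps of a Poisson process of intensity $\lambda$ relative to the observations: each $\tau_{k+1}-\tau_k$ is exponential with parameter $\lambda$ and independent of $\mathcal G_{\tau_k}$. Given $\mathcal G_{\tau_k}$ and $\tau_{k+1}-\tau_k=t$, the return $Z_{k+1}$ has law $p(t,dz)$. For every $t>0$: the support of $p(t,\cdot)$ is either an interval with interior $(-\underline z,\bar z)$, or finite with smallest element $-\underline z$ and largest element $\bar z<\infty$; the mean $\int z\,p(t,dz)$ exists and is $\ge0$; $\int(1+z)\,p(t,dz)\le ke^{bt}$.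 For every measurable $w$ of linear growth, $t\mapsto\int w(z)\,p(t,dz)$ is continuous on $(0,\infty)$. (U) $U:[0,\infty)\to\mathbb R$ is strictly increasing, strictly concave, $C^1$ on $(0,\infty)$, with $U(0)=0$, $U'(0^+)=+\infty$, $U'(+\infty)=0$, and for some $\gamma\in(0,1)$, $K_1>0$: $U(x)\le K_1x^\gamma$ for all $x\ge 0$, and $\rho>b\gamma+\lambda\big(k^\gamma/\underline z^{\gamma}-1\big)$. Let $l(a)=\max(a\underline z,-a\bar z)$, $A=\mathbb R$ if $\bar z<\infty$, and $l(a)=a\underline z$, $A=[0,\infty)$ if $\bar z=\infty$. (S) For every $a\in A\setminus\{0\}$ and every continuous $w:\mathbb R\to\mathbb R$ of linear growth, $(t,x)\mapsto\lambda\int w(x+az)\,p(t,dz)$ is locally semiconcave on $(0,\infty)\times(l(a),\infty)$. (A function $u$ is locally semiconcave if for every compact subset $K$ of its domain there is a nondecreasing upper semicontinuous $\omega:[0,\infty)\to[0,\infty)$ with $\omega(0^+)=0$ and $\eta u(x_1)+(1-\eta)u(x_2)-u(\eta x_1+(1-\eta)x_2)\le\eta(1-\eta)|x_1-x_2|\,\omega(|x_1-x_2|)$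 for all segments $[x_1,x_2]\subset K$ and $\eta\in[0,1]$.) **Value functions.** For $x\ge0$ let $v(x)=\sup E\int_0^\infty e^{-\rho t}U(c_t)\,dt$ over all pairs $(\alpha,c)$ with $\alpha_k$ real-valued and $\mathcal G_{\tau_{k-1}}$-measurable, $c\ge0$ predictable for $(\mathcal G_t)$, and $x-\int_0^{\tau_k}c_t\,dt+\sum_{i=1}^k\alpha_iZ_i\ge0$ a.s. for all $k\ge1$. Put $g(t,x,a)=\lambda\int v(x+az)\,p(t,dz)$. For $t\ge0$, $a\in A$, $x\ge l(a)$ let $$\hat v(t,x,a)=\sup_{c}\int_t^\infty e^{-(\rho+\lambda)(s-t)}\big[U(c_s)+g(s,Y_s,a)\big]ds,\qquad Y_s=x-\int_t^sc_u\,du,$$ where $c$ ranges over the deterministic measurable nonnegative functions on $[t,\infty)$ with $Y_s\ge l(a)$ for all $s\ge t$. **Proposition.** Let $a\in A$, $t\ge0$, $x\ge l(a)$. The auxiliary problem started at $(t,x)$ has an optimal couple $(\bar c,\bar Y)$. It is unique ($\bar c$ up to Lebesgue-null sets), and $\bar c$ is taken in its feedback version: whenever $s\ge t$ and $\bar Y_s>l(a)$,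 $\hat v(s,\cdot,a)$ is differentiable at $\bar Y_s$, $\bar c_s>0$ and $U'(\bar c_s)=\frac{\partial\hat v}{\partial x}(s,\bar Y_s,a)$; and $\bar c_s=0$ if $x=l(a)$. Moreover: * if $x=l(a)$, then $\bar c\equiv0$ and $\bar Y\equiv l(a)$ on $[t,\infty)$; * if $x>l(a)$, then $\bar c$ is continuous and strictly positive on $[t,\infty)$, and $\lim_{s\to+\infty}\bar c_s=0$. -/

import Mathlib

open MeasureTheory ProbabilityTheory Set Filter Topology
open scoped ENNReal NNReal

/-- The data of the illiquid market: trading dates `τ k`, stock price `S`, a conventional constant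
`Z₀` for the return at date `0`, intensity `lam`, discount rate `rho`, the conditional return laws
`p t` given a waiting time `t`, the end points `-zlo` and `zhi` (possibly infinite) of the range of
the returns, and the utility function `U` (only its values on `[0,∞)` are used). -/
structure IlliquidMarket (Ω : Type*) [MeasurableSpace Ω] where
  τ : ℕ → Ω → ℝ
  S : ℝ → Ω → ℝ
  Z₀ : ℝ
  lam : ℝ
  rho : ℝ
  p : Kernel ℝ ℝ
  zlo : ℝ
  zhi : ℝ≥0∞
  U : ℝ → ℝ
  measurable_τ : ∀ k, Measurable (τ k)
  measurable_Sτ : ∀ k, Measurable fun ω => S (τ k ω) ω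

/-- Semiconcavity on a set, with a nondecreasing upper semicontinuous modulus that vanishes
at `0+`. -/
def SemiconcaveOnSet {E : Type*} [NormedAddCommGroup E] [NormedSpace ℝ E]
    (D : Set E) (u : E → ℝ) : Prop :=
  ∃ m : ℝ≥0 → ℝ≥0, Monotone m ∧ UpperSemicontinuous m ∧ Tendsto m (𝓝[>] 0) (𝓝 0) ∧
    ∀ x₁ x₂ : E, segment ℝ x₁ x₂ ⊆ D → ∀ η ∈ Icc (0 : ℝ) 1,
      η * u x₁ + (1 - η) * u x₂ - u (η • x₁ + (1 - η) • x₂) ≤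
        η * (1 - η) * ‖x₁ - x₂‖ * (m ‖x₁ - x₂‖₊ : ℝ)

/-- Local semiconcavity: semiconcavity on every compact subset of the domain. -/
def LocallySemiconcaveOn {E : Type*} [NormedAddCommGroup E] [NormedSpace ℝ E]
    (D : Set E) (u : E → ℝ) : Prop :=
  ∀ K ⊆ D, IsCompact K → SemiconcaveOnSet K u

namespace IlliquidMarket

variable {Ω : Type*} [MeasurableSpace Ω] (M : IlliquidMarket Ω)

/-! ### Observations and control policies -/

/-- The observed returns between consecutive trading dates. -/
noncomputable def Z : ℕ → Ω → ℝ
  | 0 => fun _ => M.Z₀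
  | k + 1 => fun ω => (M.S (M.τ (k + 1) ω) ω - M.S (M.τ k ω) ω) / M.S (M.τ k ω) ω

theorem measurable_Z (k : ℕ) : Measurable (M.Z k) := by
  cases k with
  | zero => exact measurable_const
  | succ k =>
    exact ((M.measurable_Sτ (k + 1)).sub (M.measurable_Sτ k)).div (M.measurable_Sτ k)

/-- The waiting time between the trading dates `k` and `k + 1`. -/
def waiting (k : ℕ) (ω : Ω) : ℝ := M.τ (k + 1) ω - M.τ k ω

/-- The observed history `(τ i, Z i)`, `i ≤ k`, at the trading date `k`. -/
noncomputable def history (k : ℕ) (ω : Ω) : Fin (k + 1) → ℝ × ℝ :=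
  fun i => (M.τ i ω, M.Z i ω)

/-- The discrete observation filtration: the information available at the trading date `k`. -/
noncomputable abbrev discreteObs (k : ℕ) : MeasurableSpace Ω :=
  MeasurableSpace.comap (M.history k) inferInstance

/-- The continuous observation filtration `𝒢 t = σ((τ k, Z k) : τ k ≤ t)`, generated by the events
`{τ k ≤ s, Z k ∈ B}` with `s ≤ t`. -/
noncomputable def obs : Filtration ℝ≥0 (inferInstance : MeasurableSpace Ω) where
  seq t := MeasurableSpace.generateFrom
    {A | ∃ (k : ℕ) (s : ℝ) (B : Set ℝ), s ≤ t ∧ MeasurableSet B ∧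
      A = {ω | M.τ k ω ≤ s ∧ M.Z k ω ∈ B}}
  mono' := by
    intro t t' htt'
    refine MeasurableSpace.generateFrom_mono ?_
    rintro A ⟨k, s, B, hs, hB, rfl⟩
    exact ⟨k, s, B, hs.trans (by exact_mod_cast htt'), hB, rfl⟩
  le' := by
    intro t
    refine MeasurableSpace.generateFrom_le ?_
    rintro A ⟨k, s, B, hs, hB, rfl⟩
    exact (measurableSet_le (M.measurable_τ k) measurable_const).inter (M.measurable_Z k hB)

/-- The wealth at the trading date `k` of the policy `(α, c)` started with capital `x`; here
`α i` is the amount held in the stock on the period `(τ i, τ (i + 1)]`. -/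
noncomputable def wealthAt (x : ℝ) (α : ℕ → Ω → ℝ) (c : ℝ≥0 → Ω → ℝ) (k : ℕ) (ω : Ω) : ℝ :=
  x - (∫ t in Ioc 0 (M.τ k ω), c t.toNNReal ω) + ∑ i ∈ Finset.range k, α i ω * M.Z (i + 1) ω

/-- Admissible control policies: `α` is predictable for the discrete observation filtration, `c` is
nonnegative and predictable for the continuous one, and wealth is (well defined and) nonnegative
at every trading date. -/
structure IsAdmissible (P : Measure Ω) (x : ℝ) (α : ℕ → Ω → ℝ) (c : ℝ≥0 → Ω → ℝ) : Prop where
  measurable_α : ∀ k, Measurable[M.discreteObs k] (α k)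
  predictable_c : IsStronglyPredictable M.obs c
  nonneg_c : ∀ t ω, 0 ≤ c t ω
  integrable_c : ∀ k, ∀ᵐ ω ∂P,
    IntegrableOn (fun t : ℝ => c t.toNNReal ω) (Ioc 0 (M.τ k ω))
  nonneg_wealth : ∀ k, 1 ≤ k → ∀ᵐ ω ∂P, 0 ≤ M.wealthAt x α c k ω

/-- Expected discounted utility of a consumption process. -/
noncomputable def expectedUtility (P : Measure Ω) (c : ℝ≥0 → Ω → ℝ) : ℝ≥0∞ :=
  ∫⁻ ω, (∫⁻ t in Ioi (0 : ℝ),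
    ENNReal.ofReal (Real.exp (-M.rho * t) * M.U (c t.toNNReal ω))) ∂P

/-- The value function of the portfolio/consumption problem, with values in `[0,∞]`. -/
noncomputable def value (P : Measure Ω) (x : ℝ) : ℝ≥0∞ :=
  ⨆ (α : ℕ → Ω → ℝ) (c : ℝ≥0 → Ω → ℝ) (_ : M.IsAdmissible P x α c), M.expectedUtility P c

/-! ### The auxiliary deterministic problem between two trading dates -/

/-- The set `A` of stock positions: `ℝ` if `zhi < ∞`, and `[0,∞)` if `zhi = ∞`. -/
def positions : Set ℝ := {a | M.zhi = ⊤ → 0 ≤ a}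

/-- The least wealth `l(a) = max (a zlo) (-a zhi)` that covers the position `a`, read as `a zlo`
if `zhi = ∞`. -/
noncomputable def l (a : ℝ) : ℝ :=
  open Classical in
  if M.zhi = ⊤ then a * M.zlo else max (a * M.zlo) (-a * M.zhi.toReal)

/-- `g(t,x,a) = λ ∫ v(x + a z) p(t,dz)`. -/
noncomputable def g (P : Measure Ω) (t x a : ℝ) : ℝ≥0∞ :=
  ENNReal.ofReal M.lam * ∫⁻ z, M.value P (x + a * z) ∂(M.p t)

/-- The deterministic wealth from time `t` on, under the consumption rate `c`. -/
noncomputable def auxWealth (t x : ℝ) (c : ℝ → ℝ) (s : ℝ) : ℝ := x - ∫ u in Ioc t s, c u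

/-- The deterministic consumption rates `𝒞_a(t,x)` (functions on `[t,∞)`; values before `t` are
irrelevant). -/
structure IsAuxAdmissible (t x a : ℝ) (c : ℝ → ℝ) : Prop where
  measurable : Measurable c
  nonneg : ∀ s, t ≤ s → 0 ≤ c s
  integrable : ∀ s, t ≤ s → IntegrableOn c (Ioc t s)
  le_wealth : ∀ s, t ≤ s → M.l a ≤ auxWealth t x c s

/-- The payoff of the auxiliary problem. -/
noncomputable def auxPayoff (P : Measure Ω) (t x a : ℝ) (c : ℝ → ℝ) : ℝ≥0∞ :=
  ∫⁻ s in Ioi t, ENNReal.ofReal (Real.exp (-(M.rho + M.lam) * (s - t))) *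
    (ENNReal.ofReal (M.U (c s)) + M.g P s (auxWealth t x c s) a)

/-- The auxiliary value function. -/
noncomputable def auxValue (P : Measure Ω) (t x a : ℝ) : ℝ≥0∞ :=
  ⨆ (c : ℝ → ℝ) (_ : M.IsAuxAdmissible t x a c), M.auxPayoff P t x a c

/-- Optimal consumption rates for the auxiliary problem started at `(t,x)`. -/
def IsAuxOptimal (P : Measure Ω) (t x a : ℝ) (c : ℝ → ℝ) : Prop :=
  M.IsAuxAdmissible t x a c ∧ M.auxPayoff P t x a c = M.auxValue P t x a

/-! ### Standing assumptions -/

/-- The support of the law `μ` of a return is either an interval with interior `(-zlo, zhi)`, or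
finite with least element `-zlo` and greatest element `zhi < ∞`. -/
def HasReturnSupport (μ : Measure ℝ) : Prop :=
  (μ.support.OrdConnected ∧
    interior μ.support = {z | -M.zlo < z ∧ ENNReal.ofReal z < M.zhi}) ∨
  (μ.support.Finite ∧ M.zhi ≠ ⊤ ∧ IsLeast μ.support (-M.zlo) ∧
    IsGreatest μ.support M.zhi.toReal)

/-- Assumptions on the trading dates and the returns, with the constants `k`, `b` of the
exponential growth bound. The dates are the jumps of a Poisson process of intensity `lam` relative
to the observations: each waiting time is exponential and independent of the past observations. -/
structure ReturnAssumption (P : Measure Ω) (k b : ℝ) : Prop where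
  lam_pos : 0 < M.lam
  zlo_pos : 0 < M.zlo
  zlo_le_one : M.zlo ≤ 1
  zhi_pos : 0 < M.zhi
  price_pos : ∀ t ω, 0 < M.S t ω
  price_zero : ∃ s₀, ∀ ω, M.S 0 ω = s₀
  τ_zero : ∀ ω, M.τ 0 ω = 0
  τ_strictMono : ∀ ω, StrictMono fun n => M.τ n ω
  waiting_law : ∀ n, P.map (M.waiting n) = expMeasure M.lam
  waiting_indep : ∀ n, IndepFun (M.history n) (M.waiting n) P
  markov : IsMarkovKernel M.p
  /-- given the past and the waiting time `t`, the next return has law `p t` -/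
  return_law : ∀ n, P.map (fun ω => ((M.history n ω, M.waiting n ω), M.Z (n + 1) ω)) =
    (P.map fun ω => (M.history n ω, M.waiting n ω)) ⊗ₘ M.p.comap Prod.snd measurable_snd
  return_support : ∀ t, 0 < t → M.HasReturnSupport (M.p t)
  integrable_return : ∀ t, 0 < t → Integrable (fun z => z) (M.p t)
  mean_nonneg : ∀ t, 0 < t → 0 ≤ ∫ z, z ∂(M.p t)
  k_nonneg : 0 ≤ k
  b_nonneg : 0 ≤ b
  mean_le : ∀ t, 0 < t → ∫ z, (1 + z) ∂(M.p t) ≤ k * Real.exp (b * t)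
  continuous_law : ∀ w : ℝ → ℝ, Measurable w → (∃ C, ∀ z, |w z| ≤ C * (1 + |z|)) →
    ContinuousOn (fun t => ∫ z, w z ∂(M.p t)) (Ioi 0)

/-- Assumptions on the utility function and on the discount rate. -/
structure UtilityAssumption (k b : ℝ) : Prop where
  rho_pos : 0 < M.rho
  strictMono : StrictMonoOn M.U (Ici 0)
  strictConcave : StrictConcaveOn ℝ (Ici 0) M.U
  contDiff : ContDiffOn ℝ 1 M.U (Ioi 0)
  zero : M.U 0 = 0
  inada_zero : Tendsto (deriv M.U) (𝓝[>] 0) atTop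
  inada_top : Tendsto (deriv M.U) atTop (𝓝 0)
  growth : ∃ γ ∈ Ioo (0 : ℝ) 1, (∃ K₁ > 0, ∀ x, 0 ≤ x → M.U x ≤ K₁ * x ^ γ) ∧
    b * γ + M.lam * (k ^ γ / M.zlo ^ γ - 1) < M.rho

/-- For every position `a ≠ 0` and every continuous `w` of linear growth, the map
`(t,x) ↦ λ ∫ w(x + a z) p(t,dz)` is locally semiconcave on `(0,∞) × (l(a),∞)`; the coordinates
of `q` are `t = q 0` and `x = q 1`. -/
def SemiconcavityAssumption : Prop :=
  ∀ a ∈ M.positions, a ≠ 0 → ∀ w : ℝ → ℝ, Continuous w →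
    (∃ C, ∀ y, |w y| ≤ C * (1 + |y|)) →
    LocallySemiconcaveOn {q : EuclideanSpace ℝ (Fin 2) | 0 < q 0 ∧ M.l a < q 1}
      (fun q => M.lam * ∫ z, w (q 1 + a * z) ∂(M.p (q 0)))

end IlliquidMarket

namespace IlliquidMarket

variable {Ω : Type*} [MeasurableSpace Ω] {M : IlliquidMarket Ω}

/-! ### The support of the returns and the least wealth that covers a position -/

/-! Write `β = ρ + λ`. The auxiliary problem enters only through the properties of `g(s,·,a)`
collected in `AuxRegular`: for `s > 0` the reward is nondecreasing, and on `[l(a),∞)` it is finite,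
concave and right-continuous; it is also integrable against the discount. They are inherited from
`v`, which is concave and continuous on `[0,∞)` with `v(x) ≤ C x ^ γ`. The probabilistic point is
this growth bound: over one trading period the expectation of `exp(-ρ τ_n) X_n ^ γ` is multiplied by
at most `q = (k / zlo) ^ γ λ / (λ + ρ - b γ)`, the condition on `ρ` says `q < 1`, and the utility
earned in a period is at most a multiple of the same quantity, so a geometric series bounds the
total (`lintegral_wealthAt_succ_le`, `exists_value_le`).

Existence and uniqueness come from strict concavity. The midpoint of two nearly optimal rates gains
the integral of `utilityGap`, which must therefore be small (`lintegral_utilityGap_le`). So optimal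
rates agree almost everywhere, and a maximizing sequence is Cauchy for a bounded distance and
converges almost everywhere. Fatou's lemma and its reverse, applied with a truncated utility, make
the limit optimal (`exists_isAuxOptimal`).

The regularity of the optimal rate is read off from perturbations, by dynamic programming. Let
`V(s,y) = exp(-β s) v̂(s,y,a)`, concave in `y`, and let `Y` be the optimal wealth started above
`l(a)`. Carrying `θ` more along the path shows that the right derivative of `V` at `Y_s` is
nonincreasing in `s`; carrying `θ` less shows that the left derivative drops at most by an integral
of the reward, since `g` is Lipschitz away from `l(a)`. Consuming `θ` more, or a fraction `θ` less,
on a short interval gives by Lebesgue differentiation, for almost every `s`, left derivative `≤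
exp(-β s) U'(c_s) ≤` right derivative. Concavity gives the reverse order, so all three agree.
Letting such times decrease to an arbitrary `s` yields differentiability along the whole path; the
two monotonicity statements then give continuity of the derivative, and inverting `U'` produces the
continuous feedback rate.

Infinite marginal utility at `0` keeps `Y` above `l(a)` (`lt_auxWealth`). Finally, `U'(c)` grows by
a factor of at most `exp β` over a unit of time, while the unit increments of the monotone bounded
path `Y` vanish at infinity; this forces `c → 0`. -/

theorem HasReturnSupport.mem_bounds {μ : Measure ℝ} (h : M.HasReturnSupport μ) (hlo : 0 < M.zlo)
    (hhi : 0 < M.zhi) {z : ℝ} (hz : z ∈ μ.support) : -M.zlo ≤ z ∧ ENNReal.ofReal z ≤ M.zhi := by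
  rcases h with ⟨hconn, hint⟩ | ⟨-, htop, hleast, hgreatest⟩
  · have h0 : (0 : ℝ) ∈ interior μ.support := by
      rw [hint]; simpa using ⟨hlo, hhi⟩
    have h0' := interior_subset h0
    constructor
    · by_contra! hlt
      -- The support is an interval that contains `z` and the interior point `0`, so `(z, 0)` lies
      -- in its interior; yet `-zlo` belongs to `(z, 0)` and is excluded from the interior.
      have hsub : Ioo z 0 ⊆ interior μ.support :=
        interior_maximal (Ioo_subset_Icc_self.trans (hconn.out hz h0')) isOpen_Ioo
      have hmem := hsub ⟨hlt, by linarith⟩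
      rw [hint] at hmem
      exact lt_irrefl _ hmem.1
    · by_contra! hlt
      have htop : M.zhi ≠ ⊤ := ne_top_of_lt hlt
      have hz' : M.zhi.toReal < z := by
        rwa [ENNReal.lt_ofReal_iff_toReal_lt htop] at hlt
      have hsub : Ioo 0 z ⊆ interior μ.support :=
        interior_maximal (Ioo_subset_Icc_self.trans (hconn.out h0' hz)) isOpen_Ioo
      have hmem := hsub ⟨ENNReal.toReal_pos hhi.ne' htop, hz'⟩
      rw [hint] at hmem
      have := hmem.2
      rw [ENNReal.ofReal_toReal htop] at this
      exact lt_irrefl _ this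
  · exact ⟨hleast.2 hz, ENNReal.ofReal_le_of_le_toReal (hgreatest.2 hz)⟩

/-- In the interval case the assumption only gives the open interval; its end point is recovered
because the support is closed. -/
theorem HasReturnSupport.neg_zlo_mem {μ : Measure ℝ} (h : M.HasReturnSupport μ) (hlo : 0 < M.zlo)
    (hhi : 0 < M.zhi) : -M.zlo ∈ μ.support := by
  rcases h with ⟨-, hint⟩ | ⟨-, -, hleast, -⟩
  · have hsub : Ioo (-M.zlo) 0 ⊆ μ.support := by
      refine Subset.trans (fun z hz => ?_) interior_subset
      rw [hint]
      exact ⟨hz.1, by simpa [ENNReal.ofReal_of_nonpos hz.2.le] using hhi⟩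
    have hcl := closure_minimal hsub Measure.isClosed_support
    rw [closure_Ioo (by linarith)] at hcl
    exact hcl ⟨le_rfl, by linarith⟩
  · exact hleast.1

theorem HasReturnSupport.zhi_mem {μ : Measure ℝ} (h : M.HasReturnSupport μ) (hlo : 0 < M.zlo)
    (hhi : 0 < M.zhi) (htop : M.zhi ≠ ⊤) : M.zhi.toReal ∈ μ.support := by
  have hpos := ENNReal.toReal_pos hhi.ne' htop
  rcases h with ⟨-, hint⟩ | ⟨-, -, -, hgreatest⟩
  · have hsub : Ioo 0 M.zhi.toReal ⊆ μ.support := by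
      refine Subset.trans (fun z hz => ?_) interior_subset
      rw [hint]
      exact ⟨by linarith [hz.1], (ENNReal.ofReal_lt_iff_lt_toReal hz.1.le htop).2 hz.2⟩
    have hcl := closure_minimal hsub Measure.isClosed_support
    rw [closure_Ioo hpos.ne] at hcl
    exact hcl ⟨hpos.le, le_rfl⟩
  · exact hgreatest.1

theorem HasReturnSupport.mem_of_zhi_eq_top {μ : Measure ℝ} (h : M.HasReturnSupport μ)
    (htop : M.zhi = ⊤) {z : ℝ} (hz : -M.zlo < z) : z ∈ μ.support := by
  rcases h with ⟨-, hint⟩ | ⟨-, hne, -, -⟩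
  · refine interior_subset (s := μ.support) ?_
    rw [hint]
    exact ⟨hz, by simp [htop]⟩
  · exact absurd htop hne

theorem l_nonneg (hlo : 0 < M.zlo) {a : ℝ} (ha : a ∈ M.positions) : 0 ≤ M.l a := by
  unfold l
  split_ifs with h
  · exact mul_nonneg (ha h) hlo.le
  · rcases le_total 0 a with h0 | h0
    · exact le_max_of_le_left (by positivity)
    · exact le_max_of_le_right (mul_nonneg (by linarith) ENNReal.toReal_nonneg)

theorem mul_zlo_le_l (a : ℝ) : a * M.zlo ≤ M.l a := by
  unfold l
  split_ifs with h
  · exact le_rfl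
  · exact le_max_left _ _

theorem l_zero : M.l 0 = 0 := by
  unfold l
  split_ifs <;> simp

/-- A position that almost surely leaves nonnegative wealth is covered. -/
theorem HasReturnSupport.l_le_of_ae {μ : Measure ℝ} (h : M.HasReturnSupport μ) (hlo : 0 < M.zlo)
    (hhi : 0 < M.zhi) {y a : ℝ} (hy : ∀ᵐ z ∂μ, 0 ≤ y + a * z) :
    a ∈ M.positions ∧ M.l a ≤ y := by
  have hcl : IsClosed {z : ℝ | 0 ≤ y + a * z} := isClosed_le (by fun_prop) (by fun_prop)
  -- A closed set of full measure contains the support, so the inequality may be evaluated at the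
  -- extreme returns.
  have hsub : μ.support ⊆ {z : ℝ | 0 ≤ y + a * z} := Measure.support_subset_of_isClosed hcl hy
  have h1 : 0 ≤ y + a * -M.zlo := hsub (h.neg_zlo_mem hlo hhi)
  by_cases htop : M.zhi = ⊤
  · refine ⟨fun _ => ?_, ?_⟩
    -- With returns unbounded above, a short position can be ruined: the return `(|y| + 1) / (-a)`
    -- leaves the wealth `y - |y| - 1 < 0`.
    · by_contra! hneg
      have hz : 0 ≤ y + a * ((|y| + 1) / (-a)) :=
        hsub (h.mem_of_zhi_eq_top htop
          (lt_of_lt_of_le (neg_lt_zero.2 hlo) (div_nonneg (by positivity) (by linarith))))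
      rw [mul_div_assoc', div_neg, mul_div_cancel_left₀ _ hneg.ne] at hz
      linarith [le_abs_self y]
    · simp only [l, htop, if_true]
      linarith
  · refine ⟨fun h' => absurd h' htop, ?_⟩
    have h2 : 0 ≤ y + a * M.zhi.toReal := hsub (h.zhi_mem hlo hhi htop)
    simp only [l, htop, if_false]
    exact max_le (by linarith) (by linarith)

/-- A covered position almost surely leaves nonnegative wealth. -/
theorem HasReturnSupport.ae_nonneg {μ : Measure ℝ} (h : M.HasReturnSupport μ) (hlo : 0 < M.zlo)
    (hhi : 0 < M.zhi) {y a : ℝ} (ha : a ∈ M.positions) (hy : M.l a ≤ y) :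
    ∀ᵐ z ∂μ, 0 ≤ y + a * z := by
  filter_upwards [Measure.support_mem_ae (μ := μ)] with z hz
  obtain ⟨hz1, hz2⟩ := h.mem_bounds hlo hhi hz
  rcases le_total 0 a with h0 | h0
  · have := mul_zlo_le_l (M := M) a
    nlinarith
  · by_cases htop : M.zhi = ⊤
    · have := ha htop
      have ha0 : a = 0 := le_antisymm h0 this
      subst ha0
      simpa [l_zero] using hy
    · have hz3 : z ≤ M.zhi.toReal := by
        rwa [ENNReal.ofReal_le_iff_le_toReal htop] at hz2
      have : -a * M.zhi.toReal ≤ M.l a := by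
        simp only [l, htop, if_false]
        exact le_max_right _ _
      nlinarith

/-- Bernoulli's inequality in homogeneous form: the tangent line at `m` to `u ↦ u ^ γ`. -/
theorem rpow_le_tangent {γ u m : ℝ} (hγ : γ ∈ Ioo (0 : ℝ) 1) (hu : 0 ≤ u) (hm : 0 < m) :
    u ^ γ ≤ m ^ γ * (1 - γ + γ * (u / m)) := by
  have h := _root_.rpow_one_add_le_one_add_mul_self (s := u / m - 1) (p := γ)
    (by have := div_nonneg hu hm.le; linarith) hγ.1.le hγ.2.le
  rw [add_sub_cancel, Real.div_rpow hu hm.le, div_le_iff₀ (Real.rpow_pos_of_pos hm _)] at h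
  calc u ^ γ ≤ _ := h
    _ = _ := by ring

/-! ### Moments of wealth over one trading period -/

variable {P : Measure Ω} {k b : ℝ}

/-- The mean return is nonnegative, so the mean of `1 + z` is at least `1`. This forces `k > 0`. -/
theorem ReturnAssumption.one_le_growth (hR : M.ReturnAssumption P k b) {s : ℝ} (hs : 0 < s) :
    1 ≤ k * Real.exp (b * s) := by
  have := hR.markov
  have h1 := hR.mean_le s hs
  rw [integral_add (integrable_const _) (hR.integrable_return s hs)] at h1
  have h2 := hR.mean_nonneg s hs
  simp at h1
  linarith

theorem ReturnAssumption.k_pos (hR : M.ReturnAssumption P k b) : 0 < k := by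
  have h := hR.one_le_growth one_pos
  by_contra! hk
  nlinarith [Real.exp_pos (b * 1)]

/-- Covering the position means `a zlo ≤ y`. As the mean return `m` is nonnegative and `zlo ≤ 1`,
this gives `(y + a m) zlo ≤ y (1 + m)`, whence the factor `k / zlo` uniformly in `a`. -/
theorem ReturnAssumption.integral_wealth_le (hR : M.ReturnAssumption P k b) {s y a : ℝ}
    (hs : 0 < s) (ha : a ∈ M.positions) (hy : M.l a ≤ y) :
    ∫ z, (y + a * z) ∂(M.p s) ≤ y * (k * Real.exp (b * s) / M.zlo) := by
  have := hR.markov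
  have hy0 : 0 ≤ y := (l_nonneg hR.zlo_pos ha).trans hy
  rw [integral_add (integrable_const _) ((hR.integrable_return s hs).const_mul a),
    integral_const_mul]
  have h1 := hR.mean_le s hs
  rw [integral_add (integrable_const _) (hR.integrable_return s hs)] at h1
  have h2 := hR.mean_nonneg s hs
  simp only [integral_const, smul_eq_mul, probReal_univ, one_mul] at h1 ⊢
  set m := ∫ z, z ∂(M.p s)
  have hlo := hR.zlo_pos
  rw [mul_div_assoc', le_div_iff₀ hlo]
  have h3 : a * M.zlo ≤ y := (mul_zlo_le_l a).trans hy
  calc (y + a * m) * M.zlo = y * M.zlo + (a * M.zlo) * m := by ring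
    _ ≤ y * 1 + y * m := by gcongr; exact hR.zlo_le_one
    _ = y * (1 + m) := by ring
    _ ≤ _ := by gcongr

/-- The conditional growth of a power of wealth over a trading period. -/
theorem ReturnAssumption.lintegral_rpow_le (hR : M.ReturnAssumption P k b) {γ s y a : ℝ}
    (hγ : γ ∈ Ioo (0 : ℝ) 1) (hs : 0 < s) (ha : a ∈ M.positions) (hy : M.l a ≤ y) :
    ∫⁻ z, ENNReal.ofReal ((y + a * z) ^ γ) ∂(M.p s) ≤
      ENNReal.ofReal ((y * (k * Real.exp (b * s) / M.zlo)) ^ γ) := by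
  have := hR.markov
  have hlo := hR.zlo_pos
  have hy0 : 0 ≤ y := (l_nonneg hlo ha).trans hy
  have hpos := (hR.return_support s hs).ae_nonneg hlo hR.zhi_pos ha hy
  have hmean := hR.integral_wealth_le hs ha hy
  have hint : Integrable (fun z => y + a * z) (M.p s) :=
    (integrable_const _).add ((hR.integrable_return s hs).const_mul a)
  set m := y * (k * Real.exp (b * s) / M.zlo) with hm
  have hfac : 0 < k * Real.exp (b * s) / M.zlo := by
    have := hR.k_pos
    positivity
  rcases hy0.eq_or_lt with h0 | h0
  -- For `y = 0` there is no tangent line at `m = 0`; instead, nonnegative wealth of mean at most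
  -- `0` vanishes almost surely.
  · have hzero : ∀ᵐ z ∂(M.p s), y + a * z = 0 := by
      have : ∫ z, (y + a * z) ∂(M.p s) ≤ 0 := by rw [← h0] at hm; simpa [hm] using hmean
      exact (integral_eq_zero_iff_of_nonneg_ae hpos hint).1
        (le_antisymm this (integral_nonneg_of_ae hpos))
    rw [lintegral_congr_ae (g := fun _ => 0)]
    · simp
    · filter_upwards [hzero] with z hz
      rw [hz, Real.zero_rpow hγ.1.ne', ENNReal.ofReal_zero]
  · have hm0 : 0 < m := mul_pos h0 hfac
    have hint2 : Integrable (fun z => m ^ γ * (1 - γ + γ * ((y + a * z) / m))) (M.p s) :=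
      ((integrable_const _).add ((hint.div_const m).const_mul γ)).const_mul _
    -- Jensen's inequality through the tangent line at `m`. Its slope is nonnegative, so `m` may be
    -- an upper bound of the mean instead of the mean itself.
    calc ∫⁻ z, ENNReal.ofReal ((y + a * z) ^ γ) ∂(M.p s)
        ≤ ∫⁻ z, ENNReal.ofReal (m ^ γ * (1 - γ + γ * ((y + a * z) / m))) ∂(M.p s) := by
          refine lintegral_mono_ae ?_
          filter_upwards [hpos] with z hz
          exact ENNReal.ofReal_le_ofReal (rpow_le_tangent hγ hz hm0)
      _ = ENNReal.ofReal (∫ z, m ^ γ * (1 - γ + γ * ((y + a * z) / m)) ∂(M.p s)) := by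
          rw [ofReal_integral_eq_lintegral_ofReal hint2]
          filter_upwards [hpos] with z hz
          exact (Real.rpow_nonneg hz γ).trans (rpow_le_tangent hγ hz hm0)
      _ ≤ ENNReal.ofReal (m ^ γ) := by
          refine ENNReal.ofReal_le_ofReal ?_
          rw [integral_const_mul, integral_add (integrable_const _)
            ((hint.div_const m).const_mul γ), integral_const_mul, integral_div]
          simp only [integral_const, smul_eq_mul, probReal_univ, one_mul]
          have h1 : (∫ z, (y + a * z) ∂(M.p s)) / m ≤ 1 := (div_le_one hm0).2 hmean
          have h2 : 0 < m ^ γ := Real.rpow_pos_of_pos hm0 _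
          have h3 := hγ.1
          calc m ^ γ * (1 - γ + γ * ((∫ z, (y + a * z) ∂(M.p s)) / m))
              ≤ m ^ γ * (1 - γ + γ * 1) := by gcongr
            _ = m ^ γ := by ring

end IlliquidMarket

namespace IlliquidMarket

variable {Ω : Type*} [MeasurableSpace Ω] {M : IlliquidMarket Ω} {P : Measure Ω} {k b : ℝ}

/-! ### Predictable processes between trading dates -/

theorem measurable_history (n : ℕ) : Measurable (M.history n) :=
  measurable_pi_lambda _ fun i => (M.measurable_τ i).prodMk (M.measurable_Z i)

theorem measurable_waiting (n : ℕ) : Measurable (M.waiting n) :=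
  (M.measurable_τ (n + 1)).sub (M.measurable_τ n)

theorem measurable_discreteObs_τ {i n : ℕ} (h : i ≤ n) : Measurable[M.discreteObs n] (M.τ i) := by
  have h1 : Measurable[M.discreteObs n] (M.history n) := comap_measurable _
  have h2 : Measurable fun h' : Fin (n + 1) → ℝ × ℝ => (h' ⟨i, by omega⟩).1 := by fun_prop
  exact h2.comp h1

theorem measurable_discreteObs_Z {i n : ℕ} (h : i ≤ n) : Measurable[M.discreteObs n] (M.Z i) := by
  have h1 : Measurable[M.discreteObs n] (M.history n) := comap_measurable _
  have h2 : Measurable fun h' : Fin (n + 1) → ℝ × ℝ => (h' ⟨i, by omega⟩).2 := by fun_prop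
  exact h2.comp h1

theorem discreteObs_mono {i n : ℕ} (h : i ≤ n) : M.discreteObs i ≤ M.discreteObs n := by
  refine measurable_iff_comap_le.1 ?_
  refine (@measurable_pi_iff _ _ _ (M.discreteObs n) _ _).2 fun j => ?_
  exact (measurable_discreteObs_τ (by omega)).prodMk (measurable_discreteObs_Z (by omega))

/-- Up to the next trading date, a predictable process is a function of time and of the history at
the last trading date. -/
theorem ReturnAssumption.exists_predictable_factor (hR : M.ReturnAssumption P k b)
    {c : ℝ≥0 → Ω → ℝ} (hc : IsStronglyPredictable M.obs c) (n : ℕ) :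
    ∃ f : ℝ≥0 × (Fin (n + 1) → ℝ × ℝ) → ℝ, Measurable f ∧
      ∀ (t : ℝ≥0) ω, (t : ℝ) ≤ M.τ (n + 1) ω → c t ω = f (t, M.history n ω) := by
  let D := {q : ℝ≥0 × Ω // (q.1 : ℝ) ≤ M.τ (n + 1) q.2}
  let Ψ : D → ℝ≥0 × (Fin (n + 1) → ℝ × ℝ) := fun d => (d.1.1, M.history n d.1.2)
  have hΨ : Measurable[MeasurableSpace.comap Ψ inferInstance] Ψ := comap_measurable _
  -- Generating rectangles suffice. The condition on `T` says that `s` strictly precedes `τ (n + 1)`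
  -- on the part of the rectangle under study: events about a date `j ≤ n` are then read off from
  -- the history, and events about a date `j > n` observed by `s` are empty. The rectangles `(i, ∞)
  -- × A` meet it because they are open on the left.
  have key : ∀ (T : Set ℝ≥0) (s : ℝ≥0), MeasurableSet T →
      (∀ t ∈ T, ∀ ω, (t : ℝ) ≤ M.τ (n + 1) ω → (s : ℝ) < M.τ (n + 1) ω) →
      ∀ A, MeasurableSet[M.obs s] A →
        MeasurableSet[MeasurableSpace.comap Ψ inferInstance]
          ((Subtype.val : D → ℝ≥0 × Ω) ⁻¹' (T ×ˢ A)) := by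
    intro T s hT hTs A hA
    have hTm : MeasurableSet[MeasurableSpace.comap Ψ inferInstance] {d : D | d.1.1 ∈ T} :=
      ⟨Prod.fst ⁻¹' T, measurable_fst hT, rfl⟩
    refine MeasurableSpace.generateFrom_induction _
      (fun A _ => MeasurableSet[MeasurableSpace.comap Ψ inferInstance]
          ((Subtype.val : D → ℝ≥0 × Ω) ⁻¹' (T ×ˢ A))) ?_ ?_ ?_ ?_ A hA
    · rintro A ⟨j, s', B, hs', hB, rfl⟩ -
      rcases le_or_gt j n with hj | hj
      · refine ⟨{q | q.1 ∈ T ∧ (q.2 ⟨j, by omega⟩).1 ≤ s' ∧ (q.2 ⟨j, by omega⟩).2 ∈ B}, ?_, ?_⟩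
        · refine (measurable_fst hT).inter (MeasurableSet.inter ?_ ?_)
          · have : Measurable fun q : ℝ≥0 × (Fin (n + 1) → ℝ × ℝ) =>
              (q.2 ⟨j, by omega⟩).1 := by fun_prop
            exact measurableSet_le this measurable_const
          · have : Measurable fun q : ℝ≥0 × (Fin (n + 1) → ℝ × ℝ) =>
              (q.2 ⟨j, by omega⟩).2 := by fun_prop
            exact this hB
        · ext d
          rfl
      · convert @MeasurableSet.empty _ (MeasurableSpace.comap Ψ inferInstance)
        rw [eq_empty_iff_forall_notMem]
        rintro ⟨⟨t, ω⟩, ht⟩ ⟨h1, h2, -⟩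
        have h3 := hTs t h1 ω ht
        have h4 : M.τ (n + 1) ω ≤ M.τ j ω := (hR.τ_strictMono ω).monotone hj
        have h5 : M.τ j ω ≤ s' := h2
        linarith
    · simp
    · intro A _ ih
      convert hTm.diff ih using 1
      ext d
      simp only [mem_preimage, mem_prod, mem_compl_iff, Set.mem_sdiff, mem_ofPred_eq]
      tauto
    · intro A _ ih
      rw [prod_iUnion, preimage_iUnion]
      exact MeasurableSet.iUnion ih
  have hval : @Measurable D (ℝ≥0 × Ω) (MeasurableSpace.comap Ψ inferInstance) M.obs.predictable
      Subtype.val := by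
    refine @measurable_generateFrom _ _ (MeasurableSpace.comap Ψ inferInstance) _ _ ?_
    rintro s (⟨A, hA, rfl⟩ | ⟨i, A, hA, rfl⟩)
    · refine key {⊥} ⊥ (measurableSet_singleton _) ?_ A hA
      intro t _ ω _
      have := hR.τ_strictMono ω (Nat.succ_pos n)
      simpa [hR.τ_zero ω] using this
    · exact key (Ioi i) i measurableSet_Ioi
        (fun t ht ω h => lt_of_lt_of_le (by exact_mod_cast ht) h) A hA
  have hcm : @Measurable D ℝ (MeasurableSpace.comap Ψ inferInstance) _
      (fun d => c d.1.1 d.1.2) :=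
    @Measurable.comp _ _ _ _ M.obs.predictable _ _ _ (StronglyMeasurable.measurable hc) hval
  obtain ⟨f, hf, hcf⟩ := hcm.exists_eq_measurable_comp
  exact ⟨f, hf, fun t ω h => congrFun hcf (⟨(t, ω), h⟩ : D)⟩

/-- The wealth at time `w` after a trading date, before any further return, is a measurable
function of the history at that date and of `w`. -/
theorem IsAdmissible.exists_wealth_factor {x : ℝ} {α : ℕ → Ω → ℝ} {c : ℝ≥0 → Ω → ℝ}
    (hR : M.ReturnAssumption P k b) (h : M.IsAdmissible P x α c) (n : ℕ) :
    ∃ y : (Fin (n + 1) → ℝ × ℝ) → ℝ → ℝ, Measurable (fun q : _ × ℝ => y q.1 q.2) ∧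
      ∀ ω w, w ≤ M.waiting n ω → y (M.history n ω) w =
        x - (∫ t in Ioc 0 (M.τ n ω + w), c t.toNNReal ω) +
          ∑ i ∈ Finset.range n, α i ω * M.Z (i + 1) ω := by
  obtain ⟨f, hf, hcf⟩ := hR.exists_predictable_factor h.predictable_c n
  have hsum : Measurable[M.discreteObs n]
      (fun ω => ∑ i ∈ Finset.range n, α i ω * M.Z (i + 1) ω) := by
    refine Finset.measurable_sum _ fun i hi => ?_
    have hi' : i < n := Finset.mem_range.1 hi
    exact ((h.measurable_α i).mono (discreteObs_mono hi'.le) le_rfl).mul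
      (measurable_discreteObs_Z hi')
  obtain ⟨σ, hσ, hσeq⟩ := hsum.exists_eq_measurable_comp
  refine ⟨fun h w => x - (∫ t, (Ioc 0 ((h (Fin.last n)).1 + w)).indicator
    (fun t => f (t.toNNReal, h)) t) + σ h, ?_, ?_⟩
  · refine ((measurable_const.sub ?_).add (hσ.comp measurable_fst))
    refine StronglyMeasurable.measurable ?_
    refine StronglyMeasurable.integral_prod_right
      (f := fun (q : (Fin (n + 1) → ℝ × ℝ) × ℝ) t =>
        (Ioc 0 ((q.1 (Fin.last n)).1 + q.2)).indicator (fun t => f (t.toNNReal, q.1)) t) ?_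
    refine Measurable.stronglyMeasurable ?_
    have hset : MeasurableSet {r : ((Fin (n + 1) → ℝ × ℝ) × ℝ) × ℝ |
        r.2 ∈ Ioc 0 ((r.1.1 (Fin.last n)).1 + r.1.2)} :=
      (measurableSet_lt measurable_const measurable_snd).inter
        (measurableSet_le measurable_snd (by fun_prop))
    have hfm : Measurable fun r : ((Fin (n + 1) → ℝ × ℝ) × ℝ) × ℝ =>
        f (r.2.toNNReal, r.1.1) := hf.comp (by fun_prop)
    exact hfm.indicator hset
  · intro ω w hw
    have h1 : (M.history n ω (Fin.last n)).1 = M.τ n ω := rfl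
    have h2 := congrFun hσeq ω
    simp only [Function.comp_apply] at h2
    simp only [h1]
    rw [integral_indicator measurableSet_Ioc, ← h2]
    congr 2
    refine setIntegral_congr_fun measurableSet_Ioc fun t ht => ?_
    refine (hcf _ _ ?_).symm
    rw [Real.coe_toNNReal _ ht.1.le]
    have := ht.2
    unfold waiting at hw
    linarith

/-- Wealth just before the return of period `n` is known. -/
noncomputable def preWealth (M : IlliquidMarket Ω) (x : ℝ) (α : ℕ → Ω → ℝ) (c : ℝ≥0 → Ω → ℝ)
    (n : ℕ) (ω : Ω) : ℝ :=
  x - (∫ t in Ioc 0 (M.τ (n + 1) ω), c t.toNNReal ω) +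
    ∑ i ∈ Finset.range n, α i ω * M.Z (i + 1) ω

theorem wealthAt_succ (x : ℝ) (α : ℕ → Ω → ℝ) (c : ℝ≥0 → Ω → ℝ) (n : ℕ) (ω : Ω) :
    M.wealthAt x α c (n + 1) ω = M.preWealth x α c n ω + α n ω * M.Z (n + 1) ω := by
  unfold wealthAt preWealth
  rw [Finset.sum_range_succ]
  ring

theorem ReturnAssumption.waiting_pos (hR : M.ReturnAssumption P k b) (n : ℕ) (ω : Ω) :
    0 < M.waiting n ω := sub_pos.2 (hR.τ_strictMono ω n.lt_succ_self)

theorem ReturnAssumption.τ_nonneg (hR : M.ReturnAssumption P k b) (n : ℕ) (ω : Ω) :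
    0 ≤ M.τ n ω := by
  rw [← hR.τ_zero ω]
  exact (hR.τ_strictMono ω).monotone n.zero_le

theorem IsAdmissible.wealthAt_sub {x : ℝ} {α : ℕ → Ω → ℝ} {c : ℝ≥0 → Ω → ℝ}
    (hR : M.ReturnAssumption P k b) (h : M.IsAdmissible P x α c) (n : ℕ) :
    ∀ᵐ ω ∂P, M.wealthAt x α c n ω - M.preWealth x α c n ω =
      ∫ t in Ioc (M.τ n ω) (M.τ (n + 1) ω), c t.toNNReal ω := by
  filter_upwards [h.integrable_c (n + 1)] with ω hω
  have h1 : M.τ n ω ≤ M.τ (n + 1) ω := (hR.τ_strictMono ω).monotone n.le_succ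
  have h2 := hR.τ_nonneg n ω
  unfold wealthAt preWealth
  rw [← Ioc_union_Ioc_eq_Ioc h2 h1, setIntegral_union (Ioc_disjoint_Ioc_of_le le_rfl)
    measurableSet_Ioc (hω.mono_set (Ioc_subset_Ioc_right h1))
    (hω.mono_set (Ioc_subset_Ioc_left h2))]
  ring

theorem IsAdmissible.preWealth_le {x : ℝ} {α : ℕ → Ω → ℝ} {c : ℝ≥0 → Ω → ℝ}
    (hR : M.ReturnAssumption P k b) (h : M.IsAdmissible P x α c) (n : ℕ) :
    ∀ᵐ ω ∂P, M.preWealth x α c n ω ≤ M.wealthAt x α c n ω := by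
  filter_upwards [h.wealthAt_sub hR n] with ω hω
  have : 0 ≤ ∫ t in Ioc (M.τ n ω) (M.τ (n + 1) ω), c t.toNNReal ω :=
    integral_nonneg fun t => h.nonneg_c _ _
  linarith

/-- Admissible positions are covered by the wealth at the end of the trading period. -/
theorem IsAdmissible.l_le_preWealth [IsProbabilityMeasure P] {x : ℝ} {α : ℕ → Ω → ℝ}
    {c : ℝ≥0 → Ω → ℝ} (hR : M.ReturnAssumption P k b) (h : M.IsAdmissible P x α c) (n : ℕ) :
    ∀ᵐ ω ∂P, α n ω ∈ M.positions ∧ M.l (α n ω) ≤ M.preWealth x α c n ω := by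
  have := hR.markov
  obtain ⟨y, hy, hyeq⟩ := h.exists_wealth_factor hR n
  obtain ⟨φ, hφ, hφeq⟩ := (h.measurable_α n).exists_eq_measurable_comp
  have hpre : ∀ ω, M.preWealth x α c n ω = y (M.history n ω) (M.waiting n ω) := by
    intro ω
    rw [hyeq ω _ le_rfl, preWealth, waiting, add_sub_cancel]
  have hm1 : Measurable fun ω => (M.history n ω, M.waiting n ω) :=
    (measurable_history n).prodMk (measurable_waiting n)
  have hm2 : Measurable fun ω => ((M.history n ω, M.waiting n ω), M.Z (n + 1) ω) :=
    hm1.prodMk (M.measurable_Z (n + 1))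
  have hset : MeasurableSet {q : ((Fin (n + 1) → ℝ × ℝ) × ℝ) × ℝ |
      0 ≤ y q.1.1 q.1.2 + φ q.1.1 * q.2} := by
    refine measurableSet_le measurable_const ?_
    exact (hy.comp measurable_fst).add ((hφ.comp (by fun_prop)).mul measurable_snd)
  have h1 : ∀ᵐ q ∂(P.map fun ω => ((M.history n ω, M.waiting n ω), M.Z (n + 1) ω)),
      0 ≤ y q.1.1 q.1.2 + φ q.1.1 * q.2 := by
    rw [ae_map_iff hm2.aemeasurable hset]
    filter_upwards [h.nonneg_wealth (n + 1) (by omega)] with ω hω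
    rw [wealthAt_succ, hpre, hφeq] at hω
    exact hω
  -- Disintegrating the joint law turns the almost sure constraint on terminal wealth into one under
  -- `p w` for almost every history and waiting time `w`, where the support of the return can be
  -- used.
  rw [hR.return_law n] at h1
  have h2 := ae_of_ae_map hm1.aemeasurable (Measure.ae_ae_of_ae_compProd h1)
  filter_upwards [h2] with ω hω
  rw [hpre, hφeq]
  exact (hR.return_support _ (hR.waiting_pos n ω)).l_le_of_ae hR.zlo_pos hR.zhi_pos hω

end IlliquidMarket

/-! ### Exponential integrals -/

theorem lintegral_exp_neg_mul_Ioi {r : ℝ} (hr : 0 < r) (s : ℝ) :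
    ∫⁻ t in Ioi s, ENNReal.ofReal (Real.exp (-r * t)) =
      ENNReal.ofReal (Real.exp (-r * s) / r) := by
  rw [← ofReal_integral_eq_lintegral_ofReal (integrableOn_exp_mul_Ioi (by linarith) s)
    (ae_of_all _ fun t => (Real.exp_pos _).le), integral_exp_mul_Ioi (by linarith)]
  rw [neg_div_neg_eq]

theorem lintegral_exp_expMeasure {r θ : ℝ} (hr : 0 < r) (hθ : 0 < r + θ) :
    ∫⁻ w, ENNReal.ofReal (Real.exp (-θ * w)) ∂(expMeasure r) = ENNReal.ofReal (r / (r + θ)) := by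
  have hm : Measurable fun w : ℝ => ENNReal.ofReal (Real.exp (-θ * w)) := by fun_prop
  have hpdf : Measurable (gammaPDF 1 r) := (measurable_gammaPDFReal 1 r).ennreal_ofReal
  rw [expMeasure, gammaMeasure, lintegral_withDensity_eq_lintegral_mul _ hpdf hm,
    ← lintegral_add_compl _ measurableSet_Ici (A := Ici (0 : ℝ)), compl_Ici,
    setLIntegral_congr_fun (g := fun _ => 0) measurableSet_Iio, lintegral_zero, add_zero,
    setLIntegral_congr Ioi_ae_eq_Ici.symm,
    setLIntegral_congr_fun (g := fun w => ENNReal.ofReal r *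
      ENNReal.ofReal (Real.exp (-(r + θ) * w))) measurableSet_Ioi,
    lintegral_const_mul' _ _ ENNReal.ofReal_ne_top, lintegral_exp_neg_mul_Ioi hθ,
    ← ENNReal.ofReal_mul hr.le]
  · congr 1
    simp [div_eq_mul_inv]
  · intro w hw
    have hw' : 0 ≤ w := le_of_lt hw
    simp only [Pi.mul_apply]
    rw [gammaPDF_of_nonneg hw', ← ENNReal.ofReal_mul hr.le, ← ENNReal.ofReal_mul]
    · simp only [Real.rpow_one, Real.Gamma_one, div_one, sub_self, Real.rpow_zero, mul_one]
      rw [mul_assoc, ← Real.exp_add]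
      congr 3
      ring
    · simp only [Real.rpow_one, Real.Gamma_one, div_one, sub_self, Real.rpow_zero, mul_one]
      positivity
  · intro w hw
    simp [gammaPDF_of_neg (show w < 0 from hw)]

namespace IlliquidMarket

variable {Ω : Type*} [MeasurableSpace Ω] {M : IlliquidMarket Ω} {P : Measure Ω} {k b : ℝ}

/-! ### Growth of the value function -/

theorem ReturnAssumption.lintegral_history_mul_waiting (hR : M.ReturnAssumption P k b) (n : ℕ)
    {F : (Fin (n + 1) → ℝ × ℝ) → ℝ≥0∞} {H : ℝ → ℝ≥0∞} (hF : Measurable F) (hH : Measurable H) :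
    ∫⁻ ω, F (M.history n ω) * H (M.waiting n ω) ∂P =
      (∫⁻ ω, F (M.history n ω) ∂P) * ∫⁻ w, H w ∂(expMeasure M.lam) := by
  rw [← hR.waiting_law n, lintegral_map hH (measurable_waiting n)]
  exact lintegral_mul_eq_lintegral_mul_lintegral_of_indepFun''
    (hF.comp (measurable_history n)).aemeasurable (hH.comp (measurable_waiting n)).aemeasurable
    ((hR.waiting_indep n).comp hF hH)

theorem τ_succ (n : ℕ) (ω : Ω) : M.τ (n + 1) ω = M.τ n ω + M.waiting n ω := by
  unfold waiting; ring

/-- By independence each waiting time contributes the Laplace transform `λ / (λ + 1)` of the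
exponential law at `1`. The geometric decay shows that the dates cannot accumulate. -/
theorem ReturnAssumption.lintegral_exp_τ [IsProbabilityMeasure P] (hR : M.ReturnAssumption P k b)
    (n : ℕ) : ∫⁻ ω, ENNReal.ofReal (Real.exp (-M.τ n ω)) ∂P =
      ENNReal.ofReal (M.lam / (M.lam + 1)) ^ n := by
  induction n with
  | zero => simp [hR.τ_zero]
  | succ n ih =>
    have h1 := hR.lintegral_history_mul_waiting n
      (F := fun h => ENNReal.ofReal (Real.exp (-(h (Fin.last n)).1)))
      (H := fun w => ENNReal.ofReal (Real.exp (-1 * w))) (by fun_prop) (by fun_prop)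
    rw [lintegral_exp_expMeasure hR.lam_pos (by linarith [hR.lam_pos])] at h1
    have h2 : ∀ ω, (M.history n ω (Fin.last n)).1 = M.τ n ω := fun ω => rfl
    simp only [h2, ih] at h1
    rw [pow_succ, ← h1]
    refine lintegral_congr fun ω => ?_
    rw [← ENNReal.ofReal_mul (Real.exp_pos _).le, ← Real.exp_add, τ_succ]
    congr 2
    ring

/-- The trading dates do not accumulate. -/
theorem ReturnAssumption.tendsto_τ [IsProbabilityMeasure P] (hR : M.ReturnAssumption P k b) :
    ∀ᵐ ω ∂P, Tendsto (fun n => M.τ n ω) atTop atTop := by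
  have hlam := hR.lam_pos
  have hmeas : ∀ n, Measurable fun ω => ENNReal.ofReal (Real.exp (-M.τ n ω)) := fun n =>
    ((M.measurable_τ n).neg.exp).ennreal_ofReal
  have hq : ENNReal.ofReal (M.lam / (M.lam + 1)) < 1 := by
    rw [ENNReal.ofReal_lt_one, div_lt_one (by linarith)]
    linarith
  -- The infimum lies below every term and the integrals of the terms tend to `0`, so `inf exp(-τ_n)
  -- = 0` almost surely.
  have h0 : ∫⁻ ω, ⨅ n, ENNReal.ofReal (Real.exp (-M.τ n ω)) ∂P = 0 := by
    refine le_antisymm ?_ zero_le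
    refine ge_of_tendsto' (ENNReal.tendsto_pow_atTop_nhds_zero_of_lt_one hq) fun n => ?_
    rw [← hR.lintegral_exp_τ n]
    exact lintegral_mono fun ω => iInf_le _ n
  rw [lintegral_eq_zero_iff (Measurable.iInf hmeas)] at h0
  filter_upwards [h0] with ω hω
  refine tendsto_atTop_atTop_of_monotone (hR.τ_strictMono ω).monotone fun B => ?_
  have h1 : ⨅ n, ENNReal.ofReal (Real.exp (-M.τ n ω)) < ENNReal.ofReal (Real.exp (-B)) := by
    rw [hω]
    simpa using Real.exp_pos (-B)
  obtain ⟨n, hn⟩ := iInf_lt_iff.1 h1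
  refine ⟨n, ?_⟩
  rw [ENNReal.ofReal_lt_ofReal_iff (Real.exp_pos _), Real.exp_lt_exp] at hn
  linarith

theorem IsAdmissible.measurable_wealthAt {x : ℝ} {α : ℕ → Ω → ℝ} {c : ℝ≥0 → Ω → ℝ}
    (hR : M.ReturnAssumption P k b) (h : M.IsAdmissible P x α c) (n : ℕ) :
    Measurable (M.wealthAt x α c n) := by
  obtain ⟨y, hy, hyeq⟩ := h.exists_wealth_factor hR n
  have : M.wealthAt x α c n = fun ω => y (M.history n ω) 0 := by
    ext ω
    rw [hyeq ω 0 (hR.waiting_pos n ω).le, add_zero]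
    rfl
  rw [this]
  exact hy.comp ((measurable_history n).prodMk measurable_const)

/-- The expected discounted power of wealth contracts over a trading period. -/
theorem IsAdmissible.lintegral_wealthAt_succ_le [IsProbabilityMeasure P] {x γ : ℝ}
    {α : ℕ → Ω → ℝ} {c : ℝ≥0 → Ω → ℝ} (hR : M.ReturnAssumption P k b)
    (h : M.IsAdmissible P x α c) (hγ : γ ∈ Ioo (0 : ℝ) 1)
    (hrho : 0 < M.lam + (M.rho - b * γ)) (n : ℕ) :
    ∫⁻ ω, ENNReal.ofReal (Real.exp (-M.rho * M.τ (n + 1) ω) * M.wealthAt x α c (n + 1) ω ^ γ) ∂P ≤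
      (∫⁻ ω, ENNReal.ofReal (Real.exp (-M.rho * M.τ n ω) * M.wealthAt x α c n ω ^ γ) ∂P) *
        ENNReal.ofReal ((k / M.zlo) ^ γ * (M.lam / (M.lam + (M.rho - b * γ)))) := by
  have := hR.markov
  have hk := hR.k_pos
  have hlo := hR.zlo_pos
  obtain ⟨y, hy, hyeq⟩ := h.exists_wealth_factor hR n
  obtain ⟨φ, hφ, hφeq⟩ := (h.measurable_α n).exists_eq_measurable_comp
  have hpre : ∀ ω, M.preWealth x α c n ω = y (M.history n ω) (M.waiting n ω) := by
    intro ω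
    rw [hyeq ω _ le_rfl, preWealth, waiting, add_sub_cancel]
  have hwealth : ∀ ω, M.wealthAt x α c n ω = y (M.history n ω) 0 := by
    intro ω
    rw [hyeq ω 0 (hR.waiting_pos n ω).le, add_zero]
    rfl
  have hm1 : Measurable fun ω => (M.history n ω, M.waiting n ω) :=
    (measurable_history n).prodMk (measurable_waiting n)
  have hm2 : Measurable fun ω => ((M.history n ω, M.waiting n ω), M.Z (n + 1) ω) :=
    hm1.prodMk (M.measurable_Z (n + 1))
  let F : ((Fin (n + 1) → ℝ × ℝ) × ℝ) × ℝ → ℝ≥0∞ := fun q =>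
    ENNReal.ofReal (Real.exp (-M.rho * ((q.1.1 (Fin.last n)).1 + q.1.2)) *
      (y q.1.1 q.1.2 + φ q.1.1 * q.2) ^ γ)
  have hFm : Measurable F := by
    have h1 : Measurable fun q : ((Fin (n + 1) → ℝ × ℝ) × ℝ) × ℝ =>
        y q.1.1 q.1.2 + φ q.1.1 * q.2 :=
      (hy.comp measurable_fst).add ((hφ.comp (by fun_prop)).mul measurable_snd)
    have h2 : Measurable fun q : ((Fin (n + 1) → ℝ × ℝ) × ℝ) × ℝ =>
        Real.exp (-M.rho * ((q.1.1 (Fin.last n)).1 + q.1.2)) := by fun_prop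
    exact (h2.mul (h1.pow_const γ)).ennreal_ofReal
  calc ∫⁻ ω, ENNReal.ofReal
        (Real.exp (-M.rho * M.τ (n + 1) ω) * M.wealthAt x α c (n + 1) ω ^ γ) ∂P
      = ∫⁻ ω, F ((M.history n ω, M.waiting n ω), M.Z (n + 1) ω) ∂P := by
        refine lintegral_congr fun ω => ?_
        rw [wealthAt_succ, hpre, hφeq, τ_succ]
        rfl
    _ = ∫⁻ ω, ∫⁻ z, F ((M.history n ω, M.waiting n ω), z) ∂(M.p (M.waiting n ω)) ∂P := by
        rw [← lintegral_map hFm hm2, hR.return_law n, Measure.lintegral_compProd hFm,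
          lintegral_map hFm.lintegral_kernel_prod_right' hm1]
        rfl
    -- The conditional moment bound produces a power of the wealth at the end of the period.
    -- Consumption only lowers wealth, so it is at most the wealth `y h 0` at the start, which no
    -- longer involves the waiting time; history and waiting time then separate by independence.
    _ ≤ ∫⁻ ω, ENNReal.ofReal (Real.exp (-M.rho * (M.history n ω (Fin.last n)).1) *
          y (M.history n ω) 0 ^ γ) *
          ENNReal.ofReal ((k / M.zlo) ^ γ * Real.exp (-(M.rho - b * γ) * M.waiting n ω)) ∂P := by
        refine lintegral_mono_ae ?_
        filter_upwards [h.l_le_preWealth hR n, h.preWealth_le hR n] with ω hω1 hω2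
        have hw := hR.waiting_pos n ω
        rw [hpre, hwealth] at hω2
        rw [hpre, hφeq] at hω1
        have hpos : 0 ≤ y (M.history n ω) (M.waiting n ω) := (l_nonneg hlo hω1.1).trans hω1.2
        have hpow := hR.lintegral_rpow_le hγ hw hω1.1 hω1.2
        simp only [F, ENNReal.ofReal_mul (Real.exp_pos _).le]
        rw [lintegral_const_mul' _ _ ENNReal.ofReal_ne_top]
        refine (mul_le_mul_right hpow _).trans ?_
        have hy0 : 0 ≤ y (M.history n ω) 0 := hpos.trans hω2
        rw [← ENNReal.ofReal_mul (Real.exp_pos _).le, ← ENNReal.ofReal_mul (Real.exp_pos _).le,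
          ← ENNReal.ofReal_mul (by positivity)]
        refine ENNReal.ofReal_le_ofReal ?_
        rw [show k * Real.exp (b * M.waiting n ω) / M.zlo =
          k / M.zlo * Real.exp (b * M.waiting n ω) by ring,
          Real.mul_rpow hpos (by positivity), Real.mul_rpow (by positivity) (by positivity),
          ← Real.exp_mul]
        calc Real.exp (-M.rho * ((M.history n ω (Fin.last n)).1 + M.waiting n ω)) *
              (y (M.history n ω) (M.waiting n ω) ^ γ *
                ((k / M.zlo) ^ γ * Real.exp (b * M.waiting n ω * γ)))
            ≤ Real.exp (-M.rho * ((M.history n ω (Fin.last n)).1 + M.waiting n ω)) *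
              (y (M.history n ω) 0 ^ γ *
                ((k / M.zlo) ^ γ * Real.exp (b * M.waiting n ω * γ))) := by
              gcongr
              exact hγ.1.le
          _ = Real.exp (-M.rho * (M.history n ω (Fin.last n)).1) * y (M.history n ω) 0 ^ γ *
              ((k / M.zlo) ^ γ * Real.exp (-(M.rho - b * γ) * M.waiting n ω)) := by
              rw [mul_add, Real.exp_add, show -(M.rho - b * γ) * M.waiting n ω =
                -M.rho * M.waiting n ω + b * M.waiting n ω * γ by ring, Real.exp_add]
              ring
    _ = _ := by
        have hF2 : Measurable fun h : Fin (n + 1) → ℝ × ℝ =>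
            ENNReal.ofReal (Real.exp (-M.rho * (h (Fin.last n)).1) * y h 0 ^ γ) := by
          have h1 : Measurable fun h : Fin (n + 1) → ℝ × ℝ => y h 0 :=
            hy.comp (measurable_id.prodMk measurable_const)
          have h2 : Measurable fun h : Fin (n + 1) → ℝ × ℝ =>
            Real.exp (-M.rho * (h (Fin.last n)).1) := by fun_prop
          exact (h2.mul (h1.pow_const γ)).ennreal_ofReal
        rw [hR.lintegral_history_mul_waiting n hF2
          (H := fun w => ENNReal.ofReal ((k / M.zlo) ^ γ * Real.exp (-(M.rho - b * γ) * w)))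
          (by fun_prop)]
        have hkz : 0 ≤ (k / M.zlo) ^ γ := by positivity
        simp only [ENNReal.ofReal_mul hkz]
        rw [lintegral_const_mul' _ _ ENNReal.ofReal_ne_top,
          lintegral_exp_expMeasure hR.lam_pos hrho]
        simp only [hwealth]
        rfl

/-- The discounted utility of consumption over a trading period. -/
theorem lintegral_utility_Ioc_le {U : ℝ → ℝ} {γ K ρ X s s' : ℝ} {c : ℝ → ℝ}
    (hγ : γ ∈ Ioo (0 : ℝ) 1) (hK : 0 ≤ K) (hρ : 0 < ρ) (h0 : U 0 = 0)
    (hU : ∀ x, 0 ≤ x → U x ≤ K * x ^ γ) (hc : ∀ t, 0 ≤ c t)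
    (hint : IntegrableOn c (Ioc s s')) (hX : ∫ t in Ioc s s', c t ≤ X) :
    ∫⁻ t in Ioc s s', ENNReal.ofReal (Real.exp (-ρ * t) * U (c t)) ≤
      ENNReal.ofReal (K * (1 / ρ + 1)) * ENNReal.ofReal (Real.exp (-ρ * s) * X ^ γ) := by
  have hX0 : 0 ≤ X := (integral_nonneg fun t => hc t).trans hX
  rcases hX0.eq_or_lt with hX0 | hX0
  · have h1 : ∫ t in Ioc s s', c t = 0 :=
      le_antisymm (hX.trans hX0.ge) (integral_nonneg fun t => hc t)
    rw [integral_eq_zero_iff_of_nonneg (fun t => hc t) hint] at h1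
    rw [lintegral_congr_ae (g := fun _ => 0)]
    · simp
    · filter_upwards [h1] with t ht
      simp [ht, h0]
  · have hXγ : 0 < X ^ γ := Real.rpow_pos_of_pos hX0 _
    -- The tangent line to `u ^ γ` at the total budget `X` is at most `X ^ γ (1 + u / X)`. Its
    -- constant part integrates to the factor `1 / ρ`, and its linear part to the factor `1`,
    -- because consumption totals at most `X`.
    have hpt : ∀ t ∈ Ioc s s', ENNReal.ofReal (Real.exp (-ρ * t) * U (c t)) ≤
        ENNReal.ofReal (K * X ^ γ) * (ENNReal.ofReal (Real.exp (-ρ * t)) +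
          ENNReal.ofReal (Real.exp (-ρ * s) / X) * ENNReal.ofReal (c t)) := by
      intro t ht
      have hct := hc t
      rw [← ENNReal.ofReal_mul (by positivity), ← ENNReal.ofReal_add (by positivity)
        (by positivity), ← ENNReal.ofReal_mul (by positivity)]
      refine ENNReal.ofReal_le_ofReal ?_
      have h1 : U (c t) ≤ K * (X ^ γ * (1 + c t / X)) := by
        refine (hU _ hct).trans ?_
        gcongr
        refine (rpow_le_tangent hγ hct hX0).trans ?_
        gcongr
        · linarith [hγ.1]
        · exact mul_le_of_le_one_left (by positivity) hγ.2.le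
      have h2 : Real.exp (-ρ * t) ≤ Real.exp (-ρ * s) :=
        Real.exp_le_exp.2 (by nlinarith [ht.1])
      calc Real.exp (-ρ * t) * U (c t) ≤ Real.exp (-ρ * t) * (K * (X ^ γ * (1 + c t / X))) := by
            gcongr
        _ = K * X ^ γ * (Real.exp (-ρ * t) + Real.exp (-ρ * t) * (c t / X)) := by ring
        _ ≤ K * X ^ γ * (Real.exp (-ρ * t) + Real.exp (-ρ * s) * (c t / X)) := by gcongr
        _ = _ := by ring
    have hcint : ∫⁻ t in Ioc s s', ENNReal.ofReal (c t) ≤ ENNReal.ofReal X := by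
      rw [← ofReal_integral_eq_lintegral_ofReal hint (ae_of_all _ hc)]
      exact ENNReal.ofReal_le_ofReal hX
    calc ∫⁻ t in Ioc s s', ENNReal.ofReal (Real.exp (-ρ * t) * U (c t))
        ≤ ∫⁻ t in Ioc s s', ENNReal.ofReal (K * X ^ γ) * (ENNReal.ofReal (Real.exp (-ρ * t)) +
          ENNReal.ofReal (Real.exp (-ρ * s) / X) * ENNReal.ofReal (c t)) :=
          setLIntegral_mono' measurableSet_Ioc hpt
      _ = ENNReal.ofReal (K * X ^ γ) * ((∫⁻ t in Ioc s s', ENNReal.ofReal (Real.exp (-ρ * t))) +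
          ENNReal.ofReal (Real.exp (-ρ * s) / X) * ∫⁻ t in Ioc s s', ENNReal.ofReal (c t)) := by
          rw [lintegral_const_mul' _ _ ENNReal.ofReal_ne_top, lintegral_add_left (by fun_prop),
            lintegral_const_mul' _ _ ENNReal.ofReal_ne_top]
      _ ≤ ENNReal.ofReal (K * X ^ γ) * (ENNReal.ofReal (Real.exp (-ρ * s) / ρ) +
          ENNReal.ofReal (Real.exp (-ρ * s) / X) * ENNReal.ofReal X) := by
          gcongr
          rw [← lintegral_exp_neg_mul_Ioi hρ]
          exact lintegral_mono_set Ioc_subset_Ioi_self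
      _ = _ := by
          rw [← ENNReal.ofReal_mul (by positivity), ← ENNReal.ofReal_add (by positivity)
            (by positivity), ← ENNReal.ofReal_mul (by positivity),
            ← ENNReal.ofReal_mul (by positivity)]
          congr 1
          field_simp

/-- The value function is finite, of power growth. -/
theorem exists_value_le [IsProbabilityMeasure P] (hR : M.ReturnAssumption P k b)
    (hU : M.UtilityAssumption k b) :
    ∃ γ ∈ Ioo (0 : ℝ) 1, ∃ C, 0 ≤ C ∧ b * γ < M.rho + M.lam ∧
      ∀ x, 0 ≤ x → M.value P x ≤ ENNReal.ofReal (C * x ^ γ) := by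
  obtain ⟨γ, hγ, ⟨K, hK, hUK⟩, hgap⟩ := hU.growth
  have hlam := hR.lam_pos
  have hlo := hR.zlo_pos
  have hk := hR.k_pos
  have hkz : 0 < k ^ γ / M.zlo ^ γ := by positivity
  have hrho : 0 < M.lam + (M.rho - b * γ) := by nlinarith
  -- The contraction factor of one period; `q < 1` is a rearrangement of the lower bound on `ρ`.
  set q := (k / M.zlo) ^ γ * (M.lam / (M.lam + (M.rho - b * γ))) with hq
  have hq0 : 0 ≤ q := by positivity
  have hq1 : q < 1 := by
    rw [hq, Real.div_rpow hk.le hlo.le, mul_div_assoc', div_lt_one hrho]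
    nlinarith
  refine ⟨γ, hγ, K * (1 / M.rho + 1) * (1 - q)⁻¹, ?_, by linarith, ?_⟩
  · have := hU.rho_pos
    have : 0 < (1 - q)⁻¹ := inv_pos.2 (by linarith)
    positivity
  intro x hx
  refine iSup_le fun α => iSup_le fun c => iSup_le fun h => ?_
  have hmom : ∀ n, ∫⁻ ω, ENNReal.ofReal
      (Real.exp (-M.rho * M.τ n ω) * M.wealthAt x α c n ω ^ γ) ∂P ≤
      ENNReal.ofReal (x ^ γ) * ENNReal.ofReal q ^ n := by
    intro n
    induction n with
    | zero => simp [wealthAt, hR.τ_zero]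
    | succ n ih =>
      refine (h.lintegral_wealthAt_succ_le hR hγ hrho n).trans ?_
      rw [pow_succ, ← mul_assoc]
      gcongr
  have hpath : ∀ᵐ ω ∂P, ∫⁻ t in Ioi (0 : ℝ),
      ENNReal.ofReal (Real.exp (-M.rho * t) * M.U (c t.toNNReal ω)) ≤
      ∑' n, ENNReal.ofReal (K * (1 / M.rho + 1)) *
        ENNReal.ofReal (Real.exp (-M.rho * M.τ n ω) * M.wealthAt x α c n ω ^ γ) := by
    filter_upwards [hR.tendsto_τ, ae_all_iff.2 h.integrable_c,
      ae_all_iff.2 fun n => h.l_le_preWealth hR n, ae_all_iff.2 fun n => h.wealthAt_sub hR n]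
      with ω hτ hcint hpre hsub
    -- Since the dates do not accumulate, the trading periods exhaust the time axis.
    have hcover : Ioi (0 : ℝ) ⊆ ⋃ n, Ioc (M.τ n ω) (M.τ (n + 1) ω) := by
      intro t ht
      have hex : ∃ n, t ≤ M.τ n ω := (hτ.eventually_ge_atTop t).exists
      classical
      have hfind := Nat.find_spec hex
      have hmin := fun m => Nat.find_min hex (m := m)
      rcases hn : Nat.find hex with _ | n
      · rw [hn, hR.τ_zero] at hfind
        exact absurd ht (not_lt.2 hfind)
      · refine mem_iUnion.2 ⟨n, ?_, by rwa [hn] at hfind⟩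
        exact not_le.1 (hmin n (by omega))
    refine (lintegral_mono_set hcover).trans ((lintegral_iUnion_le _ _).trans ?_)
    refine ENNReal.tsum_le_tsum fun n => ?_
    refine lintegral_utility_Ioc_le hγ hK.le hU.rho_pos hU.zero hUK (fun t => h.nonneg_c _ _)
      ((hcint (n + 1)).mono_set (Ioc_subset_Ioc_left (hR.τ_nonneg n ω))) ?_
    have := l_nonneg hlo (hpre n).1
    linarith [hsub n, (hpre n).2]
  calc M.expectedUtility P c
      ≤ ∫⁻ ω, ∑' n, ENNReal.ofReal (K * (1 / M.rho + 1)) *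
        ENNReal.ofReal (Real.exp (-M.rho * M.τ n ω) * M.wealthAt x α c n ω ^ γ) ∂P :=
        lintegral_mono_ae hpath
    _ = ∑' n, ENNReal.ofReal (K * (1 / M.rho + 1)) * ∫⁻ ω,
        ENNReal.ofReal (Real.exp (-M.rho * M.τ n ω) * M.wealthAt x α c n ω ^ γ) ∂P := by
        rw [lintegral_tsum]
        · simp_rw [lintegral_const_mul' _ _ ENNReal.ofReal_ne_top]
        · intro n
          exact (((((M.measurable_τ n).const_mul _).exp.mul
            ((h.measurable_wealthAt hR n).pow_const γ)).ennreal_ofReal).const_mul _).aemeasurable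
    _ ≤ ∑' n, ENNReal.ofReal (K * (1 / M.rho + 1)) *
        (ENNReal.ofReal (x ^ γ) * ENNReal.ofReal q ^ n) := by
        gcongr with n
        exact hmom n
    _ = _ := by
        have := hU.rho_pos
        rw [ENNReal.tsum_mul_left, ENNReal.tsum_mul_left, ENNReal.tsum_geometric,
          ← ENNReal.ofReal_one, ← ENNReal.ofReal_sub _ hq0,
          ← ENNReal.ofReal_inv_of_pos (by linarith), ← ENNReal.ofReal_mul (by positivity),
          ← ENNReal.ofReal_mul (by positivity)]
        congr 1
        ring

end IlliquidMarket

namespace IlliquidMarket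

variable {Ω : Type*} [MeasurableSpace Ω] {M : IlliquidMarket Ω} {P : Measure Ω} {k b : ℝ}

/-! ### Regularity of the value function -/

theorem UtilityAssumption.nonneg (hU : M.UtilityAssumption k b) {x : ℝ} (hx : 0 ≤ x) :
    0 ≤ M.U x := by
  rw [← hU.zero]
  exact hU.strictMono.monotoneOn self_mem_Ici hx hx

theorem IsAdmissible.mono {x x' : ℝ} {α : ℕ → Ω → ℝ} {c : ℝ≥0 → Ω → ℝ}
    (h : M.IsAdmissible P x α c) (hx : x ≤ x') : M.IsAdmissible P x' α c where
  measurable_α := h.measurable_α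
  predictable_c := h.predictable_c
  nonneg_c := h.nonneg_c
  integrable_c := h.integrable_c
  nonneg_wealth := by
    intro n hn
    filter_upwards [h.nonneg_wealth n hn] with ω hω
    unfold wealthAt at hω ⊢
    linarith

theorem value_mono : Monotone (M.value P) := fun _ _ hx =>
  iSup_mono fun _ => iSup_mono fun _ => iSup_mono' fun h => ⟨h.mono hx, le_rfl⟩

theorem isAdmissible_zero {x : ℝ} (hx : 0 ≤ x) : M.IsAdmissible P x 0 0 where
  measurable_α := fun _ => measurable_const
  predictable_c := stronglyMeasurable_const
  nonneg_c := fun _ _ => le_rfl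
  integrable_c := fun _ => ae_of_all _ fun _ => integrableOn_zero
  nonneg_wealth := fun n _ => ae_of_all _ fun ω => by simpa [wealthAt] using hx

theorem IsAdmissible.convexComb {x₁ x₂ θ₁ θ₂ : ℝ} {α₁ α₂ : ℕ → Ω → ℝ} {c₁ c₂ : ℝ≥0 → Ω → ℝ}
    (h₁ : M.IsAdmissible P x₁ α₁ c₁) (h₂ : M.IsAdmissible P x₂ α₂ c₂) (hθ₁ : 0 ≤ θ₁)
    (hθ₂ : 0 ≤ θ₂) :
    M.IsAdmissible P (θ₁ * x₁ + θ₂ * x₂) (fun n ω => θ₁ * α₁ n ω + θ₂ * α₂ n ω)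
      (fun t ω => θ₁ * c₁ t ω + θ₂ * c₂ t ω) where
  measurable_α := fun n =>
    ((h₁.measurable_α n).const_mul θ₁).add ((h₂.measurable_α n).const_mul θ₂)
  predictable_c :=
    (StronglyMeasurable.const_mul h₁.predictable_c θ₁).add
      (StronglyMeasurable.const_mul h₂.predictable_c θ₂)
  nonneg_c := fun t ω => add_nonneg (mul_nonneg hθ₁ (h₁.nonneg_c t ω))
    (mul_nonneg hθ₂ (h₂.nonneg_c t ω))
  integrable_c := by
    intro n
    filter_upwards [h₁.integrable_c n, h₂.integrable_c n] with ω i₁ i₂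
    exact (i₁.const_mul θ₁).add (i₂.const_mul θ₂)
  nonneg_wealth := by
    intro n hn
    filter_upwards [h₁.integrable_c n, h₂.integrable_c n, h₁.nonneg_wealth n hn,
      h₂.nonneg_wealth n hn] with ω i₁ i₂ w₁ w₂
    have hw : M.wealthAt (θ₁ * x₁ + θ₂ * x₂) (fun n ω => θ₁ * α₁ n ω + θ₂ * α₂ n ω)
        (fun t ω => θ₁ * c₁ t ω + θ₂ * c₂ t ω) n ω =
        θ₁ * M.wealthAt x₁ α₁ c₁ n ω + θ₂ * M.wealthAt x₂ α₂ c₂ n ω := by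
      unfold wealthAt
      rw [integral_add (i₁.const_mul θ₁) (i₂.const_mul θ₂), integral_const_mul,
        integral_const_mul]
      simp only [add_mul, Finset.sum_add_distrib, mul_assoc, ← Finset.mul_sum]
      ring
    rw [hw]
    positivity

/-- Concavity of the utility, in extended form. -/
theorem UtilityAssumption.ofReal_concave (hU : M.UtilityAssumption k b) {θ₁ θ₂ x₁ x₂ w : ℝ}
    (hθ₁ : 0 ≤ θ₁) (hθ₂ : 0 ≤ θ₂) (hθ : θ₁ + θ₂ = 1) (hx₁ : 0 ≤ x₁) (hx₂ : 0 ≤ x₂) (hw : 0 ≤ w) :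
    ENNReal.ofReal θ₁ * ENNReal.ofReal (w * M.U x₁) +
      ENNReal.ofReal θ₂ * ENNReal.ofReal (w * M.U x₂) ≤
      ENNReal.ofReal (w * M.U (θ₁ * x₁ + θ₂ * x₂)) := by
  have h1 := hU.nonneg hx₁
  have h2 := hU.nonneg hx₂
  rw [← ENNReal.ofReal_mul hθ₁, ← ENNReal.ofReal_mul hθ₂,
    ← ENNReal.ofReal_add (by positivity) (by positivity)]
  refine ENNReal.ofReal_le_ofReal ?_
  have h := hU.strictConcave.concaveOn.2 hx₁ hx₂ hθ₁ hθ₂ hθ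
  simp only [smul_eq_mul] at h
  calc θ₁ * (w * M.U x₁) + θ₂ * (w * M.U x₂) = w * (θ₁ * M.U x₁ + θ₂ * M.U x₂) := by ring
    _ ≤ _ := by gcongr

theorem value_eq_iSup (x : ℝ) : M.value P x =
    ⨆ π : {π : (ℕ → Ω → ℝ) × (ℝ≥0 → Ω → ℝ) // M.IsAdmissible P x π.1 π.2},
      M.expectedUtility P π.1.2 := by
  rw [iSup_subtype, iSup_prod]
  rfl

/-- Wealth is linear in capital, positions and consumption jointly, so mixtures of policies are
admissible from mixed capital and `U` is concave. Working in `[0,∞]` with the superadditive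
inequality for lower integrals avoids finiteness and measurability. -/
theorem value_concave (hU : M.UtilityAssumption k b) {θ₁ θ₂ x₁ x₂ : ℝ}
    (hθ₁ : 0 ≤ θ₁) (hθ₂ : 0 ≤ θ₂) (hθ : θ₁ + θ₂ = 1) (hx₁ : 0 ≤ x₁) (hx₂ : 0 ≤ x₂) :
    ENNReal.ofReal θ₁ * M.value P x₁ + ENNReal.ofReal θ₂ * M.value P x₂ ≤
      M.value P (θ₁ * x₁ + θ₂ * x₂) := by
  rw [value_eq_iSup x₁, value_eq_iSup x₂, ENNReal.mul_iSup, ENNReal.mul_iSup]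
  have : Nonempty {π : (ℕ → Ω → ℝ) × (ℝ≥0 → Ω → ℝ) // M.IsAdmissible P x₁ π.1 π.2} :=
    ⟨(0, 0), isAdmissible_zero hx₁⟩
  have : Nonempty {π : (ℕ → Ω → ℝ) × (ℝ≥0 → Ω → ℝ) // M.IsAdmissible P x₂ π.1 π.2} :=
    ⟨(0, 0), isAdmissible_zero hx₂⟩
  refine ENNReal.iSup_add_iSup_le fun π₁ π₂ => ?_
  refine le_trans ?_ (le_iSup_of_le _ (le_iSup_of_le _
    (le_iSup_of_le (π₁.2.convexComb π₂.2 hθ₁ hθ₂) le_rfl)))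
  unfold expectedUtility
  rw [← lintegral_const_mul' _ _ ENNReal.ofReal_ne_top,
    ← lintegral_const_mul' _ _ ENNReal.ofReal_ne_top]
  refine (le_lintegral_add _ _).trans (lintegral_mono fun ω => ?_)
  rw [← lintegral_const_mul' _ _ ENNReal.ofReal_ne_top,
    ← lintegral_const_mul' _ _ ENNReal.ofReal_ne_top]
  refine (le_lintegral_add _ _).trans (lintegral_mono fun t => ?_)
  exact hU.ofReal_concave hθ₁ hθ₂ hθ (π₁.2.nonneg_c _ _) (π₂.2.nonneg_c _ _) (Real.exp_pos _).le

/-- Concavity gives continuity in the open half-line but does not exclude an upward jump at `0`;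
there the bound `C x ^ γ` squeezes the value. -/
theorem continuousOn_value [IsProbabilityMeasure P] (hR : M.ReturnAssumption P k b)
    (hU : M.UtilityAssumption k b) : ContinuousOn (M.value P) (Ici 0) := by
  obtain ⟨γ, hγ, C, hC, -, hv⟩ := M.exists_value_le hR hU
  have hfin : ∀ x, 0 ≤ x → M.value P x ≠ ⊤ := fun x hx =>
    ne_top_of_le_ne_top ENNReal.ofReal_ne_top (hv x hx)
  have hconc : ConcaveOn ℝ (Ioi 0) fun x => (M.value P x).toReal := by
    refine ⟨convex_Ioi 0, fun x hx y hy θ₁ θ₂ h1 h2 h => ?_⟩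
    have hx' : 0 ≤ x := le_of_lt hx
    have hy' : 0 ≤ y := le_of_lt hy
    have hxy : 0 ≤ θ₁ * x + θ₂ * y := by positivity
    have := (ENNReal.toReal_le_toReal (by finiteness [hfin x hx', hfin y hy'])
      (hfin _ hxy)).2 (value_concave (P := P) hU h1 h2 h hx' hy')
    rw [ENNReal.toReal_add (by finiteness [hfin x hx']) (by finiteness [hfin y hy']),
      ENNReal.toReal_mul, ENNReal.toReal_mul, ENNReal.toReal_ofReal h1,
      ENNReal.toReal_ofReal h2] at this
    exact this
  have hcont : ContinuousOn (fun x => (M.value P x).toReal) (Ioi 0) :=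
    hconc.continuousOn isOpen_Ioi
  intro x hx
  rcases (show (0 : ℝ) ≤ x from hx).eq_or_lt with rfl | hx0
  · have h0 : M.value P 0 = 0 := by
      have := hv 0 le_rfl
      rw [Real.zero_rpow hγ.1.ne', mul_zero, ENNReal.ofReal_zero] at this
      exact le_antisymm this zero_le
    have hlim : Tendsto (fun x : ℝ => ENNReal.ofReal (C * x ^ γ)) (𝓝[≥] 0) (𝓝 0) := by
      have : ContinuousAt (fun x : ℝ => ENNReal.ofReal (C * x ^ γ)) 0 := by
        refine ENNReal.continuous_ofReal.continuousAt.comp ?_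
        exact continuousAt_const.mul (Real.continuousAt_rpow_const _ _ (Or.inr hγ.1.le))
      have h := this.tendsto.mono_left (nhdsWithin_le_nhds (s := Ici 0))
      simpa [Real.zero_rpow hγ.1.ne'] using h
    unfold ContinuousWithinAt
    rw [h0]
    refine tendsto_of_tendsto_of_tendsto_of_le_of_le' tendsto_const_nhds hlim
      (Eventually.of_forall fun _ => zero_le) ?_
    filter_upwards [self_mem_nhdsWithin] with y hy using hv y hy
  · refine ContinuousAt.continuousWithinAt ?_
    have h1 : ContinuousAt (fun x => ENNReal.ofReal (M.value P x).toReal) x :=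
      ENNReal.continuous_ofReal.continuousAt.comp (hcont.continuousAt (Ioi_mem_nhds hx0))
    refine h1.congr ?_
    filter_upwards [Ioi_mem_nhds hx0] with y hy
    exact ENNReal.ofReal_toReal (hfin y (le_of_lt hy))

/-! ### The running reward of the auxiliary problem -/

/-- The properties of the auxiliary problem for the position `a` on which its solution rests. -/
structure AuxRegular (M : IlliquidMarket Ω) (P : Measure Ω) (a : ℝ) : Prop where
  rate_pos : 0 < M.rho + M.lam
  measurable_g : Measurable fun q : ℝ × ℝ => M.g P q.1 q.2 a
  mono_g : ∀ s, Monotone fun y => M.g P s y a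
  finite_g : ∀ s, 0 < s → ∀ y, M.l a ≤ y → M.g P s y a ≠ ⊤
  concave_g : ∀ s, 0 < s → ∀ y₁ y₂, M.l a ≤ y₁ → M.l a ≤ y₂ → ∀ θ₁ θ₂ : ℝ, 0 ≤ θ₁ → 0 ≤ θ₂ →
    θ₁ + θ₂ = 1 → ENNReal.ofReal θ₁ * M.g P s y₁ a + ENNReal.ofReal θ₂ * M.g P s y₂ a ≤
      M.g P s (θ₁ * y₁ + θ₂ * y₂) a
  tendsto_g : ∀ s, 0 < s → ∀ y, M.l a ≤ y →
    Tendsto (fun n : ℕ => M.g P s (y + 1 / (n + 1)) a) atTop (𝓝 (M.g P s y a))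
  lintegral_g : ∀ t y, 0 ≤ t → M.l a ≤ y →
    ∫⁻ s in Ioi t, ENNReal.ofReal (Real.exp (-(M.rho + M.lam) * (s - t))) * M.g P s y a ≠ ⊤

/-- A covered position leaves nonnegative wealth almost surely, so monotonicity, concavity and right
continuity of the value integrate to `g`. The growth bound gives `g(s,y,a) ≤ A exp(b γ s)`, which is
integrable against the discount because `b γ < ρ + λ`. -/
theorem auxRegular [IsProbabilityMeasure P] (hR : M.ReturnAssumption P k b)
    (hU : M.UtilityAssumption k b) {a : ℝ} (ha : a ∈ M.positions) : M.AuxRegular P a := by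
  have := hR.markov
  obtain ⟨γ, hγ, C, hC, hgap, hv⟩ := M.exists_value_le hR hU
  have hlo := hR.zlo_pos
  have hk := hR.k_pos
  have hae : ∀ s, 0 < s → ∀ y, M.l a ≤ y → ∀ᵐ z ∂(M.p s), 0 ≤ y + a * z := fun s hs y hy =>
    (hR.return_support s hs).ae_nonneg hlo hR.zhi_pos ha hy
  have hmv : Measurable (M.value P) := value_mono.measurable
  have hbound : ∀ s, 0 < s → ∀ y, M.l a ≤ y → M.g P s y a ≤
      ENNReal.ofReal (M.lam * (C * (y * (k / M.zlo)) ^ γ) * Real.exp (b * γ * s)) := by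
    intro s hs y hy
    have hy0 : 0 ≤ y := (l_nonneg hlo ha).trans hy
    have hlam := hR.lam_pos
    have h1 : ∫⁻ z, M.value P (y + a * z) ∂(M.p s) ≤ ENNReal.ofReal C *
        ENNReal.ofReal ((y * (k * Real.exp (b * s) / M.zlo)) ^ γ) := by
      refine le_trans ?_ (mul_le_mul_right (hR.lintegral_rpow_le hγ hs ha hy) _)
      rw [← lintegral_const_mul' _ _ ENNReal.ofReal_ne_top]
      refine lintegral_mono_ae ?_
      filter_upwards [hae s hs y hy] with z hz
      rw [← ENNReal.ofReal_mul hC]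
      exact hv _ hz
    refine (mul_le_mul_right h1 _).trans ?_
    rw [← ENNReal.ofReal_mul hC, ← ENNReal.ofReal_mul hlam.le]
    refine ENNReal.ofReal_le_ofReal (le_of_eq ?_)
    rw [show y * (k * Real.exp (b * s) / M.zlo) = y * (k / M.zlo) * Real.exp (b * s) by ring,
      Real.mul_rpow (by positivity) (by positivity), ← Real.exp_mul]
    ring_nf
  refine ⟨by linarith [hR.lam_pos, hU.rho_pos], ?_, ?_, ?_, ?_, ?_, ?_⟩
  · refine Measurable.const_mul ?_ _
    have h1 : Measurable fun q : (ℝ × ℝ) × ℝ => M.value P (q.1.2 + a * q.2) :=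
      hmv.comp (by fun_prop)
    exact h1.lintegral_kernel_prod_right' (κ := M.p.comap Prod.fst measurable_fst)
  · intro s y y' hy
    exact mul_le_mul_right (lintegral_mono fun z => value_mono (by linarith)) _
  · intro s hs y hy
    exact ne_top_of_le_ne_top ENNReal.ofReal_ne_top (hbound s hs y hy)
  · intro s hs y₁ y₂ hy₁ hy₂ θ₁ θ₂ hθ₁ hθ₂ hθ
    unfold g
    rw [mul_left_comm, mul_left_comm (ENNReal.ofReal θ₂), ← mul_add]
    refine mul_le_mul_right ?_ _
    rw [← lintegral_const_mul' _ _ ENNReal.ofReal_ne_top,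
      ← lintegral_const_mul' _ _ ENNReal.ofReal_ne_top]
    refine (le_lintegral_add _ _).trans (lintegral_mono_ae ?_)
    filter_upwards [hae s hs y₁ hy₁, hae s hs y₂ hy₂] with z h1 h2
    refine (value_concave hU hθ₁ hθ₂ hθ h1 h2).trans (le_of_eq ?_)
    congr 1
    linear_combination (a * z) * hθ
  · intro s hs y hy
    refine ENNReal.Tendsto.const_mul ?_ (Or.inr ENNReal.ofReal_ne_top)
    refine lintegral_tendsto_of_tendsto_of_antitone
      (fun n => (hmv.comp (by fun_prop)).aemeasurable) ?_ ?_ ?_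
    · refine ae_of_all _ fun z m n hmn => value_mono ?_
      have : (1 : ℝ) / (n + 1) ≤ 1 / (m + 1) := by gcongr
      linarith
    -- Monotone convergence along a decreasing sequence needs its first term, here at wealth `y +
    -- 1`, to have a finite integral.
    · have h := hbound s hs (y + 1 / ((0 : ℕ) + 1)) (by simp; linarith)
      intro htop
      refine absurd (h.trans_lt ENNReal.ofReal_lt_top) (not_lt.2 ?_)
      unfold g
      rw [htop, ENNReal.mul_top (by simpa using hR.lam_pos)]
    · filter_upwards [hae s hs y hy] with z hz
      have h1 := continuousOn_value hR hU (y + a * z) hz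
      refine h1.tendsto.comp (tendsto_nhdsWithin_iff.2 ⟨?_, ?_⟩)
      · have : Tendsto (fun n : ℕ => y + 1 / ((n : ℝ) + 1) + a * z) atTop (𝓝 (y + 0 + a * z)) :=
          (tendsto_const_nhds.add tendsto_one_div_add_atTop_nhds_zero_nat).add tendsto_const_nhds
        simpa using this
      · refine Eventually.of_forall fun n => ?_
        have : (0 : ℝ) ≤ 1 / (n + 1) := by positivity
        simp only [mem_Ici]
        linarith
  · intro t y ht hy
    have hlam := hR.lam_pos
    have hy0 : 0 ≤ y := (l_nonneg hlo ha).trans hy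
    have hr : 0 < M.rho + M.lam - b * γ := by linarith
    set A := M.lam * (C * (y * (k / M.zlo)) ^ γ) with hA
    have hA0 : 0 ≤ A := by positivity
    have h1 : ∫⁻ s in Ioi t, ENNReal.ofReal (Real.exp (-(M.rho + M.lam) * (s - t))) *
        M.g P s y a ≤ ∫⁻ s in Ioi t, ENNReal.ofReal (A * Real.exp ((M.rho + M.lam) * t)) *
          ENNReal.ofReal (Real.exp (-(M.rho + M.lam - b * γ) * s)) := by
      refine setLIntegral_mono' measurableSet_Ioi fun s hs => ?_
      refine (mul_le_mul_right (hbound s (ht.trans_lt hs) y hy) _).trans ?_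
      rw [← ENNReal.ofReal_mul (Real.exp_pos _).le, ← ENNReal.ofReal_mul (by positivity)]
      refine ENNReal.ofReal_le_ofReal (le_of_eq ?_)
      have h2 : Real.exp (-(M.rho + M.lam) * (s - t)) * Real.exp (b * γ * s) =
          Real.exp ((M.rho + M.lam) * t) * Real.exp (-(M.rho + M.lam - b * γ) * s) := by
        rw [← Real.exp_add, ← Real.exp_add]
        ring_nf
      linear_combination A * h2
    refine ne_top_of_le_ne_top ?_ h1
    rw [lintegral_const_mul' _ _ ENNReal.ofReal_ne_top, lintegral_exp_neg_mul_Ioi hr]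
    finiteness

end IlliquidMarket

namespace IlliquidMarket

variable {Ω : Type*} [MeasurableSpace Ω] {M : IlliquidMarket Ω} {P : Measure Ω} {k b : ℝ}

/-! ### Admissible consumption rates and payoffs of the auxiliary problem -/

/-- The discount factor from time `s` to time `t` in the auxiliary problem. -/
noncomputable abbrev discount (M : IlliquidMarket Ω) (t s : ℝ) : ℝ≥0∞ :=
  ENNReal.ofReal (Real.exp (-(M.rho + M.lam) * (s - t)))

theorem lintegral_discount (hβ : 0 < M.rho + M.lam) (t : ℝ) :
    ∫⁻ s in Ioi t, M.discount t s = ENNReal.ofReal (1 / (M.rho + M.lam)) := by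
  have h : ∀ s, M.discount t s = ENNReal.ofReal (Real.exp ((M.rho + M.lam) * t)) *
      ENNReal.ofReal (Real.exp (-(M.rho + M.lam) * s)) := by
    intro s
    rw [discount, ← ENNReal.ofReal_mul (Real.exp_pos _).le, ← Real.exp_add]
    ring_nf
  simp_rw [h]
  rw [lintegral_const_mul' _ _ ENNReal.ofReal_ne_top, lintegral_exp_neg_mul_Ioi hβ,
    ← ENNReal.ofReal_mul (Real.exp_pos _).le, mul_div_assoc', ← Real.exp_add,
    neg_mul, add_neg_cancel, Real.exp_zero]

theorem discount_le_one (hβ : 0 < M.rho + M.lam) {t s : ℝ} (hs : t ≤ s) : M.discount t s ≤ 1 := by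
  rw [discount, ENNReal.ofReal_le_one, Real.exp_le_one_iff]
  nlinarith

theorem measurable_discount (t : ℝ) : Measurable (M.discount t) := by
  unfold discount
  fun_prop

theorem measurable_auxWealth (t x : ℝ) {c : ℝ → ℝ} (hc : Measurable c) :
    Measurable (auxWealth t x c) := by
  have h : auxWealth t x c = fun s => x - ∫ u, (Ioc t s).indicator c u := by
    ext s
    rw [integral_indicator measurableSet_Ioc]
    rfl
  rw [h]
  refine measurable_const.sub (StronglyMeasurable.measurable ?_)
  refine StronglyMeasurable.integral_prod_right (f := fun s u => (Ioc t s).indicator c u) ?_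
  refine Measurable.stronglyMeasurable ?_
  have hset : MeasurableSet {r : ℝ × ℝ | r.2 ∈ Ioc t r.1} :=
    (measurableSet_lt measurable_const measurable_snd).inter
      (measurableSet_le measurable_snd measurable_fst)
  exact (hc.comp measurable_snd).indicator hset

theorem auxWealth_self (t x : ℝ) (c : ℝ → ℝ) : auxWealth t x c t = x := by
  simp [auxWealth]

theorem IsAuxAdmissible.le_start {t x a s : ℝ} {c : ℝ → ℝ} (h : M.IsAuxAdmissible t x a c) :
    auxWealth t x c s ≤ x := by
  have : 0 ≤ ∫ u in Ioc t s, c u :=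
    setIntegral_nonneg measurableSet_Ioc fun u hu => h.nonneg u hu.1.le
  unfold auxWealth
  linarith

theorem IsAuxAdmissible.auxWealth_sub {t x a s s' : ℝ} {c : ℝ → ℝ}
    (h : M.IsAuxAdmissible t x a c) (hs : t ≤ s) (hs' : s ≤ s') :
    auxWealth t x c s - auxWealth t x c s' = ∫ u in Ioc s s', c u := by
  unfold auxWealth
  rw [← Ioc_union_Ioc_eq_Ioc hs hs', setIntegral_union (Ioc_disjoint_Ioc_of_le le_rfl)
    measurableSet_Ioc (h.integrable s hs)
    ((h.integrable s' (hs.trans hs')).mono_set (Ioc_subset_Ioc_left hs))]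
  ring

theorem IsAuxAdmissible.auxWealth_anti {t x a s s' : ℝ} {c : ℝ → ℝ}
    (h : M.IsAuxAdmissible t x a c) (hs : t ≤ s) (hs' : s ≤ s') :
    auxWealth t x c s' ≤ auxWealth t x c s := by
  have h1 := h.auxWealth_sub hs hs'
  have h2 : 0 ≤ ∫ u in Ioc s s', c u :=
    setIntegral_nonneg measurableSet_Ioc fun u hu => h.nonneg u (hs.trans hu.1.le)
  linarith

theorem IsAuxAdmissible.lintegral_Ioc {t x a s : ℝ} {c : ℝ → ℝ} (h : M.IsAuxAdmissible t x a c)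
    (hs : t ≤ s) : ∫⁻ u in Ioc t s, ENNReal.ofReal (c u) =
      ENNReal.ofReal (∫ u in Ioc t s, c u) := by
  refine (ofReal_integral_eq_lintegral_ofReal (h.integrable s hs) ?_).symm
  filter_upwards [ae_restrict_mem measurableSet_Ioc] with u hu using h.nonneg u hu.1.le

/-- Total consumption is at most the wealth not needed to cover the position. -/
theorem IsAuxAdmissible.lintegral_le {t x a : ℝ} {c : ℝ → ℝ} (h : M.IsAuxAdmissible t x a c) :
    ∫⁻ s in Ioi t, ENNReal.ofReal (c s) ≤ ENNReal.ofReal (x - M.l a) := by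
  have hU : Ioi t = ⋃ n : ℕ, Ioc t (t + n) := by
    ext s
    simp only [mem_Ioi, mem_iUnion, mem_Ioc]
    refine ⟨fun hs => ?_, fun ⟨n, hn⟩ => hn.1⟩
    obtain ⟨n, hn⟩ := exists_nat_ge (s - t)
    exact ⟨n, hs, by linarith⟩
  rw [hU, setLIntegral_iUnion_of_directed]
  · refine iSup_le fun n => ?_
    have hn : t ≤ t + n := by simp
    rw [h.lintegral_Ioc hn]
    refine ENNReal.ofReal_le_ofReal ?_
    have := h.le_wealth _ hn
    unfold auxWealth at this
    linarith
  · refine Monotone.directed_le fun m n hmn => Ioc_subset_Ioc_right ?_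
    have : (m : ℝ) ≤ n := by exact_mod_cast hmn
    linarith

/-- Wealth is nonincreasing, so the constraint at all times amounts to one budget inequality on
total consumption. In this form it passes to limits by Fatou's lemma. -/
theorem isAuxAdmissible_of_lintegral_le {t x a : ℝ} {c : ℝ → ℝ} (hx : M.l a ≤ x)
    (hm : Measurable c) (hc : ∀ s, t ≤ s → 0 ≤ c s)
    (hint : ∫⁻ s in Ioi t, ENNReal.ofReal (c s) ≤ ENNReal.ofReal (x - M.l a)) :
    M.IsAuxAdmissible t x a c := by
  have hpos : ∀ s, ∀ᵐ u ∂(volume.restrict (Ioc t s)), 0 ≤ c u := fun s => by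
    filter_upwards [ae_restrict_mem measurableSet_Ioc] with u hu using hc u hu.1.le
  have hle : ∀ s, ∫⁻ u in Ioc t s, ENNReal.ofReal (c u) ≤ ENNReal.ofReal (x - M.l a) :=
    fun s => (lintegral_mono_set Ioc_subset_Ioi_self).trans hint
  have hi : ∀ s, IntegrableOn c (Ioc t s) := by
    intro s
    refine ⟨hm.aestronglyMeasurable, ?_⟩
    rw [hasFiniteIntegral_iff_ofReal (hpos s)]
    exact (hle s).trans_lt ENNReal.ofReal_lt_top
  refine ⟨hm, hc, fun s _ => hi s, fun s _ => ?_⟩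
  have h1 := hle s
  rw [← ofReal_integral_eq_lintegral_ofReal (hi s) (hpos s),
    ENNReal.ofReal_le_ofReal_iff (by linarith)] at h1
  unfold auxWealth
  linarith

theorem isAuxAdmissible_zero {t x a : ℝ} (hx : M.l a ≤ x) : M.IsAuxAdmissible t x a 0 :=
  isAuxAdmissible_of_lintegral_le hx measurable_const (fun _ _ => le_rfl) (by simp)

theorem auxWealth_convexComb {t x₁ x₂ a s θ₁ θ₂ : ℝ} {c₁ c₂ : ℝ → ℝ}
    (h₁ : M.IsAuxAdmissible t x₁ a c₁) (h₂ : M.IsAuxAdmissible t x₂ a c₂) (hs : t ≤ s) :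
    auxWealth t (θ₁ * x₁ + θ₂ * x₂) (fun u => θ₁ * c₁ u + θ₂ * c₂ u) s =
      θ₁ * auxWealth t x₁ c₁ s + θ₂ * auxWealth t x₂ c₂ s := by
  unfold auxWealth
  rw [integral_add ((h₁.integrable s hs).const_mul θ₁) ((h₂.integrable s hs).const_mul θ₂),
    integral_const_mul, integral_const_mul]
  ring

theorem IsAuxAdmissible.convexComb {t x₁ x₂ a θ₁ θ₂ : ℝ} {c₁ c₂ : ℝ → ℝ}
    (h₁ : M.IsAuxAdmissible t x₁ a c₁) (h₂ : M.IsAuxAdmissible t x₂ a c₂) (hθ₁ : 0 ≤ θ₁)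
    (hθ₂ : 0 ≤ θ₂) (hθ : θ₁ + θ₂ = 1) :
    M.IsAuxAdmissible t (θ₁ * x₁ + θ₂ * x₂) a (fun u => θ₁ * c₁ u + θ₂ * c₂ u) where
  measurable := (h₁.measurable.const_mul θ₁).add (h₂.measurable.const_mul θ₂)
  nonneg := fun s hs => add_nonneg (mul_nonneg hθ₁ (h₁.nonneg s hs))
    (mul_nonneg hθ₂ (h₂.nonneg s hs))
  integrable := fun s hs => ((h₁.integrable s hs).const_mul θ₁).add
    ((h₂.integrable s hs).const_mul θ₂)
  le_wealth := by
    intro s hs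
    rw [auxWealth_convexComb h₁ h₂ hs]
    have e1 := h₁.le_wealth s hs
    have e2 := h₂.le_wealth s hs
    calc M.l a = θ₁ * M.l a + θ₂ * M.l a := by rw [← add_mul, hθ, one_mul]
      _ ≤ _ := by gcongr

/-- Nothing is known about `U` on the negative axis; cutting off at `0` gives a monotone, hence
measurable, function on all of `ℝ`. -/
theorem measurable_posPart_utility (hU : M.UtilityAssumption k b) :
    Measurable fun y => M.U (max y 0) :=
  Monotone.measurable fun _ _ h => hU.strictMono.monotoneOn
    (show (0 : ℝ) ≤ _ from le_max_right _ _) (show (0 : ℝ) ≤ _ from le_max_right _ _)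
    (max_le_max_right 0 h)

/-- The strict concavity of the utility as seen by two consumption rates. -/
noncomputable def utilityGap (M : IlliquidMarket Ω) (θ₁ θ₂ y₁ y₂ : ℝ) : ℝ :=
  M.U (θ₁ * y₁ + θ₂ * y₂) - (θ₁ * M.U y₁ + θ₂ * M.U y₂)

theorem utilityGap_nonneg (hU : M.UtilityAssumption k b) {θ₁ θ₂ y₁ y₂ : ℝ} (hθ₁ : 0 ≤ θ₁)
    (hθ₂ : 0 ≤ θ₂) (hθ : θ₁ + θ₂ = 1) (hy₁ : 0 ≤ y₁) (hy₂ : 0 ≤ y₂) :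
    0 ≤ M.utilityGap θ₁ θ₂ y₁ y₂ :=
  sub_nonneg.2 (hU.strictConcave.concaveOn.2 hy₁ hy₂ hθ₁ hθ₂ hθ)

/-- Concavity of the payoff, with the gain due to the strict concavity of the utility. -/
theorem auxPayoff_concave (hU : M.UtilityAssumption k b) {t x₁ x₂ a θ₁ θ₂ : ℝ} {c₁ c₂ : ℝ → ℝ}
    (hA : M.AuxRegular P a) (ht : 0 ≤ t) (h₁ : M.IsAuxAdmissible t x₁ a c₁)
    (h₂ : M.IsAuxAdmissible t x₂ a c₂) (hθ₁ : 0 ≤ θ₁) (hθ₂ : 0 ≤ θ₂) (hθ : θ₁ + θ₂ = 1) :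
    ENNReal.ofReal θ₁ * M.auxPayoff P t x₁ a c₁ + ENNReal.ofReal θ₂ * M.auxPayoff P t x₂ a c₂ +
      ∫⁻ s in Ioi t, M.discount t s * ENNReal.ofReal (M.utilityGap θ₁ θ₂ (c₁ s) (c₂ s)) ≤
      M.auxPayoff P t (θ₁ * x₁ + θ₂ * x₂) a (fun u => θ₁ * c₁ u + θ₂ * c₂ u) := by
  unfold auxPayoff
  rw [← lintegral_const_mul' _ _ ENNReal.ofReal_ne_top,
    ← lintegral_const_mul' _ _ ENNReal.ofReal_ne_top]
  refine (add_le_add_left (le_lintegral_add _ _) _).trans ((le_lintegral_add _ _).trans ?_)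
  refine setLIntegral_mono' measurableSet_Ioi fun s hs => ?_
  have hs' : t ≤ s := le_of_lt hs
  have n1 := h₁.nonneg s hs'
  have n2 := h₂.nonneg s hs'
  have hgap := utilityGap_nonneg hU hθ₁ hθ₂ hθ n1 n2
  have u1 := hU.nonneg n1
  have u2 := hU.nonneg n2
  have hg := hA.concave_g s (ht.trans_lt hs) _ _ (h₁.le_wealth s hs') (h₂.le_wealth s hs')
    θ₁ θ₂ hθ₁ hθ₂ hθ
  rw [auxWealth_convexComb h₁ h₂ hs']
  have hUeq : ENNReal.ofReal (M.U (θ₁ * c₁ s + θ₂ * c₂ s)) =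
      ENNReal.ofReal θ₁ * ENNReal.ofReal (M.U (c₁ s)) +
      ENNReal.ofReal θ₂ * ENNReal.ofReal (M.U (c₂ s)) +
      ENNReal.ofReal (M.utilityGap θ₁ θ₂ (c₁ s) (c₂ s)) := by
    rw [← ENNReal.ofReal_mul hθ₁, ← ENNReal.ofReal_mul hθ₂,
      ← ENNReal.ofReal_add (by positivity) (by positivity),
      ← ENNReal.ofReal_add (by positivity) hgap]
    congr 1
    unfold utilityGap
    ring
  rw [hUeq]
  set D := M.discount t s
  calc _ = D * ((ENNReal.ofReal θ₁ * ENNReal.ofReal (M.U (c₁ s)) +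
        ENNReal.ofReal θ₂ * ENNReal.ofReal (M.U (c₂ s)) +
        ENNReal.ofReal (M.utilityGap θ₁ θ₂ (c₁ s) (c₂ s))) +
        (ENNReal.ofReal θ₁ * M.g P s (auxWealth t x₁ c₁ s) a +
          ENNReal.ofReal θ₂ * M.g P s (auxWealth t x₂ c₂ s) a)) := by
        simp only [D, discount]
        ring
    _ ≤ _ := by gcongr

theorem UtilityAssumption.exists_le_add (hU : M.UtilityAssumption k b) :
    ∃ K, 0 < K ∧ ∀ y, 0 ≤ y → M.U y ≤ K * (1 + y) := by
  obtain ⟨γ, hγ, ⟨K, hK, hUK⟩, -⟩ := hU.growth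
  refine ⟨K, hK, fun y hy => (hUK y hy).trans ?_⟩
  gcongr
  have := rpow_le_tangent hγ hy one_pos
  rw [Real.one_rpow, one_mul, div_one] at this
  have h1 := hγ.1
  have h2 := hγ.2
  nlinarith

/-- The utility is sublinear. -/
theorem UtilityAssumption.exists_le_min_add (hU : M.UtilityAssumption k b) {ε : ℝ} (hε : 0 < ε) :
    ∃ R, 0 < R ∧ ∀ y, 0 ≤ y → M.U y ≤ M.U (min y R) + ε * y := by
  obtain ⟨γ, hγ, ⟨K, hK, hUK⟩, -⟩ := hU.growth
  have hlim : Tendsto (fun y : ℝ => K * y ^ (-(1 - γ))) atTop (𝓝 (K * 0)) :=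
    (tendsto_rpow_neg_atTop (by linarith [hγ.2])).const_mul K
  rw [mul_zero] at hlim
  obtain ⟨R, hR⟩ := eventually_atTop.1 ((hlim.eventually (gt_mem_nhds hε)).and
    (eventually_gt_atTop 0))
  have hR0 : 0 < R := (hR R le_rfl).2
  refine ⟨R, hR0, fun y hy => ?_⟩
  rcases le_total y R with h | h
  · rw [min_eq_left h]
    have : 0 ≤ ε * y := by positivity
    linarith
  · have hy0 : 0 < y := (hR y h).2
    rw [min_eq_right h]
    have h1 := hU.nonneg hR0.le
    have h2 : K * y ^ γ ≤ ε * y := by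
      have h3 := (hR y h).1.le
      have h4 : y ^ γ = y ^ (-(1 - γ)) * y := by
        rw [← Real.rpow_add_one hy0.ne']
        congr 1
        ring
      rw [h4, ← mul_assoc]
      gcongr
    linarith [hUK y hy]

/-- A bound independent of the rate: total consumption is at most `x - l(a)`, utility is at most
linear, and wealth never exceeds `x`. It makes the auxiliary value finite. -/
theorem auxPayoff_le {t x a : ℝ} (hA : M.AuxRegular P a) {K : ℝ}
    (hK : 0 < K) (hUK : ∀ y, 0 ≤ y → M.U y ≤ K * (1 + y))
    {c : ℝ → ℝ} (h : M.IsAuxAdmissible t x a c) :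
    M.auxPayoff P t x a c ≤ ENNReal.ofReal K * (ENNReal.ofReal (1 / (M.rho + M.lam)) +
      ENNReal.ofReal (x - M.l a)) + ∫⁻ s in Ioi t, M.discount t s * M.g P s x a := by
  have hβ := hA.rate_pos
  rw [← lintegral_discount hβ t]
  have hint := h.lintegral_le
  calc M.auxPayoff P t x a c
      ≤ ∫⁻ s in Ioi t, (ENNReal.ofReal K * (M.discount t s + ENNReal.ofReal (c s)) +
          M.discount t s * M.g P s x a) := by
        refine setLIntegral_mono' measurableSet_Ioi fun s hs => ?_
        have hs' : t ≤ s := le_of_lt hs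
        have n := h.nonneg s hs'
        rw [mul_add]
        refine add_le_add ?_ (mul_le_mul_right (hA.mono_g s h.le_start) _)
        have h1 : ENNReal.ofReal (M.U (c s)) ≤
            ENNReal.ofReal K * (1 + ENNReal.ofReal (c s)) := by
          rw [← ENNReal.ofReal_one, ← ENNReal.ofReal_add zero_le_one n, ← ENNReal.ofReal_mul hK.le]
          exact ENNReal.ofReal_le_ofReal (hUK _ n)
        have h2 := discount_le_one hβ hs'
        calc M.discount t s * ENNReal.ofReal (M.U (c s))
            ≤ M.discount t s * (ENNReal.ofReal K * (1 + ENNReal.ofReal (c s))) := by gcongr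
          _ = ENNReal.ofReal K * (M.discount t s + M.discount t s * ENNReal.ofReal (c s)) := by
              ring
          _ ≤ ENNReal.ofReal K * (M.discount t s + 1 * ENNReal.ofReal (c s)) := by gcongr
          _ = _ := by rw [one_mul]
    _ = ENNReal.ofReal K * ((∫⁻ s in Ioi t, M.discount t s) +
          ∫⁻ s in Ioi t, ENNReal.ofReal (c s)) + ∫⁻ s in Ioi t, M.discount t s * M.g P s x a := by
        have hmd := measurable_discount (M := M) t
        have hmc := h.measurable.ennreal_ofReal
        have hms : Measurable fun s => ENNReal.ofReal K *
            (M.discount t s + ENNReal.ofReal (c s)) := (hmd.add hmc).const_mul _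
        rw [lintegral_add_left hms,
          lintegral_const_mul' _ _ ENNReal.ofReal_ne_top, lintegral_add_left hmd]
    _ ≤ _ := by gcongr

theorem auxValue_ne_top (hU : M.UtilityAssumption k b) {t x a : ℝ} (hA : M.AuxRegular P a)
    (ht : 0 ≤ t) (hx : M.l a ≤ x) : M.auxValue P t x a ≠ ⊤ := by
  obtain ⟨K, hK, hUK⟩ := hU.exists_le_add
  refine ne_top_of_le_ne_top ?_ (iSup₂_le fun c h => auxPayoff_le hA hK hUK h)
  have := hA.lintegral_g t x ht hx
  finiteness

theorem IsAuxAdmissible.auxPayoff_le_auxValue {t x a : ℝ} {c : ℝ → ℝ}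
    (h : M.IsAuxAdmissible t x a c) : M.auxPayoff P t x a c ≤ M.auxValue P t x a :=
  le_iSup₂_of_le c h le_rfl

theorem UtilityAssumption.continuousOn (hU : M.UtilityAssumption k b) :
    ContinuousOn M.U (Ici 0) := by
  obtain ⟨γ, hγ, ⟨K, hK, hUK⟩, -⟩ := hU.growth
  intro x hx
  rcases (show (0 : ℝ) ≤ x from hx).eq_or_lt with rfl | hx0
  · have hlim : Tendsto (fun x : ℝ => K * x ^ γ) (𝓝[≥] 0) (𝓝 0) := by
      have : ContinuousAt (fun x : ℝ => K * x ^ γ) 0 :=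
        continuousAt_const.mul (Real.continuousAt_rpow_const _ _ (Or.inr hγ.1.le))
      have h := this.tendsto.mono_left (nhdsWithin_le_nhds (s := Ici 0))
      simpa [Real.zero_rpow hγ.1.ne'] using h
    unfold ContinuousWithinAt
    rw [hU.zero]
    refine tendsto_of_tendsto_of_tendsto_of_le_of_le' tendsto_const_nhds hlim ?_ ?_
    · filter_upwards [self_mem_nhdsWithin] with y hy using hU.nonneg hy
    · filter_upwards [self_mem_nhdsWithin] with y hy using hUK y hy
  · exact (hU.contDiff.continuousOn.continuousAt (Ioi_mem_nhds hx0)).continuousWithinAt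

end IlliquidMarket

/-- Increments of a concave function decrease when the interval moves to the right. -/
theorem ConcaveOn.increment_mul_le {S : Set ℝ} {f : ℝ → ℝ} (hf : ConcaveOn ℝ S f) {p q r s : ℝ}
    (hp : p ∈ S) (hq : q ∈ S) (hr : r ∈ S) (hs : s ∈ S) (hpq : p < q) (hrs : r < s)
    (hpr : p ≤ r) (hqs : q ≤ s) : (f s - f r) * (q - p) ≤ (f q - f p) * (s - r) := by
  have hps : p < s := hpr.trans_lt hrs
  have h1 : slope f p s ≤ slope f p q :=
    hf.slope_anti hp ⟨hq, hpq.ne'⟩ ⟨hs, hps.ne'⟩ hqs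
  have h2 : slope f s r ≤ slope f s p :=
    hf.slope_anti hs ⟨hp, hps.ne⟩ ⟨hr, hrs.ne⟩ hpr
  rw [slope_comm f s r, slope_comm f s p] at h2
  have h3 := h2.trans h1
  rw [slope_def_field, slope_def_field, div_le_div_iff₀ (by linarith) (by linarith)] at h3
  exact h3

namespace IlliquidMarket

variable {Ω : Type*} [MeasurableSpace Ω] {M : IlliquidMarket Ω} {P : Measure Ω} {k b : ℝ}

/-! ### Existence and uniqueness of the optimal consumption rate -/

theorem utilityGap_pos (hU : M.UtilityAssumption k b) {y₁ y₂ : ℝ} (hy₁ : 0 ≤ y₁) (hy₂ : 0 ≤ y₂)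
    (h : y₁ ≠ y₂) : 0 < M.utilityGap (1 / 2) (1 / 2) y₁ y₂ :=
  sub_pos.2 (hU.strictConcave.2 hy₁ hy₂ h (by norm_num) (by norm_num) (by norm_num))

theorem utilityGap_comm (y₁ y₂ : ℝ) :
    M.utilityGap (1 / 2) (1 / 2) y₁ y₂ = M.utilityGap (1 / 2) (1 / 2) y₂ y₁ := by
  unfold utilityGap
  rw [add_comm, add_comm (1 / 2 * M.U y₁)]

/-- Raising the larger rate by `d` raises the midpoint by `d / 2`, further to the left, where `U` is
steeper. The midpoint therefore gains at least half of what `U` gains at the right end. -/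
theorem utilityGap_anti (hU : M.UtilityAssumption k b) {y y₁ y₂ : ℝ} (hy : 0 ≤ y) (h : y < y₁)
    (h' : y₁ ≤ y₂) :
    M.utilityGap (1 / 2) (1 / 2) y₁ y ≤ M.utilityGap (1 / 2) (1 / 2) y₂ y := by
  rcases h'.eq_or_lt with rfl | h'
  · exact le_rfl
  have hmem : ∀ z, y ≤ z → z ∈ Ici (0 : ℝ) := fun z hz => hy.trans hz
  have := hU.strictConcave.concaveOn.increment_mul_le (p := 1 / 2 * y₁ + 1 / 2 * y)
    (q := 1 / 2 * y₂ + 1 / 2 * y) (r := y₁) (s := y₂) (hmem _ (by linarith))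
    (hmem _ (by linarith)) (hmem _ (by linarith)) (hmem _ (by linarith)) (by linarith) h'
    (by linarith) (by linarith)
  unfold utilityGap
  have h2 : 0 < y₂ - y₁ := by linarith
  have h3 : (M.U y₂ - M.U y₁) * (1 / 2) ≤
      M.U (1 / 2 * y₂ + 1 / 2 * y) - M.U (1 / 2 * y₁ + 1 / 2 * y) := by
    refine le_of_mul_le_mul_right ?_ h2
    calc _ = (M.U y₂ - M.U y₁) * (1 / 2 * y₂ + 1 / 2 * y - (1 / 2 * y₁ + 1 / 2 * y)) := by ring
      _ ≤ _ := this
  linarith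

/-- The strict concavity of the utility controls the distance of consumption rates, measured by
the bounded distance `|y₁ / (1 + y₁) - y₂ / (1 + y₂)|`. -/
theorem exists_dist_le_utilityGap (hU : M.UtilityAssumption k b) {ε : ℝ} (hε : 0 < ε) :
    ∃ C, 0 ≤ C ∧ ∀ y₁ y₂, 0 ≤ y₁ → 0 ≤ y₂ → |y₁ / (1 + y₁) - y₂ / (1 + y₂)| ≤
      ε + C * M.utilityGap (1 / 2) (1 / 2) y₁ y₂ := by
  have hcont : ContinuousOn (fun y => M.utilityGap (1 / 2) (1 / 2) (y + ε) y)
      (Icc 0 (1 / ε)) := by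
    unfold utilityGap
    have h1 : ∀ f : ℝ → ℝ, Continuous f → (∀ y ∈ Icc 0 (1 / ε), 0 ≤ f y) →
        ContinuousOn (fun y => M.U (f y)) (Icc 0 (1 / ε)) := fun f hf hpos =>
      hU.continuousOn.comp hf.continuousOn hpos
    refine (h1 _ (by fun_prop) ?_).sub (((h1 _ (by fun_prop) ?_).const_mul _).add
      ((h1 _ (by fun_prop) ?_).const_mul _)) <;> intro y hy <;> linarith [hy.1]
  -- The least gap `m` between rates `y` and `y + ε` with `y ≤ 1 / ε` is positive by compactness and
  -- strict concavity; the constant will be `1 / m`.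
  obtain ⟨y₀, hy₀, hmin⟩ := isCompact_Icc.exists_isMinOn
    ⟨0, le_rfl, by positivity⟩ hcont
  have hm : 0 < M.utilityGap (1 / 2) (1 / 2) (y₀ + ε) y₀ :=
    utilityGap_pos hU (by linarith [hy₀.1]) hy₀.1 (by linarith)
  set m := M.utilityGap (1 / 2) (1 / 2) (y₀ + ε) y₀ with hmdef
  have key : ∀ y₁ y₂, 0 ≤ y₂ → y₂ ≤ y₁ → |y₁ / (1 + y₁) - y₂ / (1 + y₂)| ≤
      ε + m⁻¹ * M.utilityGap (1 / 2) (1 / 2) y₁ y₂ := by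
    intro y₁ y₂ hy₂ hle
    have hy₁ : 0 ≤ y₁ := hy₂.trans hle
    have hgap : 0 ≤ M.utilityGap (1 / 2) (1 / 2) y₁ y₂ :=
      utilityGap_nonneg hU (by norm_num) (by norm_num) (by norm_num) hy₁ hy₂
    have e : y₁ / (1 + y₁) - y₂ / (1 + y₂) = (y₁ - y₂) / ((1 + y₁) * (1 + y₂)) := by
      field_simp
      ring
    have e0 : 0 ≤ (y₁ - y₂) / ((1 + y₁) * (1 + y₂)) := div_nonneg (by linarith) (by positivity)
    rw [e, abs_of_nonneg e0]
    rcases le_or_gt ((y₁ - y₂) / ((1 + y₁) * (1 + y₂))) ε with h | h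
    · have : 0 ≤ m⁻¹ * M.utilityGap (1 / 2) (1 / 2) y₁ y₂ := by positivity
      linarith
    -- A distance above `ε` forces `y₂ ≤ 1 / ε` and `y₁ ≥ y₂ + ε`, hence a gap of at least `m`.
    -- Since the distance never exceeds `1`, the term with the factor `1 / m` alone dominates it.
    · rw [lt_div_iff₀ (by positivity)] at h
      have h1 : ε * (1 + y₂) < 1 := by
        by_contra! hcon
        nlinarith
      have h2 : y₂ + ε ≤ y₁ := by nlinarith [mul_nonneg hy₁ hy₂]
      have h3 : y₂ ≤ 1 / ε := by
        rw [le_div_iff₀ hε]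
        nlinarith
      have h4 : m ≤ M.utilityGap (1 / 2) (1 / 2) y₁ y₂ :=
        (hmin ⟨hy₂, h3⟩).trans (utilityGap_anti hU hy₂ (by linarith) h2)
      have h5 : 1 ≤ m⁻¹ * M.utilityGap (1 / 2) (1 / 2) y₁ y₂ := by
        rw [inv_mul_eq_div, one_le_div hm]
        exact h4
      have h6 : (y₁ - y₂) / ((1 + y₁) * (1 + y₂)) ≤ 1 := by
        rw [div_le_one (by positivity)]
        nlinarith [mul_nonneg hy₁ hy₂]
      linarith
  refine ⟨m⁻¹, by positivity, fun y₁ y₂ hy₁ hy₂ => ?_⟩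
  rcases le_total y₂ y₁ with h | h
  · exact key y₁ y₂ hy₂ h
  · rw [abs_sub_comm, utilityGap_comm]
    exact key y₂ y₁ hy₁ h

/-- The midpoint rate is admissible, so its payoff is at most the value; by concavity it is also at
least the value minus `δ` plus the integrated gap. The value is finite and cancels. -/
theorem lintegral_utilityGap_le (hU : M.UtilityAssumption k b) {t x a : ℝ}
    (hA : M.AuxRegular P a) (ht : 0 ≤ t) (hx : M.l a ≤ x) {c₁ c₂ : ℝ → ℝ} {δ : ℝ≥0∞}
    (h₁ : M.IsAuxAdmissible t x a c₁) (h₂ : M.IsAuxAdmissible t x a c₂)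
    (e₁ : M.auxValue P t x a ≤ M.auxPayoff P t x a c₁ + δ)
    (e₂ : M.auxValue P t x a ≤ M.auxPayoff P t x a c₂ + δ) :
    ∫⁻ s in Ioi t, M.discount t s *
      ENNReal.ofReal (M.utilityGap (1 / 2) (1 / 2) (c₁ s) (c₂ s)) ≤ δ := by
  have hθ : (1 / 2 : ℝ) + 1 / 2 = 1 := by norm_num
  have h0 : (0 : ℝ) ≤ 1 / 2 := by norm_num
  have hconc := auxPayoff_concave hU hA ht h₁ h₂ h0 h0 hθ
  have hadm := h₁.convexComb h₂ h0 h0 hθ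
  have hval := hconc.trans hadm.auxPayoff_le_auxValue
  rw [← add_mul, hθ, one_mul] at hval
  set D := ∫⁻ s in Ioi t, M.discount t s *
      ENNReal.ofReal (M.utilityGap (1 / 2) (1 / 2) (c₁ s) (c₂ s))
  have hfin := auxValue_ne_top hU hA ht hx
  have hhalf : ∀ z : ℝ≥0∞, ENNReal.ofReal (1 / 2) * z + ENNReal.ofReal (1 / 2) * z = z := by
    intro z
    rw [← add_mul, ← ENNReal.ofReal_add h0 h0, hθ, ENNReal.ofReal_one, one_mul]
  rw [← ENNReal.add_le_add_iff_left hfin]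
  calc M.auxValue P t x a + D
      = ENNReal.ofReal (1 / 2) * M.auxValue P t x a +
        ENNReal.ofReal (1 / 2) * M.auxValue P t x a + D := by rw [hhalf]
    _ ≤ ENNReal.ofReal (1 / 2) * (M.auxPayoff P t x a c₁ + δ) +
        ENNReal.ofReal (1 / 2) * (M.auxPayoff P t x a c₂ + δ) + D := by gcongr
    _ = (ENNReal.ofReal (1 / 2) * M.auxPayoff P t x a c₁ +
        ENNReal.ofReal (1 / 2) * M.auxPayoff P t x a c₂ + D) +
        (ENNReal.ofReal (1 / 2) * δ + ENNReal.ofReal (1 / 2) * δ) := by ring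
    _ ≤ M.auxValue P t x a + δ := by
        rw [hhalf]
        gcongr

/-- Optimal consumption rates agree almost everywhere. -/
theorem IsAuxOptimal.ae_eq (hU : M.UtilityAssumption k b) {t x a : ℝ}
    (hA : M.AuxRegular P a) (ht : 0 ≤ t) (hx : M.l a ≤ x) {c₁ c₂ : ℝ → ℝ}
    (h₁ : M.IsAuxOptimal P t x a c₁) (h₂ : M.IsAuxOptimal P t x a c₂) :
    ∀ᵐ s ∂(volume.restrict (Ici t)), c₁ s = c₂ s := by
  have hD := lintegral_utilityGap_le hU hA ht hx h₁.1 h₂.1 (δ := 0) (by simp [h₁.2])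
    (by simp [h₂.2])
  obtain ⟨C, hC, hdist⟩ : ∃ C : ℕ → ℝ, (∀ n, 0 ≤ C n) ∧ ∀ (n : ℕ) y₁ y₂, 0 ≤ y₁ → 0 ≤ y₂ →
      |y₁ / (1 + y₁) - y₂ / (1 + y₂)| ≤
        1 / ((n : ℝ) + 1) + C n * M.utilityGap (1 / 2) (1 / 2) y₁ y₂ := by
    have := fun n : ℕ => exists_dist_le_utilityGap hU (Nat.one_div_pos_of_nat (n := n) (α := ℝ))
    choose C hC using this
    exact ⟨C, fun n => (hC n).1, fun n => (hC n).2⟩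
  have hmU : ∀ c : ℝ → ℝ, Measurable c → Measurable fun s => M.U (max (c s) 0) := fun c hc =>
    (measurable_posPart_utility hU).comp hc
  have hzero : ∀ᵐ s ∂(volume.restrict (Ioi t)),
      M.utilityGap (1 / 2) (1 / 2) (c₁ s) (c₂ s) ≤ 0 := by
    have hm : AEMeasurable (fun s => M.discount t s *
        ENNReal.ofReal (M.utilityGap (1 / 2) (1 / 2) (c₁ s) (c₂ s)))
        (volume.restrict (Ioi t)) := by
      have h3 : Measurable fun s => M.discount t s * ENNReal.ofReal
          (M.U (max (1 / 2 * c₁ s + 1 / 2 * c₂ s) 0) -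
            (1 / 2 * M.U (max (c₁ s) 0) + 1 / 2 * M.U (max (c₂ s) 0))) := by
        refine (measurable_discount t).mul (Measurable.ennreal_ofReal ?_)
        exact (hmU _ ((h₁.1.measurable.const_mul _).add (h₂.1.measurable.const_mul _))).sub
          (((hmU _ h₁.1.measurable).const_mul _).add ((hmU _ h₂.1.measurable).const_mul _))
      refine h3.aemeasurable.congr ?_
      filter_upwards [ae_restrict_mem measurableSet_Ioi] with s hs
      have n1 := h₁.1.nonneg s (le_of_lt hs)
      have n2 := h₂.1.nonneg s (le_of_lt hs)
      rw [max_eq_left n1, max_eq_left n2, max_eq_left (by positivity)]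
      rfl
    have := (lintegral_eq_zero_iff' hm).1 (le_antisymm hD zero_le)
    filter_upwards [this] with s hs
    rcases mul_eq_zero.1 hs with h | h
    · simp [discount] at h
      exact absurd h (not_le.2 (Real.exp_pos _))
    · exact ENNReal.ofReal_eq_zero.1 h
  rw [restrict_Ioi_eq_restrict_Ici.symm]
  filter_upwards [hzero, ae_restrict_mem measurableSet_Ioi] with s hs hst
  by_contra hne
  exact absurd (utilityGap_pos hU (h₁.1.nonneg s (le_of_lt hst)) (h₂.1.nonneg s (le_of_lt hst))
    hne) (not_lt.2 hs)

/-- Nearly optimal consumption rates are close. -/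
theorem exists_lintegral_dist_le (hU : M.UtilityAssumption k b) {t x a : ℝ}
    (hA : M.AuxRegular P a) (ht : 0 ≤ t) (hx : M.l a ≤ x) {ε : ℝ} (hε : 0 < ε) :
    ∃ δ : ℝ, 0 < δ ∧ ∀ c₁ c₂, M.IsAuxAdmissible t x a c₁ → M.IsAuxAdmissible t x a c₂ →
      M.auxValue P t x a ≤ M.auxPayoff P t x a c₁ + ENNReal.ofReal δ →
      M.auxValue P t x a ≤ M.auxPayoff P t x a c₂ + ENNReal.ofReal δ →
      ∫⁻ s in Ioi t, M.discount t s *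
        ENNReal.ofReal |c₁ s / (1 + c₁ s) - c₂ s / (1 + c₂ s)| ≤ ENNReal.ofReal ε := by
  have hβ := hA.rate_pos
  -- The discount has total mass `1 / (ρ + λ)`, so this level contributes `ε / 2`. The choice of `δ`
  -- below makes `C δ ≤ ε / 2` as well, with `C + 1` guarding against `C = 0`.
  obtain ⟨C, hC, hdist⟩ := exists_dist_le_utilityGap hU
    (show 0 < ε * (M.rho + M.lam) / 2 by positivity)
  refine ⟨ε / (2 * (C + 1)), by positivity, fun c₁ c₂ h₁ h₂ e₁ e₂ => ?_⟩
  have hD := lintegral_utilityGap_le hU hA ht hx h₁ h₂ e₁ e₂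
  have hmd := measurable_discount (M := M) t
  calc ∫⁻ s in Ioi t, M.discount t s *
        ENNReal.ofReal |c₁ s / (1 + c₁ s) - c₂ s / (1 + c₂ s)|
      ≤ ∫⁻ s in Ioi t, (ENNReal.ofReal (ε * (M.rho + M.lam) / 2) * M.discount t s +
          ENNReal.ofReal C * (M.discount t s *
            ENNReal.ofReal (M.utilityGap (1 / 2) (1 / 2) (c₁ s) (c₂ s)))) := by
        refine setLIntegral_mono' measurableSet_Ioi fun s hs => ?_
        have n1 := h₁.nonneg s (le_of_lt hs)
        have n2 := h₂.nonneg s (le_of_lt hs)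
        have hgap : 0 ≤ M.utilityGap (1 / 2) (1 / 2) (c₁ s) (c₂ s) :=
          utilityGap_nonneg hU (by norm_num) (by norm_num) (by norm_num) n1 n2
        have h := ENNReal.ofReal_le_ofReal (hdist _ _ n1 n2)
        rw [ENNReal.ofReal_add (by positivity) (by positivity), ENNReal.ofReal_mul hC] at h
        refine (mul_le_mul_right h _).trans (le_of_eq ?_)
        ring
    _ = ENNReal.ofReal (ε * (M.rho + M.lam) / 2) * ENNReal.ofReal (1 / (M.rho + M.lam)) +
          ENNReal.ofReal C * ∫⁻ s in Ioi t, M.discount t s *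
            ENNReal.ofReal (M.utilityGap (1 / 2) (1 / 2) (c₁ s) (c₂ s)) := by
        rw [lintegral_add_left (hmd.const_mul _), lintegral_const_mul' _ _ ENNReal.ofReal_ne_top,
          lintegral_const_mul' _ _ ENNReal.ofReal_ne_top, lintegral_discount hβ]
    _ ≤ ENNReal.ofReal (ε * (M.rho + M.lam) / 2) * ENNReal.ofReal (1 / (M.rho + M.lam)) +
          ENNReal.ofReal C * ENNReal.ofReal (ε / (2 * (C + 1))) := by gcongr
    _ ≤ _ := by
        rw [← ENNReal.ofReal_mul (by positivity), ← ENNReal.ofReal_mul hC,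
          ← ENNReal.ofReal_add (by positivity) (by positivity)]
        refine ENNReal.ofReal_le_ofReal ?_
        have h1 : ε * (M.rho + M.lam) / 2 * (1 / (M.rho + M.lam)) = ε / 2 := by field_simp
        have h2 : C * (ε / (2 * (C + 1))) ≤ ε / 2 := by
          rw [mul_div_assoc', div_le_div_iff₀ (by positivity) (by norm_num)]
          nlinarith
        linarith

theorem exists_auxValue_le_add (hU : M.UtilityAssumption k b) {t x a : ℝ}
    (hA : M.AuxRegular P a) (ht : 0 ≤ t) (hx : M.l a ≤ x) {δ : ℝ} (hδ : 0 < δ) :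
    ∃ c, M.IsAuxAdmissible t x a c ∧
      M.auxValue P t x a ≤ M.auxPayoff P t x a c + ENNReal.ofReal δ := by
  by_contra! hcon
  have hδ' : 0 < ENNReal.ofReal δ := ENNReal.ofReal_pos.2 hδ
  have hfin := auxValue_ne_top hU hA ht hx
  have h0 := hcon 0 (isAuxAdmissible_zero hx)
  have hle : M.auxValue P t x a ≤ M.auxValue P t x a - ENNReal.ofReal δ :=
    iSup₂_le fun c hc => ENNReal.le_sub_of_add_le_right ENNReal.ofReal_ne_top (hcon c hc).le
  exact absurd hle (not_le.2 (ENNReal.sub_lt_self hfin (ne_bot_of_gt h0) hδ'.ne'))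

end IlliquidMarket

/-! ### Compactness of maximizing sequences and existence -/

namespace IlliquidMarket

variable {Ω : Type*} [MeasurableSpace Ω] {M : IlliquidMarket Ω} {P : Measure Ω} {k b : ℝ}

/-- There is a maximizing sequence of consumption rates that converges almost everywhere. -/
theorem exists_tendsto_maximizing (hU : M.UtilityAssumption k b) {t x a : ℝ}
    (hA : M.AuxRegular P a) (ht : 0 ≤ t) (hx : M.l a ≤ x) :
    ∃ c : ℕ → ℝ → ℝ, (∀ n, M.IsAuxAdmissible t x a (c n)) ∧
      (∀ n : ℕ, M.auxValue P t x a ≤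
        M.auxPayoff P t x a (c n) + ENNReal.ofReal (1 / ((n : ℝ) + 1))) ∧
      ∀ᵐ s ∂(volume.restrict (Ioi t)), ∃ y, Tendsto (fun n => c n s) atTop (𝓝 y) := by
  have h1 : ∀ n : ℕ, (0 : ℝ) < (1 / 2) ^ n / 2 := fun n => by positivity
  choose δ hδ hclose using fun n => exists_lintegral_dist_le hU hA ht hx (h1 n)
  -- The minimum over the first `n + 1` thresholds makes the `n`-th rate good enough for every level
  -- `N ≤ n` at once. The levels are summable, so convergence holds almost everywhere without
  -- extracting a subsequence.
  let e : ℕ → ℝ := fun n =>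
    min ((Finset.range (n + 1)).inf' Finset.nonempty_range_add_one δ) (1 / ((n : ℝ) + 1))
  have he : ∀ n, 0 < e n := by
    intro n
    refine lt_min ?_ (by positivity)
    rw [Finset.lt_inf'_iff]
    exact fun i _ => hδ i
  have heδ : ∀ N n, N ≤ n → e n ≤ δ N := fun N n h =>
    (min_le_left _ _).trans (Finset.inf'_le _ (by simp; omega))
  choose c hc hval using fun n => exists_auxValue_le_add hU hA ht hx (he n)
  refine ⟨c, hc, fun n => (hval n).trans ?_, ?_⟩
  · gcongr
    exact min_le_right _ _
  let f : ℕ → ℝ → ℝ := fun n s =>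
    Real.exp (-(M.rho + M.lam) * (s - t)) * (c n s / (1 + c n s))
  have hf : ∀ n, Measurable (f n) := by
    intro n
    have := (hc n).measurable
    fun_prop
  have hB : ∑' n : ℕ, ENNReal.ofReal ((1 / 2 : ℝ) ^ n) ≠ ⊤ :=
    Summable.tsum_ofReal_ne_top (summable_geometric_of_lt_one (by norm_num) (by norm_num))
  have hcau : ∀ N n m : ℕ, N ≤ n → N ≤ m →
      eLpNorm (f n - f m) 1 (volume.restrict (Ioi t)) < ENNReal.ofReal ((1 / 2 : ℝ) ^ N) := by
    intro N n m hn hm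
    rw [eLpNorm_one_eq_lintegral_enorm]
    have hle := hclose N (c n) (c m) (hc n) (hc m)
      ((hval n).trans (by gcongr; exact heδ N n hn)) ((hval m).trans (by gcongr; exact heδ N m hm))
    refine lt_of_le_of_lt (le_trans (le_of_eq (lintegral_congr fun s => ?_)) hle) ?_
    · simp only [f, Pi.sub_apply]
      rw [← mul_sub, Real.enorm_eq_ofReal_abs, abs_mul, abs_of_pos (Real.exp_pos _),
        ENNReal.ofReal_mul (Real.exp_pos _).le]
    · rw [ENNReal.ofReal_lt_ofReal_iff (by positivity)]
      exact half_lt_self (by positivity)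
  have hlim := Lp.ae_tendsto_of_cauchy_eLpNorm (fun n => (hf n).aestronglyMeasurable) le_rfl hB hcau
  -- Convergence of `c_n / (1 + c_n)` still allows `c_n → ∞`. The budget and Fatou's lemma exclude
  -- this almost everywhere.
  have hfatou : ∫⁻ s in Ioi t, liminf (fun n => ENNReal.ofReal (c n s)) atTop ≠ ⊤ := by
    refine ne_top_of_le_ne_top (ENNReal.ofReal_ne_top (r := x - M.l a)) ?_
    refine (lintegral_liminf_le fun n => (hc n).measurable.ennreal_ofReal).trans ?_
    exact liminf_le_of_le (by isBoundedDefault) fun B hB => by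
      obtain ⟨n, hn⟩ := hB.exists
      exact hn.trans (hc n).lintegral_le
  have hfin := ae_lt_top (Measurable.liminf fun n => (hc n).measurable.ennreal_ofReal) hfatou
  filter_upwards [hlim, hfin, ae_restrict_mem measurableSet_Ioi] with s ⟨L, hL⟩ hs hst
  have hcn : ∀ n, 0 ≤ c n s := fun n => (hc n).nonneg s (le_of_lt hst)
  set w := Real.exp (-(M.rho + M.lam) * (s - t)) with hw
  have hw0 : 0 < w := Real.exp_pos _
  have hθ : Tendsto (fun n => 1 - c n s / (1 + c n s)) atTop (𝓝 (1 - L / w)) := by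
    refine tendsto_const_nhds.sub ?_
    have h2 := hL.div_const w
    refine h2.congr fun n => ?_
    simp only [f]
    rw [← hw, mul_div_cancel_left₀ _ hw0.ne']
  have hinv : ∀ n, c n s = (1 - c n s / (1 + c n s))⁻¹ - 1 := by
    intro n
    have := hcn n
    have h3 : 1 - c n s / (1 + c n s) = (1 + c n s)⁻¹ := by
      field_simp
      ring
    rw [h3, inv_inv]
    ring
  rcases eq_or_ne (1 - L / w) 0 with h0 | h0
  · exfalso
    rw [h0] at hθ
    have hpos : Tendsto (fun n => 1 - c n s / (1 + c n s)) atTop (𝓝[>] 0) := by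
      refine tendsto_nhdsWithin_iff.2 ⟨hθ, Eventually.of_forall fun n => ?_⟩
      have := hcn n
      have h3 : 1 - c n s / (1 + c n s) = (1 + c n s)⁻¹ := by
        field_simp
        ring
      rw [h3, mem_Ioi]
      positivity
    have htop : Tendsto (fun n => c n s) atTop atTop := by
      have h4 := tendsto_atTop_add_const_right atTop (-1) (tendsto_inv_nhdsGT_zero.comp hpos)
      refine h4.congr fun n => ?_
      conv_rhs => rw [hinv n]
      rfl
    have h5 := (ENNReal.tendsto_ofReal_atTop.comp htop).liminf_eq
    simp only [Function.comp_def] at h5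
    rw [h5] at hs
    exact lt_irrefl _ hs
  · exact ⟨(1 - L / w)⁻¹ - 1, ((hθ.inv₀ h0).sub_const 1).congr fun n => (hinv n).symm⟩

/-- The running reward is upper semicontinuous along converging consumption rates. -/
theorem limsup_reward_le (hU : M.UtilityAssumption k b) {a : ℝ} (hA : M.AuxRegular P a)
    {s y r R : ℝ} (hs : 0 < s) (hy : M.l a ≤ y) (hr : 0 ≤ r) (hR : 0 < R) {rn yn : ℕ → ℝ}
    (hlim : Tendsto rn atTop (𝓝 r)) (hyn : ∀ z, y < z → ∀ᶠ n in atTop, yn n ≤ z) (D : ℝ≥0∞)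
    (hD : D ≠ ⊤) :
    limsup (fun n => D * (ENNReal.ofReal (M.U (min (max (rn n) 0) R)) + M.g P s (yn n) a)) atTop ≤
      D * (ENNReal.ofReal (M.U r) + M.g P s y a) := by
  have hUlim : Tendsto (fun n => ENNReal.ofReal (M.U (min (max (rn n) 0) R))) atTop
      (𝓝 (ENNReal.ofReal (M.U (min r R)))) := by
    refine (ENNReal.continuous_ofReal.tendsto _).comp ?_
    have h1 : (0 : ℝ) ≤ min r R := le_min hr hR.le
    refine (hU.continuousOn _ h1).tendsto.comp (tendsto_nhdsWithin_iff.2 ⟨?_, ?_⟩)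
    · have h2 := (hlim.max (tendsto_const_nhds (x := (0 : ℝ)))).min (tendsto_const_nhds (x := R))
      rwa [max_eq_left hr] at h2
    · exact Eventually.of_forall fun n => le_min (le_max_right _ _) hR.le
  -- The wealths are only known to fall eventually below any level above `y`. Monotonicity of `g`
  -- bounds the limit superior by its value at `y + 1 / (m + 1)`, and right continuity then lets `m
  -- → ∞`.
  have hstep : ∀ m : ℕ, limsup (fun n => D * (ENNReal.ofReal (M.U (min (max (rn n) 0) R)) +
      M.g P s (yn n) a)) atTop ≤
      D * (ENNReal.ofReal (M.U (min r R)) + M.g P s (y + 1 / (m + 1)) a) := by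
    intro m
    have hm : (0 : ℝ) < 1 / (m + 1) := by positivity
    have h3 : Tendsto (fun n => D * (ENNReal.ofReal (M.U (min (max (rn n) 0) R)) +
        M.g P s (y + 1 / (m + 1)) a)) atTop
        (𝓝 (D * (ENNReal.ofReal (M.U (min r R)) + M.g P s (y + 1 / (m + 1)) a))) :=
      ENNReal.Tendsto.const_mul (hUlim.add tendsto_const_nhds) (Or.inr hD)
    rw [← h3.limsup_eq]
    refine limsup_le_limsup ?_
    filter_upwards [hyn (y + 1 / (m + 1)) (by linarith)] with n hn
    gcongr
    exact hA.mono_g s hn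
  have hlast : Tendsto (fun m : ℕ => D * (ENNReal.ofReal (M.U (min r R)) +
      M.g P s (y + 1 / (m + 1)) a)) atTop
      (𝓝 (D * (ENNReal.ofReal (M.U (min r R)) + M.g P s y a))) :=
    ENNReal.Tendsto.const_mul (tendsto_const_nhds.add (hA.tendsto_g s hs y hy)) (Or.inr hD)
  refine (ge_of_tendsto' hlast hstep).trans ?_
  gcongr
  exact hU.strictMono.monotoneOn (le_min hr hR.le) hr (min_le_left _ _)

/-- The auxiliary problem has an optimal consumption rate. -/
theorem exists_isAuxOptimal (hU : M.UtilityAssumption k b) {t x a : ℝ}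
    (hA : M.AuxRegular P a) (ht : 0 ≤ t) (hx : M.l a ≤ x) :
    ∃ c, M.IsAuxOptimal P t x a c := by
  obtain ⟨cn, hc, hval, hconv⟩ := exists_tendsto_maximizing hU hA ht hx
  have hβ := hA.rate_pos
  -- Taking the lower limit in `[0,∞]` defines a nonnegative measurable rate everywhere; it is the
  -- true limit almost everywhere.
  let c : ℝ → ℝ := fun s => (liminf (fun n => ENNReal.ofReal (cn n s)) atTop).toReal
  have hcm : Measurable c :=
    (Measurable.liminf fun n => (hc n).measurable.ennreal_ofReal).ennreal_toReal
  have hlim : ∀ᵐ s ∂(volume.restrict (Ioi t)),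
      Tendsto (fun n => cn n s) atTop (𝓝 (c s)) ∧
        ENNReal.ofReal (c s) = liminf (fun n => ENNReal.ofReal (cn n s)) atTop := by
    filter_upwards [hconv, ae_restrict_mem measurableSet_Ioi] with s ⟨y, hy⟩ hst
    have hy0 : 0 ≤ y := ge_of_tendsto' hy fun n => (hc n).nonneg s (le_of_lt hst)
    have h1 := ((ENNReal.continuous_ofReal.tendsto _).comp hy).liminf_eq
    simp only [Function.comp_def] at h1
    have h2 : c s = y := by
      simp only [c]
      rw [h1, ENNReal.toReal_ofReal hy0]
    rw [h2, h1]
    exact ⟨hy, rfl⟩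
  have hfatou : ∀ S ⊆ Ioi t, MeasurableSet S → ∫⁻ s in S, ENNReal.ofReal (c s) ≤
      liminf (fun n => ∫⁻ s in S, ENNReal.ofReal (cn n s)) atTop := by
    intro S hS _
    rw [lintegral_congr_ae (g := fun s => liminf (fun n => ENNReal.ofReal (cn n s)) atTop)]
    · exact lintegral_liminf_le fun n => (hc n).measurable.ennreal_ofReal
    · filter_upwards [ae_restrict_of_ae_restrict_of_subset hS hlim] with s hs using hs.2
  have hcadm : M.IsAuxAdmissible t x a c := by
    refine isAuxAdmissible_of_lintegral_le hx hcm (fun s _ => ENNReal.toReal_nonneg) ?_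
    refine (hfatou _ Subset.rfl measurableSet_Ioi).trans ?_
    exact liminf_le_of_le (by isBoundedDefault) fun B hB => by
      obtain ⟨n, hn⟩ := hB.exists
      exact hn.trans (hc n).lintegral_le
  -- Fatou's lemma may lose consumption in the limit, so the limiting wealth can only be too large.
  -- Since `g` is nondecreasing in wealth, this one-sided control is enough.
  have hwealth : ∀ s, t ≤ s → ∀ z, auxWealth t x c s < z →
      ∀ᶠ n in atTop, auxWealth t x (cn n) s ≤ z := by
    intro s hs z hz
    rcases le_total x z with hxz | hxz
    · exact Eventually.of_forall fun n => (hc n).le_start.trans hxz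
    · have h1 := hfatou (Ioc t s) Ioc_subset_Ioi_self measurableSet_Ioc
      rw [hcadm.lintegral_Ioc hs] at h1
      have h2 : ENNReal.ofReal (x - z) <
          liminf (fun n => ∫⁻ s in Ioc t s, ENNReal.ofReal (cn n s)) atTop := by
        refine lt_of_lt_of_le ?_ h1
        unfold auxWealth at hz
        rw [ENNReal.ofReal_lt_ofReal_iff (by linarith)]
        linarith
      filter_upwards [eventually_lt_of_lt_liminf h2] with n hn
      rw [(hc n).lintegral_Ioc hs, ENNReal.ofReal_lt_ofReal_iff_of_nonneg (by linarith)] at hn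
      unfold auxWealth
      linarith
  refine ⟨c, hcadm, le_antisymm hcadm.auxPayoff_le_auxValue ?_⟩
  -- The utilities of the rates need not be uniformly integrable. Cutting them off at `R` costs at
  -- most `ε` times total consumption, and the truncated rewards have an integrable majorant, as the
  -- reverse Fatou lemma requires.
  have hmain : ∀ ε : ℝ, 0 < ε → M.auxValue P t x a ≤
      M.auxPayoff P t x a c + ENNReal.ofReal ε + ENNReal.ofReal ε * ENNReal.ofReal (x - M.l a) := by
    intro ε hε
    obtain ⟨R, hR, hUR⟩ := hU.exists_le_min_add hε
    let F : ℕ → ℝ → ℝ≥0∞ := fun n s => M.discount t s *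
      (ENNReal.ofReal (M.U (min (max (cn n s) 0) R)) + M.g P s (auxWealth t x (cn n) s) a)
    have hFm : ∀ n, Measurable (F n) := by
      intro n
      refine (measurable_discount t).mul (Measurable.add (Measurable.ennreal_ofReal ?_) ?_)
      · have h1 := (measurable_posPart_utility hU).comp
          (((hc n).measurable.max measurable_const).min measurable_const :
            Measurable fun s => min (max (cn n s) 0) R)
        have h2 : (fun s => M.U (min (max (cn n s) 0) R)) =
            (fun y => M.U (max y 0)) ∘ fun s => min (max (cn n s) 0) R := by
          ext s
          simp only [Function.comp_apply]
          rw [max_eq_left (le_min (le_max_right _ _) hR.le)]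
        rw [h2]
        exact h1
      · exact hA.measurable_g.comp
          (measurable_id.prodMk (measurable_auxWealth t x (hc n).measurable))
    have hpay : ∀ n, M.auxPayoff P t x a (cn n) ≤
        (∫⁻ s in Ioi t, F n s) + ENNReal.ofReal ε * ENNReal.ofReal (x - M.l a) := by
      intro n
      refine le_trans ?_ (add_le_add_right (mul_le_mul_right (hc n).lintegral_le _) _)
      rw [← lintegral_const_mul' _ _ ENNReal.ofReal_ne_top, ← lintegral_add_left (hFm n)]
      refine setLIntegral_mono' measurableSet_Ioi fun s hs => ?_
      have hs' : t ≤ s := le_of_lt hs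
      have n1 := (hc n).nonneg s hs'
      have h1 := hUR _ n1
      have h2 : ENNReal.ofReal (M.U (cn n s)) ≤
          ENNReal.ofReal (M.U (min (cn n s) R)) + ENNReal.ofReal ε * ENNReal.ofReal (cn n s) := by
        have hUpos := hU.nonneg (le_min n1 hR.le)
        rw [← ENNReal.ofReal_mul hε.le, ← ENNReal.ofReal_add hUpos (by positivity)]
        exact ENNReal.ofReal_le_ofReal h1
      have h3 := discount_le_one hβ hs'
      simp only [F]
      rw [max_eq_left n1]
      calc M.discount t s * (ENNReal.ofReal (M.U (cn n s)) +
            M.g P s (auxWealth t x (cn n) s) a)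
          ≤ M.discount t s * ((ENNReal.ofReal (M.U (min (cn n s) R)) +
            ENNReal.ofReal ε * ENNReal.ofReal (cn n s)) +
            M.g P s (auxWealth t x (cn n) s) a) := by gcongr
        _ = M.discount t s * (ENNReal.ofReal (M.U (min (cn n s) R)) +
            M.g P s (auxWealth t x (cn n) s) a) +
            M.discount t s * (ENNReal.ofReal ε * ENNReal.ofReal (cn n s)) := by ring
        _ ≤ _ := add_le_add_right (mul_le_of_le_one_left zero_le h3) _
    have hdom : ∀ n, F n ≤ᵐ[volume.restrict (Ioi t)] fun s =>
        M.discount t s * ENNReal.ofReal (M.U R) + M.discount t s * M.g P s x a := by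
      intro n
      filter_upwards [ae_restrict_mem measurableSet_Ioi] with s hs
      rw [← mul_add]
      simp only [F]
      gcongr
      · exact hU.strictMono.monotoneOn (le_min (le_max_right _ _) hR.le :
          (0 : ℝ) ≤ min (max (cn n s) 0) R) hR.le (min_le_right _ _)
      · exact hA.mono_g s (hc n).le_start
    have hdomfin : ∫⁻ s in Ioi t, (M.discount t s * ENNReal.ofReal (M.U R) +
        M.discount t s * M.g P s x a) ≠ ⊤ := by
      rw [lintegral_add_left ((measurable_discount t).mul_const _),
        lintegral_mul_const' _ _ ENNReal.ofReal_ne_top, lintegral_discount hβ]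
      have := hA.lintegral_g t x ht hx
      finiteness
    have hlimsup : limsup (fun n => ∫⁻ s in Ioi t, F n s) atTop ≤ M.auxPayoff P t x a c := by
      refine (limsup_lintegral_le _ hFm hdom hdomfin).trans (lintegral_mono_ae ?_)
      filter_upwards [hlim, ae_restrict_mem measurableSet_Ioi] with s hs hst
      have hst' : t ≤ s := le_of_lt hst
      exact limsup_reward_le hU hA (ht.trans_lt hst) (hcadm.le_wealth s hst')
        (hcadm.nonneg s hst') hR hs.1 (hwealth s hst') _ ENNReal.ofReal_ne_top
    have hfin : M.auxPayoff P t x a c ≠ ⊤ :=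
      ne_top_of_le_ne_top (auxValue_ne_top hU hA ht hx) hcadm.auxPayoff_le_auxValue
    have hlt : limsup (fun n => ∫⁻ s in Ioi t, F n s) atTop <
        M.auxPayoff P t x a c + ENNReal.ofReal ε :=
      hlimsup.trans_lt (ENNReal.lt_add_right hfin (ENNReal.ofReal_pos.2 hε).ne')
    have hev := eventually_lt_of_limsup_lt hlt
    have hfinal : Tendsto (fun n : ℕ => M.auxPayoff P t x a c + ENNReal.ofReal ε +
        ENNReal.ofReal ε * ENNReal.ofReal (x - M.l a) + ENNReal.ofReal (1 / ((n : ℝ) + 1))) atTop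
        (𝓝 (M.auxPayoff P t x a c + ENNReal.ofReal ε +
          ENNReal.ofReal ε * ENNReal.ofReal (x - M.l a) + ENNReal.ofReal 0)) :=
      tendsto_const_nhds.add ((ENNReal.continuous_ofReal.tendsto _).comp
        tendsto_one_div_add_atTop_nhds_zero_nat)
    rw [ENNReal.ofReal_zero, add_zero] at hfinal
    refine ge_of_tendsto hfinal ?_
    filter_upwards [hev] with n hn
    refine (hval n).trans (add_le_add_left ((hpay n).trans ?_) _)
    gcongr
  refine ENNReal.le_of_forall_pos_le_add fun ε hε _ => ?_
  have hxl : 0 ≤ x - M.l a := by linarith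
  -- The two errors together carry the factor `1 + (x - l(a))`, which this choice normalizes.
  have h1 := hmain (ε / (1 + (x - M.l a))) (by positivity)
  rw [add_assoc, ← ENNReal.ofReal_mul (by positivity),
    ← ENNReal.ofReal_add (by positivity) (by positivity)] at h1
  refine h1.trans (add_le_add_right (le_of_eq ?_) _)
  rw [← ENNReal.ofReal_coe_nnreal]
  congr 1
  field_simp

end IlliquidMarket

namespace IlliquidMarket

variable {Ω : Type*} [MeasurableSpace Ω] {M : IlliquidMarket Ω} {P : Measure Ω} {k b : ℝ}

/-! ### Dynamic programming -/

theorem auxWealth_trans {t s r x : ℝ} {c : ℝ → ℝ} (hts : t ≤ s) (hsr : s ≤ r)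
    (hc : IntegrableOn c (Ioc t r)) :
    auxWealth s (auxWealth t x c s) c r = auxWealth t x c r := by
  unfold auxWealth
  rw [← Ioc_union_Ioc_eq_Ioc hts hsr, setIntegral_union (Ioc_disjoint_Ioc_of_le le_rfl)
    measurableSet_Ioc (hc.mono_set (Ioc_subset_Ioc_right hsr))
    (hc.mono_set (Ioc_subset_Ioc_left hts))]
  ring

theorem IsAuxAdmissible.restrict {t s x a : ℝ} {c : ℝ → ℝ} (h : M.IsAuxAdmissible t x a c)
    (hs : t ≤ s) : M.IsAuxAdmissible s (auxWealth t x c s) a c where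
  measurable := h.measurable
  nonneg := fun r hr => h.nonneg r (hs.trans hr)
  integrable := fun r hr => (h.integrable r (hs.trans hr)).mono_set (Ioc_subset_Ioc_left hs)
  le_wealth := fun r hr => by
    rw [auxWealth_trans hs hr (h.integrable r (hs.trans hr))]
    exact h.le_wealth r (hs.trans hr)

/-- The payoff earned on `(t, s]`. -/
noncomputable def runningPayoff (M : IlliquidMarket Ω) (P : Measure Ω) (a t s x : ℝ) (c : ℝ → ℝ) :
    ℝ≥0∞ :=
  ∫⁻ r in Ioc t s, M.discount t r * (ENNReal.ofReal (M.U (c r)) + M.g P r (auxWealth t x c r) a)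

theorem IsAuxAdmissible.auxPayoff_split {t s x a : ℝ} {c : ℝ → ℝ} (h : M.IsAuxAdmissible t x a c)
    (hs : t ≤ s) : M.auxPayoff P t x a c = M.runningPayoff P a t s x c +
      M.discount t s * M.auxPayoff P s (auxWealth t x c s) a c := by
  unfold auxPayoff runningPayoff
  rw [← Ioc_union_Ioi_eq_Ioi hs, lintegral_union measurableSet_Ioi
    (disjoint_left.2 fun r h1 h2 => absurd h1.2 (not_le.2 h2)),
    ← lintegral_const_mul' _ _ ENNReal.ofReal_ne_top]
  congr 1
  refine setLIntegral_congr_fun measurableSet_Ioi fun r hr => ?_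
  have hr' : s ≤ r := le_of_lt hr
  rw [auxWealth_trans hs hr' (h.integrable r (hs.trans hr')), ← mul_assoc,
    ← ENNReal.ofReal_mul (Real.exp_pos _).le, ← Real.exp_add]
  ring_nf

/-- The dynamic programming inequality. -/
theorem runningPayoff_add_le (hU : M.UtilityAssumption k b) {t s y a : ℝ}
    (hA : M.AuxRegular P a) (ht : 0 ≤ t) (hs : t ≤ s) {c : ℝ → ℝ} (hm : Measurable c)
    (hc : ∀ r, t ≤ r → r ≤ s → 0 ≤ c r) (hint : IntegrableOn c (Ioc t s))
    (hl : M.l a ≤ auxWealth t y c s) :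
    M.runningPayoff P a t s y c + M.discount t s * M.auxValue P s (auxWealth t y c s) a ≤
      M.auxValue P t y a := by
  obtain ⟨c₂, hc₂, hopt⟩ := exists_isAuxOptimal hU hA (ht.trans hs) hl
  classical
  let d : ℝ → ℝ := fun r => if r ≤ s then c r else c₂ r
  have hd1 : ∀ r, r ≤ s → d r = c r := fun r hr => by simp only [d, hr, if_true]
  have hd2 : ∀ r, s < r → d r = c₂ r := fun r hr => by simp only [d, not_le.2 hr, if_false]
  have hnn : ∀ᵐ r ∂(volume.restrict (Ioc t s)), 0 ≤ c r := by
    filter_upwards [ae_restrict_mem measurableSet_Ioc] with r hr using hc r hr.1.le hr.2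
  have hI : 0 ≤ ∫ r in Ioc t s, c r := integral_nonneg_of_ae hnn
  have hw1 : ∀ r, r ≤ s → auxWealth t y d r = auxWealth t y c r := by
    intro r hr
    unfold auxWealth
    rw [setIntegral_congr_fun measurableSet_Ioc fun u hu => hd1 u (hu.2.trans hr)]
  have hyl : M.l a ≤ y := by
    unfold auxWealth at hl
    linarith
  have hdadm : M.IsAuxAdmissible t y a d := by
    refine isAuxAdmissible_of_lintegral_le hyl
      (Measurable.ite measurableSet_Iic hm hc₂.measurable) ?_ ?_
    · intro r hr
      rcases le_or_gt r s with h | h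
      · rw [hd1 r h]
        exact hc r hr h
      · rw [hd2 r h]
        exact hc₂.nonneg r h.le
    · rw [← Ioc_union_Ioi_eq_Ioi hs, lintegral_union measurableSet_Ioi
        (disjoint_left.2 fun r h1 h2 => absurd h1.2 (not_le.2 h2)),
        setLIntegral_congr_fun (g := fun r => ENNReal.ofReal (c r)) measurableSet_Ioc
          fun r hr => by simp only [hd1 r hr.2],
        setLIntegral_congr_fun (g := fun r => ENNReal.ofReal (c₂ r)) measurableSet_Ioi
          fun r hr => by simp only [hd2 r hr],
        ← ofReal_integral_eq_lintegral_ofReal hint hnn]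
      refine (add_le_add_right hc₂.lintegral_le _).trans (le_of_eq ?_)
      rw [← ENNReal.ofReal_add hI (by linarith)]
      congr 1
      unfold auxWealth
      ring
  refine le_trans (le_of_eq ?_) hdadm.auxPayoff_le_auxValue
  rw [hdadm.auxPayoff_split hs, hw1 s le_rfl, ← hopt]
  congr 1
  · refine setLIntegral_congr_fun measurableSet_Ioc fun r hr => ?_
    rw [hd1 r hr.2, hw1 r hr.2]
  · congr 1
    refine setLIntegral_congr_fun measurableSet_Ioi fun r hr => ?_
    rw [hd2 r hr]
    congr 3
    unfold auxWealth
    rw [setIntegral_congr_fun measurableSet_Ioc fun u hu => hd2 u hu.1]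

theorem IsAuxOptimal.le {t x a : ℝ} {c : ℝ → ℝ} (h : M.IsAuxOptimal P t x a c) : M.l a ≤ x := by
  have := h.1.le_wealth t le_rfl
  rwa [auxWealth_self] at this

/-- An optimal consumption rate remains optimal at later times. -/
theorem IsAuxOptimal.restrict (hU : M.UtilityAssumption k b) {t s x a : ℝ}
    (hA : M.AuxRegular P a) (ht : 0 ≤ t) (hs : t ≤ s) {c : ℝ → ℝ}
    (h : M.IsAuxOptimal P t x a c) : M.IsAuxOptimal P s (auxWealth t x c s) a c := by
  refine ⟨h.1.restrict hs, le_antisymm (h.1.restrict hs).auxPayoff_le_auxValue ?_⟩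
  have h1 := runningPayoff_add_le hU hA ht hs h.1.measurable (fun r hr _ => h.1.nonneg r hr)
    (h.1.integrable s hs) (h.1.le_wealth s hs)
  have hfin : M.auxPayoff P t x a c ≠ ⊤ := by
    rw [h.2]
    exact auxValue_ne_top hU hA ht h.le
  rw [← h.2, h.1.auxPayoff_split hs] at h1
  have hrun : M.runningPayoff P a t s x c ≠ ⊤ := by
    rw [h.1.auxPayoff_split hs] at hfin
    exact ne_top_of_le_ne_top hfin le_self_add
  rw [ENNReal.add_le_add_iff_left hrun] at h1
  refine (ENNReal.mul_le_mul_iff_right ?_ ENNReal.ofReal_ne_top).1 h1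
  exact (ENNReal.ofReal_pos.2 (Real.exp_pos _)).ne'

/-- The auxiliary value function, discounted to time `0`. -/
noncomputable def presentValue (M : IlliquidMarket Ω) (P : Measure Ω) (a s y : ℝ) : ℝ :=
  Real.exp (-(M.rho + M.lam) * s) * (M.auxValue P s y a).toReal

/-- Both values are attained, so concavity of the payoff applies directly to a mixture of optimal
rates. -/
theorem concaveOn_presentValue (hU : M.UtilityAssumption k b) {s a : ℝ}
    (hA : M.AuxRegular P a) (hs : 0 ≤ s) : ConcaveOn ℝ (Ici (M.l a)) (M.presentValue P a s) := by
  have hconc : ConcaveOn ℝ (Ici (M.l a)) fun y => (M.auxValue P s y a).toReal := by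
    refine ⟨convex_Ici _, fun y₁ hy₁ y₂ hy₂ θ₁ θ₂ h1 h2 h => ?_⟩
    obtain ⟨c₁, hc₁, e₁⟩ := exists_isAuxOptimal hU hA hs hy₁
    obtain ⟨c₂, hc₂, e₂⟩ := exists_isAuxOptimal hU hA hs hy₂
    have hadm := hc₁.convexComb hc₂ h1 h2 h
    have hle := (le_self_add.trans (auxPayoff_concave hU hA hs hc₁ hc₂ h1 h2 h)).trans
      hadm.auxPayoff_le_auxValue
    rw [e₁, e₂] at hle
    have f1 := auxValue_ne_top hU hA hs hy₁
    have f2 := auxValue_ne_top hU hA hs hy₂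
    have f3 := auxValue_ne_top hU hA hs ((convex_Ici (M.l a)) hy₁ hy₂ h1 h2 h)
    have := (ENNReal.toReal_le_toReal (by finiteness) f3).2 hle
    rw [ENNReal.toReal_add (by finiteness) (by finiteness), ENNReal.toReal_mul, ENNReal.toReal_mul,
      ENNReal.toReal_ofReal h1, ENNReal.toReal_ofReal h2] at this
    exact this
  exact hconc.smul (Real.exp_pos _).le

theorem presentValue_nonneg (a s y : ℝ) : 0 ≤ M.presentValue P a s y :=
  mul_nonneg (Real.exp_pos _).le ENNReal.toReal_nonneg

theorem integrableOn_discounted_utility (hU : M.UtilityAssumption k b) {t s : ℝ}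
    (hβ : 0 < M.rho + M.lam) (ht : 0 ≤ t) {c : ℝ → ℝ} (hm : Measurable c)
    (hc : ∀ r ∈ Ioc t s, 0 ≤ c r) (hint : IntegrableOn c (Ioc t s)) :
    IntegrableOn (fun r => Real.exp (-(M.rho + M.lam) * r) * M.U (c r)) (Ioc t s) := by
  obtain ⟨K, hK, hUK⟩ := hU.exists_le_add
  have hdom : IntegrableOn (fun r => K * (1 + c r)) (Ioc t s) :=
    (((integrableOn_const (by simp)).add hint).const_mul K)
  refine Integrable.mono' hdom ?_ ?_
  · have h1 : Measurable fun r => Real.exp (-(M.rho + M.lam) * r) * M.U (max (c r) 0) :=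
      Measurable.mul (by fun_prop) ((measurable_posPart_utility hU).comp hm)
    refine h1.aestronglyMeasurable.congr ?_
    filter_upwards [ae_restrict_mem measurableSet_Ioc] with r hr
    rw [max_eq_left (hc r hr)]
  · filter_upwards [ae_restrict_mem measurableSet_Ioc] with r hr
    have h1 := hU.nonneg (hc r hr)
    have h2 : Real.exp (-(M.rho + M.lam) * r) ≤ 1 :=
      Real.exp_le_one_iff.2 (by nlinarith [hr.1])
    rw [Real.norm_of_nonneg (by positivity)]
    exact (mul_le_of_le_one_left h1 h2).trans (hUK _ (hc r hr))

theorem integrableOn_discounted_reward {t s x a : ℝ} (hA : M.AuxRegular P a) (ht : 0 ≤ t)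
    {Y : ℝ → ℝ} (hm : Measurable Y) (hY : ∀ r ∈ Ioc t s, M.l a ≤ Y r ∧ Y r ≤ x)
    (hx : M.l a ≤ x) :
    IntegrableOn (fun r => Real.exp (-(M.rho + M.lam) * r) * (M.g P r (Y r) a).toReal)
      (Ioc t s) := by
  refine ⟨?_, ?_⟩
  · refine Measurable.aestronglyMeasurable (Measurable.mul (by fun_prop) ?_)
    exact (hA.measurable_g.comp (measurable_id.prodMk hm)).ennreal_toReal
  · rw [hasFiniteIntegral_iff_ofReal (ae_of_all _ fun r =>
      mul_nonneg (Real.exp_pos _).le ENNReal.toReal_nonneg)]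
    refine lt_of_le_of_lt ?_ (hA.lintegral_g t x ht hx).lt_top
    refine (setLIntegral_mono' measurableSet_Ioc fun r hr => ?_).trans
      (lintegral_mono_set Ioc_subset_Ioi_self)
    rw [ENNReal.ofReal_mul (Real.exp_pos _).le,
      ENNReal.ofReal_toReal (hA.finite_g r (ht.trans_lt hr.1) _ (hY r hr).1)]
    have hβ := hA.rate_pos
    gcongr ENNReal.ofReal (Real.exp ?_) * ?_
    · nlinarith
    · exact hA.mono_g r (hY r hr).2

/-- The running payoff in terms of integrals of real functions. -/
theorem runningPayoff_eq (hU : M.UtilityAssumption k b) {t s y a : ℝ}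
    (hA : M.AuxRegular P a) (ht : 0 ≤ t) {c : ℝ → ℝ} (hm : Measurable c)
    (hc : ∀ r ∈ Ioc t s, 0 ≤ c r) (hint : IntegrableOn c (Ioc t s)) (hy : M.l a ≤ y)
    (hl : ∀ r ∈ Ioc t s, M.l a ≤ auxWealth t y c r ∧ auxWealth t y c r ≤ y) :
    M.runningPayoff P a t s y c = ENNReal.ofReal (Real.exp ((M.rho + M.lam) * t) *
      ((∫ r in Ioc t s, Real.exp (-(M.rho + M.lam) * r) * M.U (c r)) +
        ∫ r in Ioc t s, Real.exp (-(M.rho + M.lam) * r) *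
          (M.g P r (auxWealth t y c r) a).toReal)) := by
  have i1 := integrableOn_discounted_utility hU hA.rate_pos ht hm hc hint
  have i2 := integrableOn_discounted_reward hA ht (measurable_auxWealth t y hm) hl hy
  have i3 : IntegrableOn (fun r => Real.exp (-(M.rho + M.lam) * r) * M.U (c r) +
      Real.exp (-(M.rho + M.lam) * r) * (M.g P r (auxWealth t y c r) a).toReal) (Ioc t s) :=
    i1.add i2
  rw [← integral_add i1 i2, ENNReal.ofReal_mul (Real.exp_pos _).le,
    ofReal_integral_eq_lintegral_ofReal i3, ← lintegral_const_mul' _ _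
    ENNReal.ofReal_ne_top]
  · refine setLIntegral_congr_fun measurableSet_Ioc fun r hr => ?_
    have hpos := hU.nonneg (hc r hr)
    have hfin := hA.finite_g r (ht.trans_lt hr.1) _ (hl r hr).1
    rw [← mul_add, ENNReal.ofReal_mul (Real.exp_pos _).le, ← mul_assoc,
      ← ENNReal.ofReal_mul (Real.exp_pos _).le, ← Real.exp_add,
      ENNReal.ofReal_add hpos ENNReal.toReal_nonneg, ENNReal.ofReal_toReal hfin, discount]
    ring_nf
  · filter_upwards [ae_restrict_mem measurableSet_Ioc] with r hr
    have hpos := hU.nonneg (hc r hr)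
    simp only [Pi.zero_apply]
    positivity

theorem ofReal_presentValue (hU : M.UtilityAssumption k b) {s y a : ℝ}
    (hA : M.AuxRegular P a) (hs : 0 ≤ s) (hy : M.l a ≤ y) :
    ENNReal.ofReal (Real.exp ((M.rho + M.lam) * s) * M.presentValue P a s y) =
      M.auxValue P s y a := by
  unfold presentValue
  rw [← mul_assoc, ← Real.exp_add, neg_mul, add_neg_cancel, Real.exp_zero, one_mul,
    ENNReal.ofReal_toReal (auxValue_ne_top hU hA hs hy)]

theorem discount_mul_auxValue (hU : M.UtilityAssumption k b) {t s y a : ℝ}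
    (hA : M.AuxRegular P a) (hs : 0 ≤ s) (hy : M.l a ≤ y) :
    M.discount t s * M.auxValue P s y a =
      ENNReal.ofReal (Real.exp ((M.rho + M.lam) * t) * M.presentValue P a s y) := by
  rw [← ofReal_presentValue hU hA hs hy, discount, ← ENNReal.ofReal_mul (Real.exp_pos _).le,
    ← mul_assoc, ← Real.exp_add]
  ring_nf

theorem integral_discounted_nonneg (hU : M.UtilityAssumption k b) {t s a : ℝ} {c Y : ℝ → ℝ}
    (hc : ∀ r ∈ Ioc t s, 0 ≤ c r) :
    0 ≤ (∫ r in Ioc t s, Real.exp (-(M.rho + M.lam) * r) * M.U (c r)) +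
        ∫ r in Ioc t s, Real.exp (-(M.rho + M.lam) * r) * (M.g P r (Y r) a).toReal :=
  add_nonneg (setIntegral_nonneg measurableSet_Ioc fun r hr =>
    mul_nonneg (Real.exp_pos _).le (hU.nonneg (hc r hr)))
    (setIntegral_nonneg measurableSet_Ioc fun _ _ =>
      mul_nonneg (Real.exp_pos _).le ENNReal.toReal_nonneg)

theorem auxWealth_bounds {t s y a : ℝ} {c : ℝ → ℝ} (hc : ∀ r ∈ Ioc t s, 0 ≤ c r)
    (hint : IntegrableOn c (Ioc t s)) (hl : M.l a ≤ auxWealth t y c s) :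
    ∀ r ∈ Ioc t s, M.l a ≤ auxWealth t y c r ∧ auxWealth t y c r ≤ y := by
  intro r hr
  have h1 : 0 ≤ ∫ u in Ioc t r, c u :=
    setIntegral_nonneg measurableSet_Ioc fun u hu => hc u ⟨hu.1, hu.2.trans hr.2⟩
  have h2 : 0 ≤ ∫ u in Ioc r s, c u :=
    setIntegral_nonneg measurableSet_Ioc fun u hu => hc u ⟨hr.1.trans hu.1, hu.2⟩
  have h3 := auxWealth_trans (x := y) hr.1.le hr.2 hint
  unfold auxWealth at h3 hl ⊢
  constructor <;> linarith

/-- The dynamic programming inequality for the discounted value. -/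
theorem le_presentValue (hU : M.UtilityAssumption k b) {t s y a : ℝ}
    (hA : M.AuxRegular P a) (ht : 0 ≤ t) (hs : t ≤ s) {c : ℝ → ℝ} (hm : Measurable c)
    (hc : ∀ r, t ≤ r → r ≤ s → 0 ≤ c r) (hint : IntegrableOn c (Ioc t s))
    (hl : M.l a ≤ auxWealth t y c s) :
    (∫ r in Ioc t s, Real.exp (-(M.rho + M.lam) * r) * M.U (c r)) +
        (∫ r in Ioc t s, Real.exp (-(M.rho + M.lam) * r) *
          (M.g P r (auxWealth t y c r) a).toReal) +
        M.presentValue P a s (auxWealth t y c s) ≤ M.presentValue P a t y := by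
  have hc' : ∀ r ∈ Ioc t s, 0 ≤ c r := fun r hr => hc r hr.1.le hr.2
  have hI : 0 ≤ ∫ r in Ioc t s, c r := setIntegral_nonneg measurableSet_Ioc hc'
  have hyl : M.l a ≤ y := by
    unfold auxWealth at hl
    linarith
  have h := runningPayoff_add_le hU hA ht hs hm hc hint hl
  rw [runningPayoff_eq hU hA ht hm hc' hint hyl (auxWealth_bounds hc' hint hl),
    discount_mul_auxValue hU hA (ht.trans hs) hl, ← ofReal_presentValue hU hA ht hyl,
    ← ENNReal.ofReal_add (mul_nonneg (Real.exp_pos _).le (integral_discounted_nonneg hU hc'))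
    (mul_nonneg (Real.exp_pos _).le (presentValue_nonneg _ _ _)), ← mul_add,
    ENNReal.ofReal_le_ofReal_iff (mul_nonneg (Real.exp_pos _).le (presentValue_nonneg _ _ _))] at h
  exact le_of_mul_le_mul_left h (Real.exp_pos _)

/-- The dynamic programming principle along an optimal consumption rate. -/
theorem IsAuxOptimal.presentValue_eq (hU : M.UtilityAssumption k b) {t s x a : ℝ}
    (hA : M.AuxRegular P a) (ht : 0 ≤ t) (hs : t ≤ s) {c : ℝ → ℝ}
    (h : M.IsAuxOptimal P t x a c) :
    M.presentValue P a t x = (∫ r in Ioc t s, Real.exp (-(M.rho + M.lam) * r) * M.U (c r)) +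
        (∫ r in Ioc t s, Real.exp (-(M.rho + M.lam) * r) *
          (M.g P r (auxWealth t x c r) a).toReal) +
        M.presentValue P a s (auxWealth t x c s) := by
  have hc' : ∀ r ∈ Ioc t s, 0 ≤ c r := fun r hr => h.1.nonneg r hr.1.le
  have hl := h.1.le_wealth s hs
  have hint := h.1.integrable s hs
  have h1 := h.1.auxPayoff_split (P := P) hs
  rw [h.2, (h.restrict hU hA ht hs).2,
    runningPayoff_eq hU hA ht h.1.measurable hc' hint h.le (auxWealth_bounds hc' hint hl),
    discount_mul_auxValue hU hA (ht.trans hs) hl, ← ofReal_presentValue hU hA ht h.le,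
    ← ENNReal.ofReal_add (mul_nonneg (Real.exp_pos _).le (integral_discounted_nonneg hU hc'))
    (mul_nonneg (Real.exp_pos _).le (presentValue_nonneg _ _ _)), ← mul_add,
    ENNReal.ofReal_eq_ofReal_iff (mul_nonneg (Real.exp_pos _).le (presentValue_nonneg _ _ _))
    (mul_nonneg (Real.exp_pos _).le
      (add_nonneg (integral_discounted_nonneg hU hc') (presentValue_nonneg _ _ _)))] at h1
  exact mul_left_cancel₀ (Real.exp_pos _).ne' h1

end IlliquidMarket

/-- Lebesgue's differentiation theorem along shrinking intervals to the right. -/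
theorem ae_tendsto_right_average {f : ℝ → ℝ} {t : ℝ}
    (hf : ∀ s, t ≤ s → IntegrableOn f (Ioc t s)) :
    ∀ᵐ s ∂(volume.restrict (Ioi t)),
      Tendsto (fun n : ℕ => (∫ r in Ioc s (s + 1 / ((n : ℝ) + 1)), f r) / (1 / ((n : ℝ) + 1)))
        atTop (𝓝 (f s)) := by
  -- Cutting off before `t` gives a function that is locally integrable on the whole line; to the
  -- right of a point `s > t` the averages are unchanged.
  have hloc : LocallyIntegrable ((Ioi t).indicator f) volume := by
    rw [locallyIntegrable_iff]
    intro K hK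
    obtain ⟨B, hB⟩ := hK.bddAbove
    have h1 : IntegrableOn ((Ioi t).indicator f) (Iic (max t B)) := by
      rw [IntegrableOn, integrable_indicator_iff measurableSet_Ioi, IntegrableOn,
        Measure.restrict_restrict measurableSet_Ioi, Ioi_inter_Iic]
      exact hf _ (le_max_left _ _)
    exact h1.mono_set fun y hy => (hB hy).trans (le_max_right _ _)
  rw [ae_restrict_iff' measurableSet_Ioi]
  filter_upwards [LocallyIntegrable.ae_hasDerivAt_integral hloc] with s hs hst
  have hd := (hs s).tendsto_slope
  have hseq : Tendsto (fun n : ℕ => s + 1 / ((n : ℝ) + 1)) atTop (𝓝[≠] s) := by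
    refine tendsto_nhdsWithin_iff.2 ⟨?_, Eventually.of_forall fun n => ?_⟩
    · simpa using (tendsto_const_nhds (x := s)).add tendsto_one_div_add_atTop_nhds_zero_nat
    · have : (0 : ℝ) < 1 / ((n : ℝ) + 1) := by positivity
      simp only [mem_compl_iff, mem_singleton_iff]
      linarith
  have h2 := hd.comp hseq
  rw [indicator_of_mem hst] at h2
  refine h2.congr fun n => ?_
  have hn : (0 : ℝ) < 1 / ((n : ℝ) + 1) := by positivity
  simp only [Function.comp_apply, slope_def_field, intervalIntegral.integral_same, sub_zero,
    add_sub_cancel_left]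
  rw [intervalIntegral.integral_of_le (by linarith)]
  congr 1
  refine setIntegral_congr_fun measurableSet_Ioc fun r hr => ?_
  exact indicator_of_mem (lt_trans hst hr.1 : t < r) f

namespace IlliquidMarket

variable {Ω : Type*} [MeasurableSpace Ω] {M : IlliquidMarket Ω} {P : Measure Ω} {k b : ℝ}

theorem UtilityAssumption.differentiableAt (hU : M.UtilityAssumption k b) {y : ℝ} (hy : 0 < y) :
    DifferentiableAt ℝ M.U y :=
  (hU.contDiff.differentiableOn one_ne_zero).differentiableAt (Ioi_mem_nhds hy)

/-- The marginal utility at `0` is infinite. -/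
theorem UtilityAssumption.eventually_mul_lt (hU : M.UtilityAssumption k b) (C : ℝ) :
    ∀ᶠ θ in 𝓝[>] (0 : ℝ), C * θ < M.U θ := by
  filter_upwards [hU.inada_zero.eventually_gt_atTop C, self_mem_nhdsWithin] with θ hθ h0
  have h0' : (0 : ℝ) < θ := h0
  have h1 := hU.strictConcave.concaveOn.deriv_le_slope (self_mem_Ici (a := (0 : ℝ)))
    (show (0 : ℝ) ≤ θ from h0'.le) h0' (hU.differentiableAt h0')
  rw [slope_def_field, hU.zero, sub_zero, sub_zero, le_div_iff₀ h0'] at h1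
  nlinarith

/-! ### Perturbations of an optimal consumption rate -/

theorem concaveOn_toReal_g {a s : ℝ} (hA : M.AuxRegular P a) (hs : 0 < s) :
    ConcaveOn ℝ (Ici (M.l a)) fun y => (M.g P s y a).toReal := by
  refine ⟨convex_Ici _, fun y₁ hy₁ y₂ hy₂ θ₁ θ₂ h1 h2 h => ?_⟩
  have f1 := hA.finite_g s hs _ hy₁
  have f2 := hA.finite_g s hs _ hy₂
  have f3 := hA.finite_g s hs _ ((convex_Ici (M.l a)) hy₁ hy₂ h1 h2 h)
  have := (ENNReal.toReal_le_toReal (by finiteness) f3).2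
    (hA.concave_g s hs y₁ y₂ hy₁ hy₂ θ₁ θ₂ h1 h2 h)
  rw [ENNReal.toReal_add (by finiteness) (by finiteness), ENNReal.toReal_mul, ENNReal.toReal_mul,
    ENNReal.toReal_ofReal h1, ENNReal.toReal_ofReal h2] at this
  exact this

theorem toReal_g_mono {a s y y' : ℝ} (hA : M.AuxRegular P a) (hs : 0 < s) (hy : M.l a ≤ y)
    (h : y ≤ y') : (M.g P s y a).toReal ≤ (M.g P s y' a).toReal :=
  ENNReal.toReal_mono (hA.finite_g s hs _ (hy.trans h)) (hA.mono_g s h)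

/-- The running reward is Lipschitz in wealth away from the least wealth. -/
theorem toReal_g_sub_le {a s y y' x η d : ℝ} (hA : M.AuxRegular P a) (hs : 0 < s) (hη : 0 < η)
    (h1 : M.l a + η ≤ y') (h2 : y' ≤ y) (h3 : y ≤ x) (hd : y - y' ≤ d) :
    (M.g P s y a).toReal ≤ (M.g P s y' a).toReal + d / η * (M.g P s x a).toReal := by
  have hgx : 0 ≤ (M.g P s x a).toReal := ENNReal.toReal_nonneg
  rcases h2.eq_or_lt with rfl | h2
  · have : 0 ≤ d / η * (M.g P s x a).toReal := by
      have : 0 ≤ d := by linarith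
      positivity
    linarith
  -- The slope on `[y', y]` is at most the slope on `[l(a), y']`, an interval of length at least `η`
  -- over which `g` rises by at most `g(s,x,a)`.
  have h4 := (concaveOn_toReal_g hA hs).increment_mul_le (p := M.l a) (q := y') (r := y') (s := y)
    self_mem_Ici (show M.l a ≤ y' by linarith) (show M.l a ≤ y' by linarith)
    (show M.l a ≤ y by linarith) (by linarith) h2 (by linarith) h2.le
  have h5 : (M.g P s y' a).toReal ≤ (M.g P s x a).toReal :=
    toReal_g_mono hA hs (by linarith) (h2.le.trans h3)
  have h6 : (M.g P s y' a).toReal ≤ (M.g P s y a).toReal := toReal_g_mono hA hs (by linarith) h2.le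
  have h7 : 0 ≤ (M.g P s (M.l a) a).toReal := ENNReal.toReal_nonneg
  have h8 : ((M.g P s y a).toReal - (M.g P s y' a).toReal) * η ≤ d * (M.g P s x a).toReal := by
    calc ((M.g P s y a).toReal - (M.g P s y' a).toReal) * η
        ≤ ((M.g P s y a).toReal - (M.g P s y' a).toReal) * (y' - M.l a) :=
          mul_le_mul_of_nonneg_left (by linarith) (by linarith)
      _ ≤ ((M.g P s y' a).toReal - (M.g P s (M.l a) a).toReal) * (y - y') := h4
      _ ≤ (M.g P s x a).toReal * (y - y') := by
          refine mul_le_mul_of_nonneg_right (by linarith) (by linarith)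
      _ ≤ (M.g P s x a).toReal * d := mul_le_mul_of_nonneg_left hd hgx
      _ = _ := mul_comm _ _
  rw [div_mul_eq_mul_div, ← sub_le_iff_le_add', le_div_iff₀ hη]
  exact h8

/-- The discounted reward from holding the wealth `x` on `(t, s]`. -/
noncomputable def rewardIntegral (M : IlliquidMarket Ω) (P : Measure Ω) (a x t s : ℝ) : ℝ :=
  ∫ r in Ioc t s, Real.exp (-(M.rho + M.lam) * r) * (M.g P r x a).toReal

theorem integrableOn_rewardIntegral {a x t s : ℝ} (hA : M.AuxRegular P a) (ht : 0 ≤ t)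
    (hx : M.l a ≤ x) : IntegrableOn (fun r => Real.exp (-(M.rho + M.lam) * r) *
      (M.g P r x a).toReal) (Ioc t s) :=
  integrableOn_discounted_reward hA ht measurable_const (fun _ _ => ⟨hx, le_rfl⟩) hx

theorem IsAuxOptimal.bounds {t s x a : ℝ} {c : ℝ → ℝ} (h : M.IsAuxOptimal P t x a c) :
    ∀ r ∈ Ioc t s, M.l a ≤ auxWealth t x c r ∧ auxWealth t x c r ≤ x := fun r hr =>
  ⟨h.1.le_wealth r hr.1.le, h.1.le_start⟩

theorem auxWealth_add (t x θ s : ℝ) (c : ℝ → ℝ) :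
    auxWealth t (x + θ) c s = auxWealth t x c s + θ := by
  unfold auxWealth
  ring

/-- More initial wealth can be kept until a later time. -/
theorem IsAuxOptimal.presentValue_add_sub_le (hU : M.UtilityAssumption k b) {t s x a θ : ℝ}
    (hA : M.AuxRegular P a) (ht : 0 ≤ t) (hs : t ≤ s) (hθ : 0 ≤ θ) {c : ℝ → ℝ}
    (h : M.IsAuxOptimal P t x a c) :
    M.presentValue P a s (auxWealth t x c s + θ) - M.presentValue P a s (auxWealth t x c s) ≤
      M.presentValue P a t (x + θ) - M.presentValue P a t x := by
  have hc : ∀ r, t ≤ r → r ≤ s → 0 ≤ c r := fun r hr _ => h.1.nonneg r hr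
  have hint := h.1.integrable s hs
  have hlow := h.1.le_wealth s hs
  -- The same rate started from `x + θ` shifts the wealth path up by `θ`: the utility is unchanged
  -- and the reward does not decrease.
  have h1 := le_presentValue hU hA ht hs (y := x + θ) h.1.measurable hc hint
    (by rw [auxWealth_add]; linarith)
  have h2 := h.presentValue_eq hU hA ht hs
  have i1 := integrableOn_discounted_reward hA ht (measurable_auxWealth t x h.1.measurable)
    (h.bounds (s := s)) h.le
  have i2 : IntegrableOn (fun r => Real.exp (-(M.rho + M.lam) * r) *
      (M.g P r (auxWealth t (x + θ) c r) a).toReal) (Ioc t s) := by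
    refine integrableOn_discounted_reward hA ht (measurable_auxWealth t _ h.1.measurable)
      (x := x + θ) (fun r hr => ?_) (by linarith [h.le])
    rw [auxWealth_add]
    have := h.bounds r hr
    exact ⟨by linarith, by linarith⟩
  have h3 := setIntegral_mono_on i1 i2 measurableSet_Ioc fun r hr => by
    refine mul_le_mul_of_nonneg_left ?_ (Real.exp_pos _).le
    refine toReal_g_mono hA (ht.trans_lt hr.1) (h.bounds r hr).1 ?_
    rw [auxWealth_add]
    linarith
  rw [auxWealth_add] at h1
  linarith

/-- Comparison of the rewards of two wealth paths. -/
theorem integral_reward_le {t s x a η d : ℝ} (hA : M.AuxRegular P a) (ht : 0 ≤ t) (hη : 0 < η)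
    {Y Y' : ℝ → ℝ} (hY : Measurable Y) (hY' : Measurable Y')
    (h : ∀ r ∈ Ioc t s, M.l a + η ≤ Y' r ∧ Y' r ≤ Y r ∧ Y r ≤ x ∧ Y r - Y' r ≤ d)
    (hx : M.l a ≤ x) :
    ∫ r in Ioc t s, Real.exp (-(M.rho + M.lam) * r) * (M.g P r (Y r) a).toReal ≤
      (∫ r in Ioc t s, Real.exp (-(M.rho + M.lam) * r) * (M.g P r (Y' r) a).toReal) +
        d / η * M.rewardIntegral P a x t s := by
  have i1 := integrableOn_discounted_reward hA ht hY (x := x) (s := s) (fun r hr => by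
    obtain ⟨h1, h2, h3, -⟩ := h r hr
    exact ⟨by linarith, h3⟩) hx
  have i2 := integrableOn_discounted_reward hA ht hY' (x := x) (s := s) (fun r hr => by
    obtain ⟨h1, h2, h3, -⟩ := h r hr
    exact ⟨by linarith, by linarith⟩) hx
  have i3 := integrableOn_rewardIntegral (s := s) hA ht hx
  unfold rewardIntegral
  rw [← integral_const_mul, ← integral_add i2 (i3.const_mul _)]
  refine setIntegral_mono_on i1 (i2.add (i3.const_mul _)) measurableSet_Ioc fun r hr => ?_
  obtain ⟨h1, h2, h3, h4⟩ := h r hr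
  have h5 := toReal_g_sub_le hA (ht.trans_lt hr.1) hη h1 h2 h3 h4
  calc Real.exp (-(M.rho + M.lam) * r) * (M.g P r (Y r) a).toReal
      ≤ Real.exp (-(M.rho + M.lam) * r) *
        ((M.g P r (Y' r) a).toReal + d / η * (M.g P r x a).toReal) :=
        mul_le_mul_of_nonneg_left h5 (Real.exp_pos _).le
    _ = _ := by ring

/-- Less initial wealth can be carried along until a later time. -/
theorem IsAuxOptimal.presentValue_sub_sub_le (hU : M.UtilityAssumption k b) {t s x a θ η : ℝ}
    (hA : M.AuxRegular P a) (ht : 0 ≤ t) (hs : t ≤ s) (hθ : 0 ≤ θ) (hη : 0 < η) {c : ℝ → ℝ}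
    (h : M.IsAuxOptimal P t x a c) (hl : M.l a + η ≤ auxWealth t x c s - θ) :
    M.presentValue P a t x - M.presentValue P a t (x - θ) ≤
      M.presentValue P a s (auxWealth t x c s) - M.presentValue P a s (auxWealth t x c s - θ) +
        θ / η * M.rewardIntegral P a x t s := by
  have hc : ∀ r, t ≤ r → r ≤ s → 0 ≤ c r := fun r hr _ => h.1.nonneg r hr
  have hint := h.1.integrable s hs
  have hsub : ∀ r, auxWealth t (x - θ) c r = auxWealth t x c r - θ := fun r => by
    rw [sub_eq_add_neg, auxWealth_add, ← sub_eq_add_neg]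
  -- The same rate shifts the path down by `θ`; the margin `η` keeps it where the reward is
  -- Lipschitz.
  have h1 := le_presentValue hU hA ht hs (y := x - θ) h.1.measurable hc hint
    (by rw [hsub]; linarith)
  have h2 := h.presentValue_eq hU hA ht hs
  have h3 := integral_reward_le hA ht hη (measurable_auxWealth t x h.1.measurable)
    (measurable_auxWealth t (x - θ) h.1.measurable) (s := s) (x := x) (d := θ)
    (fun r hr => by
      have e1 := h.1.auxWealth_anti hr.1.le hr.2
      rw [hsub]
      exact ⟨by linarith, by linarith, h.1.le_start, by linarith⟩) h.le
  rw [hsub] at h1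
  linarith

/-- Extra initial wealth can be consumed at a constant rate. -/
theorem IsAuxOptimal.le_presentValue_add (hU : M.UtilityAssumption k b) {t s x a θ : ℝ}
    (hA : M.AuxRegular P a) (ht : 0 ≤ t) (hs : t ≤ s) (hθ : 0 ≤ θ) {c : ℝ → ℝ}
    (h : M.IsAuxOptimal P t x a c) :
    (∫ r in Ioc t s, Real.exp (-(M.rho + M.lam) * r) * M.U (c r + θ)) -
      (∫ r in Ioc t s, Real.exp (-(M.rho + M.lam) * r) * M.U (c r)) ≤
      M.presentValue P a t (x + θ * (s - t)) - M.presentValue P a t x := by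
  have hc : ∀ r, t ≤ r → r ≤ s → 0 ≤ c r + θ := fun r hr _ => add_nonneg (h.1.nonneg r hr) hθ
  have hint : IntegrableOn (fun r => c r + θ) (Ioc t s) :=
    (h.1.integrable s hs).add (integrableOn_const (by simp))
  have hm : Measurable fun r => c r + θ := h.1.measurable.add_const θ
  -- The extra capital is exactly used up at time `s` and is never negative before, so the reward
  -- does not suffer.
  have hw : ∀ r, t ≤ r → auxWealth t (x + θ * (s - t)) (fun r => c r + θ) r =
      auxWealth t x c r + θ * (s - r) := by
    intro r hr
    unfold auxWealth
    rw [integral_add (h.1.integrable r hr) (integrableOn_const (by simp))]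
    simp only [integral_const, smul_eq_mul, measureReal_restrict_apply, MeasurableSet.univ,
      univ_inter, Real.volume_real_Ioc_of_le hr]
    ring
  have hlow := h.1.le_wealth s hs
  have h1 := le_presentValue hU hA ht hs (y := x + θ * (s - t)) hm hc hint
    (by rw [hw s hs]; simpa using hlow)
  have h2 := h.presentValue_eq hU hA ht hs
  have i1 := integrableOn_discounted_reward hA ht (measurable_auxWealth t x h.1.measurable)
    (h.bounds (s := s)) h.le
  have hpos : 0 ≤ θ * (s - t) := mul_nonneg hθ (by linarith)
  have i2 : IntegrableOn (fun r => Real.exp (-(M.rho + M.lam) * r) *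
      (M.g P r (auxWealth t (x + θ * (s - t)) (fun r => c r + θ) r) a).toReal) (Ioc t s) := by
    refine integrableOn_discounted_reward hA ht (measurable_auxWealth t _ hm)
      (x := x + θ * (s - t)) (fun r hr => ?_) (by linarith [h.le])
    rw [hw r hr.1.le]
    have := h.bounds r hr
    have e1 : 0 ≤ θ * (s - r) := mul_nonneg hθ (by linarith [hr.2])
    have e2 : θ * (s - r) ≤ θ * (s - t) := mul_le_mul_of_nonneg_left (by linarith [hr.1]) hθ
    exact ⟨by linarith, by linarith⟩
  have h3 := setIntegral_mono_on i1 i2 measurableSet_Ioc fun r hr => by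
    refine mul_le_mul_of_nonneg_left ?_ (Real.exp_pos _).le
    refine toReal_g_mono hA (ht.trans_lt hr.1) (h.bounds r hr).1 ?_
    rw [hw r hr.1.le]
    have e1 : 0 ≤ θ * (s - r) := mul_nonneg hθ (by linarith [hr.2])
    linarith
  rw [hw s hs, sub_self, mul_zero, add_zero] at h1
  linarith

/-- A lack of initial wealth can be made up for by a proportional cut in consumption. -/
theorem IsAuxOptimal.presentValue_sub_le (hU : M.UtilityAssumption k b) {t s x a θ η : ℝ}
    (hA : M.AuxRegular P a) (ht : 0 ≤ t) (hs : t ≤ s) (hθ : 0 ≤ θ) (hθ' : θ ≤ 1) (hη : 0 < η)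
    {c : ℝ → ℝ} (h : M.IsAuxOptimal P t x a c) (hl : M.l a + η ≤ auxWealth t x c s) :
    M.presentValue P a t x - M.presentValue P a t (x - θ * ∫ r in Ioc t s, c r) ≤
      (∫ r in Ioc t s, Real.exp (-(M.rho + M.lam) * r) * M.U (c r)) -
      (∫ r in Ioc t s, Real.exp (-(M.rho + M.lam) * r) * M.U ((1 - θ) * c r)) +
        θ * (∫ r in Ioc t s, c r) / η * M.rewardIntegral P a x t s := by
  have hc : ∀ r, t ≤ r → r ≤ s → 0 ≤ (1 - θ) * c r := fun r hr _ =>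
    mul_nonneg (by linarith) (h.1.nonneg r hr)
  have hint : IntegrableOn (fun r => (1 - θ) * c r) (Ioc t s) := (h.1.integrable s hs).const_mul _
  have hm : Measurable fun r => (1 - θ) * c r := h.1.measurable.const_mul _
  -- The missing capital equals the saved consumption, so the two paths meet at `s`; before that the
  -- new path is a convex combination of the old wealth and its terminal value.
  have hw : ∀ r, auxWealth t (x - θ * ∫ r in Ioc t s, c r) (fun r => (1 - θ) * c r) r =
      θ * auxWealth t x c s + (1 - θ) * auxWealth t x c r := by
    intro r
    unfold auxWealth
    rw [integral_const_mul]
    ring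
  have h1 := le_presentValue hU hA ht hs (y := x - θ * ∫ r in Ioc t s, c r) hm hc hint
    (by rw [hw]; linarith)
  have h2 := h.presentValue_eq hU hA ht hs
  have h3 := integral_reward_le hA ht hη (measurable_auxWealth t x h.1.measurable)
    (measurable_auxWealth t (x - θ * ∫ r in Ioc t s, c r) hm) (s := s) (x := x)
    (d := θ * ∫ r in Ioc t s, c r)
    (fun r hr => by
      have e1 := h.1.auxWealth_anti hr.1.le hr.2
      have e2 := h.1.le_start (s := r)
      have e3 : auxWealth t x c s = x - ∫ r in Ioc t s, c r := rfl
      rw [hw]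
      refine ⟨by nlinarith, by nlinarith, e2, ?_⟩
      have : θ * auxWealth t x c r ≤ θ * x := mul_le_mul_of_nonneg_left e2 hθ
      rw [e3]
      linarith) h.le
  have e4 : θ * auxWealth t x c s + (1 - θ) * auxWealth t x c s = auxWealth t x c s := by ring
  rw [hw, e4] at h1
  linarith

/-- Increments of the discounted value grow at most linearly above an interior point. -/
theorem presentValue_increment_le (hU : M.UtilityAssumption k b) {s a x θ : ℝ}
    (hA : M.AuxRegular P a) (hs : 0 ≤ s) (hx : M.l a < x) (hθ : 0 < θ) :
    M.presentValue P a s (x + θ) - M.presentValue P a s x ≤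
      M.presentValue P a s x / (x - M.l a) * θ := by
  have h := (concaveOn_presentValue (P := P) hU hA hs).increment_mul_le (p := M.l a) (q := x)
    (r := x) (s := x + θ) self_mem_Ici hx.le hx.le (show M.l a ≤ x + θ by linarith) hx
    (by linarith) hx.le (by linarith)
  have h0 := presentValue_nonneg (M := M) (P := P) a s (M.l a)
  rw [div_mul_eq_mul_div, le_div_iff₀ (by linarith)]
  nlinarith

/-- Optimal wealth stays above the least wealth. -/
theorem IsAuxOptimal.lt_auxWealth (hU : M.UtilityAssumption k b) {t s x a : ℝ}
    (hA : M.AuxRegular P a) (ht : 0 ≤ t) (hs : t ≤ s) {c : ℝ → ℝ}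
    (h : M.IsAuxOptimal P t x a c) (hx : M.l a < x) : M.l a < auxWealth t x c s := by
  by_contra! hcon
  have hY : auxWealth t x c s = M.l a := le_antisymm hcon (h.1.le_wealth s hs)
  have hs0 : 0 ≤ s := ht.trans hs
  have hs1 : s ≤ s + 1 := by linarith
  have hopt := h.restrict hU hA ht hs
  -- Once at the least wealth, nothing is left to consume.
  have hzero : ∀ᵐ r ∂(volume.restrict (Ioc s (s + 1))), c r = 0 := by
    have h1 := h.1.auxWealth_sub hs hs1
    have h2 := h.1.le_wealth (s + 1) (by linarith)
    have h3 : 0 ≤ᵐ[volume.restrict (Ioc s (s + 1))] c := by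
      filter_upwards [ae_restrict_mem measurableSet_Ioc] with r hr
      exact h.1.nonneg r (hs.trans hr.1.le)
    have h4 : ∫ r in Ioc s (s + 1), c r = 0 :=
      le_antisymm (by linarith) (integral_nonneg_of_ae h3)
    exact (integral_eq_zero_iff_of_nonneg_ae h3 (hopt.1.integrable _ hs1)).1 h4
  set κ := ∫ r in Ioc s (s + 1), Real.exp (-(M.rho + M.lam) * r) with hκ
  have hκ0 : 0 < κ := by
    rw [hκ, ← intervalIntegral.integral_of_le hs1]
    exact intervalIntegral.intervalIntegral_pos_of_pos (Continuous.intervalIntegrable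
      (by fun_prop) _ _) (fun r => Real.exp_pos _) (by linarith)
  -- By concavity `θ` more capital at time `t` is worth at most `C θ`. Keeping it until `s` and
  -- consuming it over the next unit of time would earn `κ U(θ)`, which exceeds `C θ` for small `θ`
  -- because marginal utility at `0` is infinite.
  set C := M.presentValue P a t x / (x - M.l a)
  obtain ⟨θ, hθU, hθ⟩ :=
    ((hU.eventually_mul_lt (C / κ)).and self_mem_nhdsWithin).exists
  have hθ0 : (0 : ℝ) < θ := hθ
  have h1 := presentValue_increment_le (P := P) hU hA ht hx hθ0
  have h2 := h.presentValue_add_sub_le hU hA ht hs hθ0.le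
  have h3 := hopt.le_presentValue_add hU hA hs0 hs1 hθ0.le
  have e1 : ∫ r in Ioc s (s + 1), Real.exp (-(M.rho + M.lam) * r) * M.U (c r + θ) =
      κ * M.U θ := by
    rw [hκ, ← integral_mul_const]
    refine integral_congr_ae ?_
    filter_upwards [hzero] with r hr
    rw [hr, zero_add]
  have e2 : ∫ r in Ioc s (s + 1), Real.exp (-(M.rho + M.lam) * r) * M.U (c r) = 0 := by
    rw [integral_congr_ae (g := fun _ => 0), integral_zero]
    filter_upwards [hzero] with r hr
    rw [hr, hU.zero, mul_zero]
  rw [e1, e2, add_sub_cancel_left, mul_one, sub_zero] at h3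
  have h4 : κ * M.U θ ≤ C * θ := by linarith
  rw [div_mul_eq_mul_div, div_lt_iff₀ hκ0] at hθU
  linarith

end IlliquidMarket

/-! ### One-sided derivatives of concave functions on a half-line -/

theorem HasDerivWithinAt.tendsto_right_quotient {f : ℝ → ℝ} {f' x : ℝ}
    (h : HasDerivWithinAt f f' (Ioi x) x) :
    Tendsto (fun θ => (f (x + θ) - f x) / θ) (𝓝[>] 0) (𝓝 f') := by
  have h1 := (hasDerivWithinAt_iff_tendsto_slope' (self_notMem_Ioi (a := x))).1 h
  have h2 : Tendsto (fun θ : ℝ => x + θ) (𝓝[>] 0) (𝓝[>] x) := by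
    refine tendsto_nhdsWithin_iff.2 ⟨?_, ?_⟩
    · exact ((by fun_prop : Continuous fun θ : ℝ => x + θ).tendsto' 0 x (by simp)).mono_left
        nhdsWithin_le_nhds
    · filter_upwards [self_mem_nhdsWithin] with θ hθ
      exact lt_add_of_pos_right x hθ
  refine (h1.comp h2).congr fun θ => ?_
  simp [slope_def_field]

theorem HasDerivWithinAt.tendsto_left_quotient {f : ℝ → ℝ} {f' x : ℝ}
    (h : HasDerivWithinAt f f' (Iio x) x) :
    Tendsto (fun θ => (f x - f (x - θ)) / θ) (𝓝[>] 0) (𝓝 f') := by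
  have h1 := (hasDerivWithinAt_iff_tendsto_slope' (self_notMem_Iio (a := x))).1 h
  have h2 : Tendsto (fun θ : ℝ => x - θ) (𝓝[>] 0) (𝓝[<] x) := by
    refine tendsto_nhdsWithin_iff.2 ⟨?_, ?_⟩
    · exact ((by fun_prop : Continuous fun θ : ℝ => x - θ).tendsto' 0 x (by simp)).mono_left
        nhdsWithin_le_nhds
    · filter_upwards [self_mem_nhdsWithin] with θ hθ
      exact sub_lt_self x hθ
  refine (h1.comp h2).congr fun θ => ?_
  simp only [Function.comp_apply, slope_def_field, sub_sub_cancel_left]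
  rw [div_neg, ← neg_div, neg_sub]

namespace ConcaveOn

variable {f : ℝ → ℝ} {l x : ℝ}

theorem hasDerivWithinAt_Ioi (hf : ConcaveOn ℝ (Ici l) f) (hx : l < x) :
    HasDerivWithinAt f (derivWithin f (Ioi x) x) (Ioi x) x := by
  have h := hf.neg.differentiableWithinAt_Ioi_of_mem_interior (x := x) (by simpa using hx)
  have h' := h.neg
  rw [neg_neg] at h'
  exact h'.hasDerivWithinAt

theorem hasDerivWithinAt_Iio (hf : ConcaveOn ℝ (Ici l) f) (hx : l < x) :
    HasDerivWithinAt f (derivWithin f (Iio x) x) (Iio x) x := by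
  have h := hf.neg.differentiableWithinAt_Iio_of_mem_interior (x := x) (by simpa using hx)
  have h' := h.neg
  rw [neg_neg] at h'
  exact h'.hasDerivWithinAt

theorem add_sub_le_rightDeriv_mul (hf : ConcaveOn ℝ (Ici l) f) (hx : l < x) {d : ℝ}
    (hd : 0 ≤ d) : f (x + d) - f x ≤ derivWithin f (Ioi x) x * d := by
  rcases hd.eq_or_lt with rfl | hd
  · simp
  have h := hf.slope_le_of_hasDerivWithinAt_Ioi (x := x) (y := x + d) (show l ≤ x from hx.le)
    (show l ≤ x + d by linarith) (by linarith) (hf.hasDerivWithinAt_Ioi hx)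
  rw [slope_def_field, add_sub_cancel_left, div_le_iff₀ hd] at h
  exact h

theorem leftDeriv_mul_le_sub (hf : ConcaveOn ℝ (Ici l) f) (hx : l < x) {d : ℝ}
    (hd : 0 ≤ d) (hdx : l ≤ x - d) : derivWithin f (Iio x) x * d ≤ f x - f (x - d) := by
  rcases hd.eq_or_lt with rfl | hd
  · simp
  have h := hf.le_slope_of_hasDerivWithinAt_Iio (x := x - d) (y := x) hdx
    (show l ≤ x from hx.le) (by linarith) (hf.hasDerivWithinAt_Iio hx)
  rw [slope_def_field, sub_sub_cancel, le_div_iff₀ hd] at h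
  exact h

theorem rightDeriv_le_leftDeriv (hf : ConcaveOn ℝ (Ici l) f) (hx : l < x) :
    derivWithin f (Ioi x) x ≤ derivWithin f (Iio x) x := by
  have h := hf.neg.leftDeriv_le_rightDeriv_of_mem_interior (x := x) (by simpa using hx)
  rw [derivWithin.neg, derivWithin.neg] at h
  linarith

theorem hasDerivAt_of_leftDeriv_le (hf : ConcaveOn ℝ (Ici l) f) (hx : l < x)
    (h : derivWithin f (Iio x) x ≤ derivWithin f (Ioi x) x) :
    HasDerivAt f (derivWithin f (Ioi x) x) x := by
  have h1 := hf.hasDerivWithinAt_Iio hx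
  rw [h.antisymm (hf.rightDeriv_le_leftDeriv hx), hasDerivWithinAt_Iio_iff_Iic] at h1
  have h2 := (hf.hasDerivWithinAt_Ioi hx).Ici_of_Ioi
  have h3 := h1.union h2
  rwa [Iic_union_Ici, hasDerivWithinAt_univ] at h3

end ConcaveOn

/-- A property that holds almost everywhere holds arbitrarily close to the right of any point. -/
theorem frequently_nhdsGT_of_ae {p : ℝ → Prop} {t s : ℝ} (hs : t ≤ s)
    (h : ∀ᵐ r ∂(volume.restrict (Ioi t)), p r) : ∃ᶠ r in 𝓝[>] s, p r := by
  intro hcon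
  obtain ⟨u, hu, hsub⟩ := mem_nhdsGT_iff_exists_Ioo_subset.1 hcon
  have h1 : volume (Ioo s u) = 0 := by
    rw [ae_restrict_iff' measurableSet_Ioi] at h
    refine measure_mono_null (fun r hr => ?_) h
    intro hp
    exact hsub hr (hp (hs.trans_lt hr.1))
  rw [Real.volume_Ioo, ENNReal.ofReal_eq_zero] at h1
  have : s < u := hu
  linarith

namespace IlliquidMarket

variable {Ω : Type*} [MeasurableSpace Ω] {M : IlliquidMarket Ω} {P : Measure Ω} {k b : ℝ}

/-! ### Marginal utility -/

theorem UtilityAssumption.strictAntiOn_deriv (hU : M.UtilityAssumption k b) :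
    StrictAntiOn (deriv M.U) (Ioi 0) :=
  (hU.strictConcave.subset Ioi_subset_Ici_self (convex_Ioi 0)).strictAntiOn_deriv
    fun _ hy => hU.differentiableAt hy

theorem UtilityAssumption.deriv_pos (hU : M.UtilityAssumption k b) {y : ℝ} (hy : 0 < y) :
    0 < deriv M.U y := by
  have hy1 : (0 : ℝ) < y + 1 := by linarith
  have h1 : 0 ≤ deriv M.U (y + 1) := by
    refine le_of_tendsto hU.inada_top ?_
    filter_upwards [eventually_ge_atTop (y + 1)] with z hz
    exact hU.strictAntiOn_deriv.antitoneOn hy1 (hy1.trans_le hz) hz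
  exact h1.trans_lt (hU.strictAntiOn_deriv hy hy1 (by linarith))

theorem UtilityAssumption.exists_deriv_eq (hU : M.UtilityAssumption k b) {q : ℝ} (hq : 0 < q) :
    ∃ y, 0 < y ∧ deriv M.U y = q := by
  obtain ⟨y₁, h1, h1'⟩ := ((hU.inada_zero.eventually_gt_atTop q).and self_mem_nhdsWithin).exists
  obtain ⟨y₂, h2, h2'⟩ := ((hU.inada_top.eventually_lt_const hq).and
    (eventually_gt_atTop (0 : ℝ))).exists
  have hc : ContinuousOn (deriv M.U) (Ioi 0) :=
    hU.contDiff.continuousOn_deriv_of_isOpen isOpen_Ioi le_rfl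
  have hsub : uIcc y₁ y₂ ⊆ Ioi 0 := ordConnected_Ioi.uIcc_subset h1' h2'
  obtain ⟨y, hy, hyq⟩ := intermediate_value_uIcc (hc.mono hsub)
    (show q ∈ uIcc (deriv M.U y₁) (deriv M.U y₂) from mem_uIcc.2 (Or.inr ⟨h2.le, h1.le⟩))
  exact ⟨y, hsub hy, hyq⟩

/-- Marginal utility has a continuous inverse. -/
theorem UtilityAssumption.exists_inverse_deriv (hU : M.UtilityAssumption k b) :
    ∃ I : ℝ → ℝ, (∀ q, 0 < q → 0 < I q ∧ deriv M.U (I q) = q) ∧ ContinuousOn I (Ioi 0) := by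
  have hex : ∀ q : ℝ, ∃ y, 0 < q → 0 < y ∧ deriv M.U y = q := by
    intro q
    by_cases hq : 0 < q
    · obtain ⟨y, hy⟩ := hU.exists_deriv_eq hq
      exact ⟨y, fun _ => hy⟩
    · exact ⟨0, fun h => absurd h hq⟩
  choose I hI using hex
  refine ⟨I, hI, fun q hq => ContinuousAt.continuousWithinAt ?_⟩
  have hq0 : (0 : ℝ) < q := hq
  obtain ⟨h1, h2⟩ := hI q hq0
  have hanti := hU.strictAntiOn_deriv
  rw [ContinuousAt, tendsto_order]
  refine ⟨fun y hy => ?_, fun y hy => ?_⟩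
  · rcases le_or_gt y 0 with hy0 | hy0
    · filter_upwards [Ioi_mem_nhds hq0] with r hr
      exact hy0.trans_lt (hI r hr).1
    · have h3 : q < deriv M.U y := by
        rw [← h2]
        exact hanti hy0 h1 hy
      filter_upwards [Ioi_mem_nhds hq0, Iio_mem_nhds h3] with r hr hr'
      obtain ⟨h4, h5⟩ := hI r hr
      refine (hanti.lt_iff_gt h4 hy0).1 ?_
      rw [h5]
      exact hr'
  · have hy0 : 0 < y := h1.trans hy
    have h3 : deriv M.U y < q := by
      rw [← h2]
      exact hanti h1 hy0 hy
    filter_upwards [Ioi_mem_nhds hq0, Ioi_mem_nhds h3] with r hr hr'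
    obtain ⟨h4, h5⟩ := hI r hr
    refine (hanti.lt_iff_gt hy0 h4).1 ?_
    rw [h5]
    exact hr'

/-! ### Marginal values along an optimal path -/

/-- The right derivative of the discounted value with respect to wealth. -/
noncomputable def rightMarginal (M : IlliquidMarket Ω) (P : Measure Ω) (a s y : ℝ) : ℝ :=
  derivWithin (M.presentValue P a s) (Ioi y) y

/-- The left derivative of the discounted value with respect to wealth. -/
noncomputable def leftMarginal (M : IlliquidMarket Ω) (P : Measure Ω) (a s y : ℝ) : ℝ :=
  derivWithin (M.presentValue P a s) (Iio y) y

theorem rewardIntegral_mono {a x x' t s : ℝ} (hA : M.AuxRegular P a) (ht : 0 ≤ t)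
    (hx : M.l a ≤ x) (hxx : x ≤ x') :
    M.rewardIntegral P a x t s ≤ M.rewardIntegral P a x' t s :=
  setIntegral_mono_on (integrableOn_rewardIntegral hA ht hx)
    (integrableOn_rewardIntegral hA ht (hx.trans hxx)) measurableSet_Ioc fun _ hr =>
    mul_le_mul_of_nonneg_left (toReal_g_mono hA (ht.trans_lt hr.1) hx hxx) (Real.exp_pos _).le

theorem rewardIntegral_add {a x t s r : ℝ} (hA : M.AuxRegular P a) (ht : 0 ≤ t)
    (hx : M.l a ≤ x) (hts : t ≤ s) (hsr : s ≤ r) :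
    M.rewardIntegral P a x t s + M.rewardIntegral P a x s r = M.rewardIntegral P a x t r := by
  unfold rewardIntegral
  rw [← setIntegral_union (Ioc_disjoint_Ioc_of_le le_rfl) measurableSet_Ioc
    (integrableOn_rewardIntegral hA ht hx) (integrableOn_rewardIntegral hA (ht.trans hts) hx),
    Ioc_union_Ioc_eq_Ioc hts hsr]

theorem continuousOn_rewardIntegral {a x t T : ℝ} (hA : M.AuxRegular P a) (ht : 0 ≤ t)
    (hx : M.l a ≤ x) : ContinuousOn (M.rewardIntegral P a x t) (Icc t T) :=
  intervalIntegral.continuousOn_primitive (by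
    rw [integrableOn_Icc_iff_integrableOn_Ioc]
    exact integrableOn_rewardIntegral hA ht hx)

theorem tendsto_rewardIntegral {a x t : ℝ} (hA : M.AuxRegular P a) (ht : 0 ≤ t)
    (hx : M.l a ≤ x) : Tendsto (M.rewardIntegral P a x t) (𝓝[>] t) (𝓝 0) := by
  have h := continuousOn_rewardIntegral (T := t + 1) hA ht hx t ⟨le_rfl, by linarith⟩
  have h0 : M.rewardIntegral P a x t t = 0 := by simp [rewardIntegral]
  rw [ContinuousWithinAt, h0] at h
  refine h.mono_left (nhdsWithin_le_iff.2 ?_)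
  exact mem_of_superset (Ioo_mem_nhdsGT (by linarith : t < t + 1)) Ioo_subset_Icc_self

namespace IsAuxOptimal

variable {t s x a : ℝ} {c : ℝ → ℝ}

theorem auxWealth_auxWealth {r : ℝ} (h : M.IsAuxOptimal P t x a c) (hts : t ≤ s) (hsr : s ≤ r) :
    auxWealth s (auxWealth t x c s) c r = auxWealth t x c r :=
  (auxWealth_trans hts hsr (h.1.integrable r (hts.trans hsr)))

theorem rightMarginal_le_start (hU : M.UtilityAssumption k b) (hA : M.AuxRegular P a)
    (ht : 0 ≤ t) (hs : t ≤ s) (h : M.IsAuxOptimal P t x a c) (hx : M.l a < x) :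
    M.rightMarginal P a s (auxWealth t x c s) ≤ M.rightMarginal P a t x := by
  have h1 := ((concaveOn_presentValue (P := P) hU hA (ht.trans hs)).hasDerivWithinAt_Ioi
    (h.lt_auxWealth hU hA ht hs hx)).tendsto_right_quotient
  have h2 := ((concaveOn_presentValue (P := P) hU hA ht).hasDerivWithinAt_Ioi
    hx).tendsto_right_quotient
  refine le_of_tendsto_of_tendsto h1 h2 ?_
  filter_upwards [self_mem_nhdsWithin] with θ hθ
  have hθ0 : (0 : ℝ) < θ := hθ
  exact div_le_div_of_nonneg_right (h.presentValue_add_sub_le hU hA ht hs hθ0.le) hθ0.le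

/-- Difference quotients of the comparison in which `θ` less is carried along. The strict margin
leaves room for small `θ`, and the loss of reward has rate `1 / η`. -/
theorem leftMarginal_start_le (hU : M.UtilityAssumption k b) (hA : M.AuxRegular P a)
    (ht : 0 ≤ t) (hs : t ≤ s) {η : ℝ} (hη : 0 < η) (h : M.IsAuxOptimal P t x a c)
    (hl : M.l a + η < auxWealth t x c s) :
    M.leftMarginal P a t x ≤ M.leftMarginal P a s (auxWealth t x c s) +
      M.rewardIntegral P a x t s / η := by
  have hx : M.l a < x := by linarith [h.1.le_start (s := s)]
  have h1 := ((concaveOn_presentValue (P := P) hU hA (ht.trans hs)).hasDerivWithinAt_Iio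
    (show M.l a < auxWealth t x c s by linarith)).tendsto_left_quotient
  have h2 := ((concaveOn_presentValue (P := P) hU hA ht).hasDerivWithinAt_Iio
    hx).tendsto_left_quotient
  refine le_of_tendsto_of_tendsto h2 (h1.add_const _) ?_
  have hsmall : ∀ᶠ θ : ℝ in 𝓝[>] 0, θ < auxWealth t x c s - (M.l a + η) :=
    nhdsWithin_le_nhds (Iio_mem_nhds (by linarith))
  filter_upwards [self_mem_nhdsWithin, hsmall] with θ hθ hθ'
  have hθ0 : (0 : ℝ) < θ := hθ
  have h3 := h.presentValue_sub_sub_le hU hA ht hs hθ0.le hη (by linarith)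
  rw [div_le_iff₀ hθ0, add_mul, div_mul_cancel₀ _ hθ0.ne']
  refine h3.trans (le_of_eq ?_)
  ring

theorem rightMarginal_anti (hU : M.UtilityAssumption k b) (hA : M.AuxRegular P a)
    (ht : 0 ≤ t) {r : ℝ} (hs : t ≤ s) (hsr : s ≤ r) (h : M.IsAuxOptimal P t x a c)
    (hx : M.l a < x) :
    M.rightMarginal P a r (auxWealth t x c r) ≤ M.rightMarginal P a s (auxWealth t x c s) := by
  have h1 := (h.restrict hU hA ht hs).rightMarginal_le_start hU hA (ht.trans hs) hsr
    (h.lt_auxWealth hU hA ht hs hx)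
  rwa [h.auxWealth_auxWealth hs hsr] at h1

/-- Wealth is nonincreasing, so the margin at the horizon `T` serves at all earlier times; half of
it makes the required inequality strict. The error constant is thus uniform on `[t, T]`. -/
theorem leftMarginal_le_add (hU : M.UtilityAssumption k b) (hA : M.AuxRegular P a)
    (ht : 0 ≤ t) {r T : ℝ} (hs : t ≤ s) (hsr : s ≤ r) (hrT : r ≤ T)
    (h : M.IsAuxOptimal P t x a c) (hx : M.l a < x) :
    M.leftMarginal P a s (auxWealth t x c s) ≤ M.leftMarginal P a r (auxWealth t x c r) +
      M.rewardIntegral P a x s r / ((auxWealth t x c T - M.l a) / 2) := by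
  have hT := h.lt_auxWealth hU hA ht (hs.trans (hsr.trans hrT)) hx
  have hη : 0 < (auxWealth t x c T - M.l a) / 2 := by linarith
  have h0 := h.1.auxWealth_anti (hs.trans hsr) hrT
  have h1 := (h.restrict hU hA ht hs).leftMarginal_start_le hU hA (ht.trans hs) hsr hη
    (by rw [h.auxWealth_auxWealth hs hsr]; linarith)
  rw [h.auxWealth_auxWealth hs hsr] at h1
  refine h1.trans (add_le_add le_rfl (div_le_div_of_nonneg_right ?_ hη.le))
  exact rewardIntegral_mono hA (ht.trans hs) (h.1.le_wealth s hs) h.1.le_start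

end IsAuxOptimal

end IlliquidMarket

/-! ### First-order conditions and differentiability along the optimal path -/

namespace IlliquidMarket

variable {Ω : Type*} [MeasurableSpace Ω] {M : IlliquidMarket Ω} {P : Measure Ω} {k b : ℝ}

namespace IsAuxOptimal

variable {t s x a : ℝ} {c : ℝ → ℝ}

/-- Consuming a little more is not profitable. -/
theorem ae_utility_add_sub_le (hU : M.UtilityAssumption k b) (hA : M.AuxRegular P a)
    (ht : 0 ≤ t) {θ : ℝ} (hθ : 0 ≤ θ) (h : M.IsAuxOptimal P t x a c) (hx : M.l a < x) :
    ∀ᵐ s ∂(volume.restrict (Ioi t)),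
      Real.exp (-(M.rho + M.lam) * s) * (M.U (c s + θ) - M.U (c s)) ≤
        M.rightMarginal P a s (auxWealth t x c s) * θ := by
  have f1 : ∀ s, t ≤ s → IntegrableOn
      (fun r => Real.exp (-(M.rho + M.lam) * r) * M.U (c r + θ)) (Ioc t s) := fun s hs =>
    integrableOn_discounted_utility hU hA.rate_pos ht (h.1.measurable.add_const θ)
      (fun r hr => add_nonneg (h.1.nonneg r hr.1.le) hθ)
      ((h.1.integrable s hs).add (integrableOn_const (by simp)))
  have f2 : ∀ s, t ≤ s → IntegrableOn
      (fun r => Real.exp (-(M.rho + M.lam) * r) * M.U (c r)) (Ioc t s) := fun s hs =>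
    integrableOn_discounted_utility hU hA.rate_pos ht h.1.measurable
      (fun r hr => h.1.nonneg r hr.1.le) (h.1.integrable s hs)
  filter_upwards [ae_tendsto_right_average f1, ae_tendsto_right_average f2,
    ae_restrict_mem measurableSet_Ioi] with s h1 h2 hts
  have hs : t ≤ s := le_of_lt hts
  have h3 := h1.sub h2
  rw [← mul_sub] at h3
  refine le_of_tendsto h3 (Eventually.of_forall fun n => ?_)
  have hn : (0 : ℝ) < 1 / ((n : ℝ) + 1) := by positivity
  rw [← sub_div, div_le_iff₀ hn]
  -- Consume `θ` more on an interval of length `1 / (n + 1)`. The gain is bounded by the right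
  -- derivative times the capital spent, and dividing by the length leaves averages that converge at
  -- Lebesgue points.
  have h4 := (h.restrict hU hA ht hs).le_presentValue_add hU hA (ht.trans hs)
    (s := s + 1 / ((n : ℝ) + 1)) (by linarith) hθ
  rw [add_sub_cancel_left] at h4
  have h5 := (concaveOn_presentValue (P := P) hU hA (ht.trans hs)).add_sub_le_rightDeriv_mul
    (h.lt_auxWealth hU hA ht hs hx) (mul_nonneg hθ hn.le)
  rw [mul_assoc]
  exact h4.trans h5

/-- Consuming a little less is not profitable. -/
theorem ae_mul_le_utility_sub (hU : M.UtilityAssumption k b) (hA : M.AuxRegular P a)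
    (ht : 0 ≤ t) {θ : ℝ} (hθ : 0 ≤ θ) (hθ' : θ ≤ 1) (h : M.IsAuxOptimal P t x a c)
    (hx : M.l a < x) :
    ∀ᵐ s ∂(volume.restrict (Ioi t)),
      M.leftMarginal P a s (auxWealth t x c s) * (θ * c s) ≤
        Real.exp (-(M.rho + M.lam) * s) * (M.U (c s) - M.U ((1 - θ) * c s)) := by
  have f1 : ∀ s, t ≤ s → IntegrableOn
      (fun r => Real.exp (-(M.rho + M.lam) * r) * M.U ((1 - θ) * c r)) (Ioc t s) := fun s hs =>
    integrableOn_discounted_utility hU hA.rate_pos ht (h.1.measurable.const_mul _)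
      (fun r hr => mul_nonneg (by linarith) (h.1.nonneg r hr.1.le))
      ((h.1.integrable s hs).const_mul _)
  have f2 : ∀ s, t ≤ s → IntegrableOn
      (fun r => Real.exp (-(M.rho + M.lam) * r) * M.U (c r)) (Ioc t s) := fun s hs =>
    integrableOn_discounted_utility hU hA.rate_pos ht h.1.measurable
      (fun r hr => h.1.nonneg r hr.1.le) (h.1.integrable s hs)
  filter_upwards [ae_tendsto_right_average f1, ae_tendsto_right_average f2,
    ae_tendsto_right_average h.1.integrable,
    ae_restrict_mem measurableSet_Ioi] with s h1 h2 h3 hts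
  have hs : t ≤ s := le_of_lt hts
  have hs0 : 0 ≤ s := ht.trans hs
  have hopt := h.restrict hU hA ht hs
  have hlY := h.lt_auxWealth hU hA ht hs hx
  have hl1 := h.lt_auxWealth hU hA ht (show t ≤ s + 1 by linarith) hx
  set η := auxWealth t x c (s + 1) - M.l a with hη
  have hη0 : 0 < η := by linarith
  have hseq : Tendsto (fun n : ℕ => s + 1 / ((n : ℝ) + 1)) atTop (𝓝[>] s) := by
    refine tendsto_nhdsWithin_iff.2 ⟨?_, Eventually.of_forall fun n => ?_⟩
    · simpa using (tendsto_const_nhds (x := s)).add tendsto_one_div_add_atTop_nhds_zero_nat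
    · have : (0 : ℝ) < 1 / ((n : ℝ) + 1) := by positivity
      exact lt_add_of_pos_right s this
  -- The loss of reward is of lower order: it is the consumption on the interval times a reward
  -- integral that vanishes with the interval. The margin `η`, taken at time `s + 1`, does not
  -- depend on `n`.
  have hR := (tendsto_rewardIntegral hA hs0 hlY.le).comp hseq
  have h4 := (h2.sub h1).add (((h3.const_mul θ).div_const η).mul hR)
  rw [mul_zero, add_zero, ← mul_sub] at h4
  have h5 := (h3.const_mul θ).const_mul (M.leftMarginal P a s (auxWealth t x c s))
  refine le_of_tendsto_of_tendsto' h5 h4 fun n => ?_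
  have hn : (0 : ℝ) < 1 / ((n : ℝ) + 1) := by positivity
  have hn1 : 1 / ((n : ℝ) + 1) ≤ 1 := by
    rw [div_le_one (by positivity)]
    linarith [(Nat.cast_nonneg n : (0 : ℝ) ≤ n)]
  set r := s + 1 / ((n : ℝ) + 1) with hr
  have hsr : s ≤ r := by linarith
  have hYr : auxWealth t x c (s + 1) ≤ auxWealth t x c r :=
    h.1.auxWealth_anti (hs.trans hsr) (by linarith)
  have h6 := hopt.presentValue_sub_le hU hA hs0 hsr hθ hθ' hη0
    (by rw [h.auxWealth_auxWealth hs hsr]; linarith)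
  have hC := h.1.auxWealth_sub hs hsr
  have hC0 : 0 ≤ ∫ u in Ioc s r, c u :=
    setIntegral_nonneg measurableSet_Ioc fun u hu => h.1.nonneg u (hs.trans hu.1.le)
  have hC1 : θ * ∫ u in Ioc s r, c u ≤ ∫ u in Ioc s r, c u := mul_le_of_le_one_left hC0 hθ'
  have h7 := (concaveOn_presentValue (P := P) hU hA hs0).leftDeriv_mul_le_sub hlY
    (mul_nonneg hθ hC0) (by linarith)
  have h8 := h7.trans h6
  rw [← sub_nonneg] at h8 ⊢
  refine (div_nonneg h8 hn.le).trans (le_of_eq ?_)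
  simp only [leftMarginal, Function.comp_apply, ← hr]
  field_simp

/-- Almost everywhere, marginal utility agrees with the marginal value of wealth. -/
theorem ae_marginal_eq (hU : M.UtilityAssumption k b) (hA : M.AuxRegular P a)
    (ht : 0 ≤ t) (h : M.IsAuxOptimal P t x a c) (hx : M.l a < x) :
    ∀ᵐ s ∂(volume.restrict (Ioi t)), 0 < c s ∧
      M.leftMarginal P a s (auxWealth t x c s) ≤ M.rightMarginal P a s (auxWealth t x c s) ∧
      M.rightMarginal P a s (auxWealth t x c s) =
        Real.exp (-(M.rho + M.lam) * s) * deriv M.U (c s) := by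
  -- Restricting `θ` to a sequence keeps a single exceptional null set.
  have e1 := ae_all_iff.2 fun n : ℕ => h.ae_utility_add_sub_le hU hA ht
    (θ := 1 / ((n : ℝ) + 1)) (by positivity) hx
  have e2 := ae_all_iff.2 fun n : ℕ => h.ae_mul_le_utility_sub hU hA ht
    (θ := 1 / ((n : ℝ) + 1)) (by positivity) (by
      rw [div_le_one (by positivity)]
      linarith [(Nat.cast_nonneg n : (0 : ℝ) ≤ n)]) hx
  have hseq : Tendsto (fun n : ℕ => 1 / ((n : ℝ) + 1)) atTop (𝓝[>] 0) :=
    tendsto_nhdsWithin_iff.2 ⟨tendsto_one_div_add_atTop_nhds_zero_nat,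
      Eventually.of_forall fun n => by
        have : (0 : ℝ) < 1 / ((n : ℝ) + 1) := by positivity
        exact this⟩
  filter_upwards [e1, e2, ae_restrict_mem measurableSet_Ioi] with s h1 h2 hts
  have hs : t ≤ s := le_of_lt hts
  have hw := Real.exp_pos (-(M.rho + M.lam) * s)
  set W := Real.exp (-(M.rho + M.lam) * s)
  have hc : 0 < c s := by
    -- At a vanishing rate the first inequality would bound `U(θ)` by a multiple of `θ`, against
    -- infinite marginal utility.
    refine (h.1.nonneg s hs).lt_of_ne' fun hc => ?_
    obtain ⟨n, hn⟩ := (hseq.eventually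
      (hU.eventually_mul_lt (M.rightMarginal P a s (auxWealth t x c s) / W))).exists
    have h3 := h1 n
    rw [hc, zero_add, hU.zero, sub_zero] at h3
    rw [div_mul_eq_mul_div, div_lt_iff₀ hw] at hn
    linarith
  have hd := (hU.differentiableAt hc).hasDerivAt
  have hright : W * deriv M.U (c s) ≤ M.rightMarginal P a s (auxWealth t x c s) := by
    have h3 := ((hd.hasDerivWithinAt.tendsto_right_quotient.comp hseq).const_mul W)
    refine le_of_tendsto h3 (Eventually.of_forall fun n => ?_)
    have hn : (0 : ℝ) < 1 / ((n : ℝ) + 1) := by positivity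
    simp only [Function.comp_apply]
    rw [← mul_div_assoc, div_le_iff₀ hn]
    exact h1 n
  have hleft : M.leftMarginal P a s (auxWealth t x c s) ≤ W * deriv M.U (c s) := by
    have hseq' : Tendsto (fun n : ℕ => 1 / ((n : ℝ) + 1) * c s) atTop (𝓝[>] 0) := by
      refine tendsto_nhdsWithin_iff.2 ⟨?_, Eventually.of_forall fun n => ?_⟩
      · simpa using tendsto_one_div_add_atTop_nhds_zero_nat.mul_const (c s)
      · have : (0 : ℝ) < 1 / ((n : ℝ) + 1) * c s := by positivity
        exact this
    have h3 := ((hd.hasDerivWithinAt.tendsto_left_quotient.comp hseq').const_mul W)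
    refine ge_of_tendsto h3 (Eventually.of_forall fun n => ?_)
    have hn : (0 : ℝ) < 1 / ((n : ℝ) + 1) * c s := by positivity
    simp only [Function.comp_apply]
    rw [← mul_div_assoc, le_div_iff₀ hn]
    have h4 := h2 n
    rw [sub_mul, one_mul] at h4
    exact h4
  have hlr := (concaveOn_presentValue (P := P) hU hA (ht.trans hs)).rightDeriv_le_leftDeriv
    (h.lt_auxWealth hU hA ht hs hx)
  change M.rightMarginal P a s (auxWealth t x c s) ≤
    M.leftMarginal P a s (auxWealth t x c s) at hlr
  exact ⟨hc, hleft.trans hright, (hlr.trans hleft).antisymm hright⟩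

/-- The discounted value is differentiable along the optimal path. -/
theorem leftMarginal_le_rightMarginal (hU : M.UtilityAssumption k b) (hA : M.AuxRegular P a)
    (ht : 0 ≤ t) (hs : t ≤ s) (h : M.IsAuxOptimal P t x a c) (hx : M.l a < x) :
    M.leftMarginal P a s (auxWealth t x c s) ≤ M.rightMarginal P a s (auxWealth t x c s) := by
  have hR := ((tendsto_rewardIntegral hA (ht.trans hs) h.le).div_const
    ((auxWealth t x c (s + 1) - M.l a) / 2)).const_add
      (M.rightMarginal P a s (auxWealth t x c s))
  rw [zero_div, add_zero] at hR
  -- The inequality holds at almost every `r > s`. From `s` to `r` the left marginal drops by at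
  -- most a vanishing reward integral, and back from `r` to `s` the right marginal does not
  -- decrease.
  refine ge_of_tendsto_of_frequently hR ?_
  refine ((frequently_nhdsGT_of_ae hs (h.ae_marginal_eq hU hA ht hx)).and_eventually
    (Ioo_mem_nhdsGT (by linarith : s < s + 1))).mono ?_
  rintro r ⟨⟨-, h1, -⟩, hr⟩
  have h2 := h.leftMarginal_le_add hU hA ht hs hr.1.le hr.2.le hx
  have h3 := h.rightMarginal_anti hU hA ht hs hr.1.le hx
  linarith

/-- At almost every later time the marginal value is a discounted, hence positive, marginal utility,
and it does not exceed the marginal value at `s`. -/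
theorem rightMarginal_pos (hU : M.UtilityAssumption k b) (hA : M.AuxRegular P a)
    (ht : 0 ≤ t) (hs : t ≤ s) (h : M.IsAuxOptimal P t x a c) (hx : M.l a < x) :
    0 < M.rightMarginal P a s (auxWealth t x c s) := by
  obtain ⟨r, ⟨h1, -, h2⟩, hr⟩ := ((frequently_nhdsGT_of_ae hs
    (h.ae_marginal_eq hU hA ht hx)).and_eventually self_mem_nhdsWithin).exists
  have hsr : s ≤ r := le_of_lt hr
  refine lt_of_lt_of_le ?_ (h.rightMarginal_anti hU hA ht hs hsr hx)
  rw [h2]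
  exact mul_pos (Real.exp_pos _) (hU.deriv_pos h1)

/-- The marginal value is nonincreasing along the path. As the two one-sided marginals agree, its
decrease is bounded by the increment of a reward integral, which is continuous in time. -/
theorem continuousOn_rightMarginal (hU : M.UtilityAssumption k b) (hA : M.AuxRegular P a)
    (ht : 0 ≤ t) (h : M.IsAuxOptimal P t x a c) (hx : M.l a < x) :
    ContinuousOn (fun s => M.rightMarginal P a s (auxWealth t x c s)) (Ici t) := by
  intro s hs
  have hs' : t ≤ s := hs
  set η := (auxWealth t x c (s + 1) - M.l a) / 2
  have hη : 0 < η := by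
    have := h.lt_auxWealth hU hA ht (show t ≤ s + 1 by linarith) hx
    simp only [η]
    linarith
  have key : ∀ u r, t ≤ u → u ≤ r → r ≤ s + 1 →
      M.rightMarginal P a u (auxWealth t x c u) ≤ M.rightMarginal P a r (auxWealth t x c r) +
        (M.rewardIntegral P a x t r - M.rewardIntegral P a x t u) / η := by
    intro u r hu hur hr
    have h1 := h.leftMarginal_le_add hU hA ht hu hur hr hx
    have h2 := h.leftMarginal_le_rightMarginal hU hA ht (hu.trans hur) hx
    have h3 := (concaveOn_presentValue (P := P) hU hA (ht.trans hu)).rightDeriv_le_leftDeriv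
      (h.lt_auxWealth hU hA ht hu hx)
    have h4 := rewardIntegral_add hA ht h.le hu hur
    rw [← h4, add_sub_cancel_left]
    exact h3.trans (h1.trans (add_le_add h2 le_rfl))
  have hc := continuousOn_rewardIntegral (T := s + 1) hA ht h.le s ⟨hs, by linarith⟩
  have hmem : Icc t (s + 1) ∈ 𝓝[Ici t] s := by
    rw [← Ici_inter_Iic]
    exact inter_mem_nhdsWithin _ (Iic_mem_nhds (by linarith))
  have hc' : Tendsto (fun r => |M.rewardIntegral P a x t r - M.rewardIntegral P a x t s| / η)
      (𝓝[Ici t] s) (𝓝 0) := by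
    have h1 : Tendsto (M.rewardIntegral P a x t) (𝓝[Ici t] s)
        (𝓝 (M.rewardIntegral P a x t s)) :=
      hc.mono_left (nhdsWithin_le_iff.2 hmem)
    have h2 := ((h1.sub_const (M.rewardIntegral P a x t s)).abs).div_const η
    simpa using h2
  rw [ContinuousWithinAt, tendsto_iff_dist_tendsto_zero]
  refine squeeze_zero' (Eventually.of_forall fun r => dist_nonneg) ?_ hc'
  filter_upwards [hmem] with r hr
  rw [Real.dist_eq, abs_le]
  rcases le_total r s with hrs | hsr
  · have h1 := key r s hr.1 hrs (by linarith)
    have h2 := h.rightMarginal_anti hU hA ht hr.1 hrs hx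
    have h3 : (M.rewardIntegral P a x t s - M.rewardIntegral P a x t r) / η ≤
        |M.rewardIntegral P a x t r - M.rewardIntegral P a x t s| / η := by
      rw [abs_sub_comm]
      exact div_le_div_of_nonneg_right (le_abs_self _) hη.le
    have h4 : 0 ≤ |M.rewardIntegral P a x t r - M.rewardIntegral P a x t s| / η := by positivity
    constructor <;> linarith
  · have h1 := key s r hs hsr hr.2
    have h2 := h.rightMarginal_anti hU hA ht hs hsr hx
    have h3 : (M.rewardIntegral P a x t r - M.rewardIntegral P a x t s) / η ≤
        |M.rewardIntegral P a x t r - M.rewardIntegral P a x t s| / η :=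
      div_le_div_of_nonneg_right (le_abs_self _) hη.le
    have h4 : 0 ≤ |M.rewardIntegral P a x t r - M.rewardIntegral P a x t s| / η := by positivity
    constructor <;> linarith

theorem hasDerivAt_auxValue (hU : M.UtilityAssumption k b) (hA : M.AuxRegular P a)
    (ht : 0 ≤ t) (hs : t ≤ s) (h : M.IsAuxOptimal P t x a c) (hx : M.l a < x) :
    HasDerivAt (fun y => (M.auxValue P s y a).toReal)
      (Real.exp ((M.rho + M.lam) * s) * M.rightMarginal P a s (auxWealth t x c s))
      (auxWealth t x c s) := by
  have h1 := ((concaveOn_presentValue (P := P) hU hA (ht.trans hs)).hasDerivAt_of_leftDeriv_le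
    (h.lt_auxWealth hU hA ht hs hx) (h.leftMarginal_le_rightMarginal hU hA ht hs hx)).const_mul
    (Real.exp ((M.rho + M.lam) * s))
  refine h1.congr_of_eventuallyEq (Eventually.of_forall fun y => ?_)
  simp only [presentValue]
  rw [← mul_assoc, ← Real.exp_add, show (M.rho + M.lam) * s + -(M.rho + M.lam) * s = 0 by ring,
    Real.exp_zero, one_mul]

end IsAuxOptimal

/-! ### Feedback form and long-run behaviour of the optimal rate -/

theorem auxWealth_congr {t s x : ℝ} {c c' : ℝ → ℝ}
    (hcc : ∀ᵐ r ∂(volume.restrict (Ioi t)), c r = c' r) :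
    auxWealth t x c s = auxWealth t x c' s := by
  unfold auxWealth
  rw [integral_congr_ae (ae_restrict_of_ae_restrict_of_subset Ioc_subset_Ioi_self hcc)]

/-- Optimality does not depend on null sets. -/
theorem IsAuxOptimal.congr {t x a : ℝ} {c c' : ℝ → ℝ} (h : M.IsAuxOptimal P t x a c)
    (hm : Measurable c') (h0 : ∀ s, t ≤ s → 0 ≤ c' s)
    (hcc : ∀ᵐ r ∂(volume.restrict (Ioi t)), c r = c' r) : M.IsAuxOptimal P t x a c' := by
  refine ⟨⟨hm, h0, fun s hs => ?_, fun s hs => ?_⟩, ?_⟩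
  · exact (h.1.integrable s hs).congr
      (ae_restrict_of_ae_restrict_of_subset Ioc_subset_Ioi_self hcc)
  · rw [← auxWealth_congr hcc]
    exact h.1.le_wealth s hs
  · rw [← h.2, auxPayoff, auxPayoff]
    refine lintegral_congr_ae ?_
    filter_upwards [hcc] with s hs
    rw [hs, auxWealth_congr hcc]

/-- The increments of an admissible wealth path over unit intervals vanish at infinity. -/
theorem IsAuxAdmissible.tendsto_auxWealth_sub {t x a : ℝ} {c : ℝ → ℝ}
    (h : M.IsAuxAdmissible t x a c) :
    Tendsto (fun s => auxWealth t x c s - auxWealth t x c (s + 1)) atTop (𝓝 0) := by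
  have hanti : Antitone fun s => auxWealth t x c (max t s) := fun s s' hs =>
    h.auxWealth_anti (le_max_left _ _) (max_le_max le_rfl hs)
  have hbdd : BddBelow (range fun s => auxWealth t x c (max t s)) := by
    refine ⟨M.l a, ?_⟩
    rintro _ ⟨s, rfl⟩
    exact h.le_wealth _ (le_max_left _ _)
  have h1 := tendsto_atTop_ciInf hanti hbdd
  have h2 := h1.comp (tendsto_atTop_add_const_right atTop (1 : ℝ) tendsto_id)
  have h3 := h1.sub h2
  rw [sub_self] at h3
  refine h3.congr' ?_
  filter_upwards [eventually_ge_atTop t] with s hs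
  simp only [Function.comp_apply, id]
  rw [max_eq_right hs, max_eq_right (by linarith)]

/-- The optimal rate in feedback form. -/
theorem exists_isAuxOptimal_feedback (hU : M.UtilityAssumption k b) {t x a : ℝ}
    (hA : M.AuxRegular P a) (ht : 0 ≤ t) (hx : M.l a < x) :
    ∃ c : ℝ → ℝ, M.IsAuxOptimal P t x a c ∧ Continuous c ∧
      (∀ s, t ≤ s → 0 < c s ∧
        deriv M.U (c s) = Real.exp ((M.rho + M.lam) * s) *
          M.rightMarginal P a s (auxWealth t x c s)) := by
  obtain ⟨c, h⟩ := exists_isAuxOptimal hU hA ht hx.le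
  obtain ⟨I, hI, hIc⟩ := hU.exists_inverse_deriv
  set D : ℝ → ℝ := fun s => M.rightMarginal P a s (auxWealth t x c s) with hD
  have hDpos : ∀ s, t ≤ s → 0 < D s := fun s hs => h.rightMarginal_pos hU hA ht hs hx
  -- Freezing the marginal value before `t` yields a rate that is continuous and measurable on all
  -- of `ℝ`.
  have hDc : Continuous fun s => D (max t s) :=
    (h.continuousOn_rightMarginal hU hA ht hx).comp_continuous (by fun_prop)
      fun s => mem_Ici.2 (le_max_left _ _)
  set q : ℝ → ℝ := fun s => Real.exp ((M.rho + M.lam) * max t s) * D (max t s) with hq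
  have hq0 : ∀ s, 0 < q s := fun s => mul_pos (Real.exp_pos _) (hDpos _ (le_max_left _ _))
  have hqc : Continuous q := by
    refine Continuous.mul ?_ hDc
    fun_prop
  have hqs : ∀ s, t ≤ s → q s = Real.exp ((M.rho + M.lam) * s) * D s := fun s hs => by
    simp only [hq]
    rw [max_eq_right hs]
  have hc'c : Continuous fun s => I (q s) := hIc.comp_continuous hqc hq0
  -- Injectivity of `U'` identifies the optimal rate with `I ∘ q` almost everywhere. Both generate
  -- the same wealth, so the new rate is optimal and solves the feedback equation along its own
  -- path.
  have hcc : ∀ᵐ r ∂(volume.restrict (Ioi t)), c r = I (q r) := by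
    filter_upwards [h.ae_marginal_eq hU hA ht hx, ae_restrict_mem measurableSet_Ioi]
      with r hr htr
    obtain ⟨h1, -, h2⟩ := hr
    obtain ⟨h3, h4⟩ := hI _ (hq0 r)
    refine hU.strictAntiOn_deriv.injOn h1 h3 ?_
    rw [h4, hqs r (le_of_lt htr)]
    change _ = _ * M.rightMarginal P a r (auxWealth t x c r)
    rw [h2, ← mul_assoc, ← Real.exp_add,
      show (M.rho + M.lam) * r + -(M.rho + M.lam) * r = 0 by ring, Real.exp_zero, one_mul]
  refine ⟨fun s => I (q s), h.congr hc'c.measurable (fun s _ => (hI _ (hq0 s)).1.le) hcc, hc'c,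
    fun s hs => ⟨(hI _ (hq0 s)).1, ?_⟩⟩
  rw [(hI _ (hq0 s)).2, hqs s hs, ← auxWealth_congr hcc]

/-- Over a unit of time `U'(c)` increases by a factor of at most `exp (ρ + λ)`, since the marginal
value is nonincreasing. So `c s ≥ ε` would keep consumption above a fixed `δ` on `(s, s + 1]`,
whereas the unit increments of wealth tend to `0`. -/
theorem IsAuxOptimal.tendsto_zero (hU : M.UtilityAssumption k b) {t x a : ℝ} {c : ℝ → ℝ}
    (hA : M.AuxRegular P a) (ht : 0 ≤ t) (hx : M.l a < x) (h : M.IsAuxOptimal P t x a c)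
    (hc : ∀ s, t ≤ s → 0 < c s ∧ deriv M.U (c s) = Real.exp ((M.rho + M.lam) * s) *
      M.rightMarginal P a s (auxWealth t x c s)) : Tendsto c atTop (𝓝 0) := by
  rw [tendsto_order]
  refine ⟨fun y hy => ?_, fun ε hε => ?_⟩
  · filter_upwards [eventually_ge_atTop t] with s hs
    exact hy.trans (hc s hs).1
  have hβ := hA.rate_pos
  -- The level `δ` solves `U'(δ) = exp (ρ + λ) U'(ε)`.
  obtain ⟨δ, hδ, hδ'⟩ := hU.exists_deriv_eq
    (mul_pos (Real.exp_pos (M.rho + M.lam)) (hU.deriv_pos hε))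
  have h1 := h.1.tendsto_auxWealth_sub.eventually_lt_const hδ
  filter_upwards [h1, eventually_ge_atTop t] with s hs hts
  by_contra! hcon
  have hanti := hU.strictAntiOn_deriv
  have h2 : ∀ r ∈ Ioc s (s + 1), δ ≤ c r := by
    intro r hr
    obtain ⟨h3, h4⟩ := hc r (hts.trans hr.1.le)
    obtain ⟨h5, h6⟩ := hc s hts
    refine (hanti.le_iff_ge h3 hδ).1 ?_
    rw [hδ', h4]
    calc Real.exp ((M.rho + M.lam) * r) * M.rightMarginal P a r (auxWealth t x c r)
        ≤ Real.exp ((M.rho + M.lam) * (s + 1)) *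
          M.rightMarginal P a s (auxWealth t x c s) := by
          refine mul_le_mul (Real.exp_le_exp.2 (mul_le_mul_of_nonneg_left hr.2 hβ.le))
            (h.rightMarginal_anti hU hA ht hts hr.1.le hx)
            (h.rightMarginal_pos hU hA ht (hts.trans hr.1.le) hx).le (Real.exp_pos _).le
      _ = Real.exp (M.rho + M.lam) * deriv M.U (c s) := by
          rw [h6, ← mul_assoc, ← Real.exp_add]
          ring_nf
      _ ≤ _ := mul_le_mul_of_nonneg_left (hanti.antitoneOn hε h5 hcon) (Real.exp_pos _).le
  have h3 := h.1.auxWealth_sub hts (show s ≤ s + 1 by linarith)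
  have h4 : ∫ _ in Ioc s (s + 1), δ ≤ ∫ r in Ioc s (s + 1), c r :=
    setIntegral_mono_on (integrableOn_const (by simp))
      ((h.1.integrable (s + 1) (by linarith)).mono_set (Ioc_subset_Ioc_left hts))
      measurableSet_Ioc h2
  simp only [integral_const, smul_eq_mul, measureReal_restrict_apply, MeasurableSet.univ,
    univ_inter, Real.volume_real_Ioc_of_le (show s ≤ s + 1 by linarith)] at h4
  linarith

/-- At the least wealth the optimal rate vanishes. -/
theorem isAuxOptimal_zero (hU : M.UtilityAssumption k b) {t a : ℝ}
    (hA : M.AuxRegular P a) (ht : 0 ≤ t) : M.IsAuxOptimal P t (M.l a) a fun _ => 0 := by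
  obtain ⟨c, h⟩ := exists_isAuxOptimal (P := P) hU hA ht le_rfl
  refine h.congr measurable_const (fun _ _ => le_rfl) ?_
  have h1 := h.1.lintegral_le
  rw [sub_self, ENNReal.ofReal_zero, nonpos_iff_eq_zero,
    lintegral_eq_zero_iff h.1.measurable.ennreal_ofReal] at h1
  filter_upwards [h1, ae_restrict_mem measurableSet_Ioi] with s hs hts
  exact (ENNReal.ofReal_eq_zero.1 hs).antisymm (h.1.nonneg s (le_of_lt hts))

end IlliquidMarket

/-! ### The optimal couple in both cases -/

theorem mainTheorem10 {Ω : Type*} [MeasurableSpace Ω] (P : Measure Ω) [IsProbabilityMeasure P]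
    (M : IlliquidMarket Ω) (k b : ℝ)
    (hreturn : M.ReturnAssumption P k b) (hutility : M.UtilityAssumption k b)
    (hsemiconcave : M.SemiconcavityAssumption)
    (a : ℝ) (ha : a ∈ M.positions) (t x : ℝ) (ht : 0 ≤ t) (hx : M.l a ≤ x) :
    ∃ c : ℝ → ℝ,
      -- `c`, with its wealth, is the optimal couple: optimal, unique, and of feedback form
      M.IsAuxOptimal P t x a c ∧
      (∀ c' : ℝ → ℝ, M.IsAuxOptimal P t x a c' →
        ∀ᵐ s ∂(volume.restrict (Ici t)), c' s = c s) ∧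
      (∀ s, t ≤ s → M.l a < IlliquidMarket.auxWealth t x c s → 0 < c s ∧
        HasDerivAt (fun y => (M.auxValue P s y a).toReal) (deriv M.U (c s))
          (IlliquidMarket.auxWealth t x c s)) ∧
      -- the two cases
      (x = M.l a →
        ∀ s, t ≤ s → c s = 0 ∧ IlliquidMarket.auxWealth t x c s = M.l a) ∧
      (M.l a < x →
        ContinuousOn c (Ici t) ∧ (∀ s, t ≤ s → 0 < c s) ∧ Tendsto c atTop (𝓝 0)) := by
  have hA := IlliquidMarket.auxRegular hreturn hutility ha
  rcases hx.eq_or_lt with rfl | hlt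
  · have hopt := IlliquidMarket.isAuxOptimal_zero (P := P) hutility hA ht
    have hw : ∀ s, IlliquidMarket.auxWealth t (M.l a) (fun _ => 0) s = M.l a := fun s => by
      simp [IlliquidMarket.auxWealth]
    refine ⟨fun _ => 0, hopt, fun c' h' => h'.ae_eq hutility hA ht hx hopt,
      fun s _ hls => ?_, fun _ s _ => ⟨rfl, hw s⟩, fun h => absurd h (lt_irrefl _)⟩
    rw [hw s] at hls
    exact absurd hls (lt_irrefl _)
  · obtain ⟨c, hopt, hcont, hc⟩ :=
      IlliquidMarket.exists_isAuxOptimal_feedback (P := P) hutility hA ht hlt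
    refine ⟨c, hopt, fun c' h' => h'.ae_eq hutility hA ht hx hopt, fun s hs _ => ?_,
      fun h => absurd h hlt.ne', fun _ => ⟨hcont.continuousOn, fun s hs => (hc s hs).1,
        hopt.tendsto_zero hutility hA ht hlt hc⟩⟩
    refine ⟨(hc s hs).1, ?_⟩
    rw [(hc s hs).2]
    exact hopt.hasDerivAt_auxValue hutility hA ht hs hlt
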